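/- Let $\gamma\le 0$, $\omega>\gamma^2/4$ and $p\ge 5$ be real numbers. Consider the nonlinear Schrödinger equation on the line with a Dirac potential, $$ i\partial_t u=-\partial_x^2u-\gamma\,\delta(x)\,u-|u|^{p-1}u,\qquad u(0)=u_0\in H^1(\mathbb R)=H^1(\mathbb R,\mathbb C), \tag{NLS}$$ where $\langle\delta,v\rangle=v(0)$ for $v\in H^1(\mathbb R)$. A solution on $[0,T)$ is a function $u\in C([0,T),H^1(\mathbb R))\cap C^1([0,T),H^{-1}(\mathbb R))$ satisfying the equation in $H^{-1}(\mathbb R)$ for every $t\in[0,T)$. Let $$\varphi_{\omega,\gamma}(x)=\left[\frac{(p+1)\omega}{2}\,\mathrm{sech}^2\!\left(\frac{(p-1)\sqrt\omega}{2}|x|+\tanh^{-1}\!\Big(\frac{\gamma}{2\sqrt\omega}\Big)\right)\right]^{\frac1{p-1}} .$$ Then $\varphi_{\omega,\gamma}\in H^1(\mathbb R)\setminus\{0\}$ solves $-\partial_x^2\varphi+\omega\varphi-\gamma\delta\varphi-|\varphi|^{p-1}\varphi=0$ in $H^{-1}(\mathbb R)$, and the standing wave $e^{i\omega t}\varphi_{\omega,\gamma}(x)$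 of (NLS) is strongly unstable in $H^1(\mathbb R)$: for every $\varepsilon>0$ there are $u_\varepsilon\in H^1(\mathbb R)$ with $\|u_\varepsilon-\varphi_{\omega,\gamma}\|_{H^1}<\varepsilon$ and $0<T<\infty$ such that the solution $u$ of (NLS) with $u(0)=u_\varepsilon$ exists on $[0,T)$, is unique, cannot be continued beyond $T$, and satisfies $\lim_{t\uparrow T}\|\partial_xu(t)\|_{L^2}=+\infty$. -/

import Mathlib

/-! # The nonlinear Schrödinger equation on the line with a Dirac potential -/

noncomputable section

namespace DeltaNLS

open MeasureTheory Set Filter Topology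
open scoped ComplexConjugate

section Sobolev

open scoped ContDiff

/-! ## The Sobolev space `H¹(ℝ)` of complex-valued functions -/

/-- `L²(ℝ, ℂ)`. -/
abbrev L2 : Type := Lp ℂ 2 (volume : Measure ℝ)

/-- `g` is the weak derivative of `f` on the line. -/
def HasWeakDeriv (f g : ℝ → ℂ) : Prop :=
  ∀ η : ℝ → ℝ, ContDiff ℝ ∞ η → HasCompactSupport η →
    ∫ x, deriv η x • f x = - ∫ x, η x • g x

theorem L2.integrable_smul (f : L2) {η : ℝ → ℝ} (hη : Continuous η)
    (hc : HasCompactSupport η) : Integrable (fun x => η x • f x) :=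
  ((Lp.memLp f).locallyIntegrable (by norm_num)).integrable_smul_left_of_hasCompactSupport hη hc

/-- The Hilbert space `H¹(ℝ)`: pairs `(f, f')` in `L² × L²` with `f'` the weak derivative of `f`,
with the norm `‖v‖² = ‖f‖² + ‖f'‖²` and its complex inner product. -/
def sobolevH1 : Submodule ℂ (WithLp 2 (L2 × L2)) where
  carrier := {v | HasWeakDeriv v.fst v.snd}
  zero_mem' := by
    intro η _ _
    have h1 : ∫ x, deriv η x • (0 : L2) x = 0 := by
      refine integral_eq_zero_of_ae ?_
      filter_upwards [Lp.coeFn_zero ℂ 2 (volume : Measure ℝ)] with x _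
      simp
    have h2 : ∫ x, η x • (0 : L2) x = 0 := by
      refine integral_eq_zero_of_ae ?_
      filter_upwards [Lp.coeFn_zero ℂ 2 (volume : Measure ℝ)] with x _
      simp
    change ∫ x, deriv η x • (0 : L2) x = - ∫ x, η x • (0 : L2) x
    rw [h1, h2, neg_zero]
  add_mem' := by
    intro v w hv hw η hη hc
    have key : ∀ (f g : L2) (ξ : ℝ → ℝ), Continuous ξ → HasCompactSupport ξ →
        ∫ x, ξ x • (f + g : L2) x = (∫ x, ξ x • f x) + ∫ x, ξ x • g x := by
      intro f g ξ h1 h2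
      rw [← integral_add (L2.integrable_smul f h1 h2) (L2.integrable_smul g h1 h2)]
      refine integral_congr_ae ?_
      filter_upwards [Lp.coeFn_add f g] with x hx
      rw [hx, Pi.add_apply, smul_add]
    have hd : Continuous (deriv η) := hη.continuous_deriv (by simp)
    change ∫ x, deriv η x • (v.fst + w.fst : L2) x = - ∫ x, η x • (v.snd + w.snd : L2) x
    rw [key _ _ _ hd hc.deriv, key _ _ _ hη.continuous hc, hv η hη hc, hw η hη hc]
    ring
  smul_mem' := by
    intro c v hv η hη hc
    have key : ∀ (f : L2) (ξ : ℝ → ℝ), ∫ x, ξ x • (c • f : L2) x = c * ∫ x, ξ x • f x := by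
      intro f ξ
      rw [← integral_const_mul]
      refine integral_congr_ae ?_
      filter_upwards [Lp.coeFn_smul c f] with x hx
      rw [hx, Pi.smul_apply, smul_eq_mul, mul_smul_comm]
    change ∫ x, deriv η x • (c • v.fst : L2) x = - ∫ x, η x • (c • v.snd : L2) x
    rw [key, key, hv η hη hc]
    ring

/-- The type of elements of `H¹(ℝ)`. -/
def H1 : Type := sobolevH1

instance : NormedAddCommGroup H1 := inferInstanceAs (NormedAddCommGroup sobolevH1)

instance : InnerProductSpace ℂ H1 := inferInstanceAs (InnerProductSpace ℂ sobolevH1)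

/-- The inclusion of `H¹(ℝ)` into `L²(ℝ)`. -/
def H1.toL2 : H1 →L[ℂ] L2 :=
  ((WithLp.fstL 2 ℂ L2 L2).comp sobolevH1.subtypeL : sobolevH1 →L[ℂ] L2)

/-- The weak derivative, as a map from `H¹(ℝ)` to `L²(ℝ)`. -/
def H1.dx : H1 →L[ℂ] L2 :=
  ((WithLp.sndL 2 ℂ L2 L2).comp sobolevH1.subtypeL : sobolevH1 →L[ℂ] L2)

theorem H1.hasWeakDeriv (v : H1) : HasWeakDeriv v.toL2 v.dx := v.2

theorem exists_support_subset_Ioc {η : ℝ → ℝ} (hc : HasCompactSupport η) :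
    ∃ R : ℝ, 0 < R ∧ tsupport η ⊆ Ioo (-R) R := by
  obtain ⟨R, hR⟩ := hc.isCompact.isBounded.subset_ball_lt 0 0
  refine ⟨R, hR.1, hR.2.trans ?_⟩
  rw [Real.ball_eq_Ioo]
  simp

theorem integral_deriv_mul_primitive {g : ℝ → ℝ} (hg : LocallyIntegrable g) {η : ℝ → ℝ}
    (hη : ContDiff ℝ ∞ η) (hc : HasCompactSupport η) :
    ∫ x, deriv η x * (∫ t in (0 : ℝ)..x, g t) = - ∫ x, η x * g x := by
  obtain ⟨R, hR, hs⟩ := exists_support_subset_Ioc hc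
  have hgi : ∀ a b, IntervalIntegrable g volume a b := fun a b =>
    (hg.integrableOn_isCompact isCompact_uIcc).intervalIntegrable
  have hη0 : ∀ x, x ∉ Ioo (-R) R → η x = 0 := fun x hx => by
    by_contra h
    exact hx (hs (subset_tsupport _ h))
  have hηR : η R = 0 := hη0 R (by simp)
  have hηR' : η (-R) = 0 := hη0 (-R) (by simp)
  have s1 : Function.support (fun x => deriv η x * (∫ t in (0 : ℝ)..x, g t)) ⊆ Ioc (-R) R := by
    intro x hx
    have : deriv η x ≠ 0 := left_ne_zero_of_mul hx
    exact Ioo_subset_Ioc_self (hs (support_deriv_subset this))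
  have s2 : Function.support (fun x => η x * g x) ⊆ Ioc (-R) R := by
    intro x hx
    have : η x ≠ 0 := left_ne_zero_of_mul hx
    exact Ioo_subset_Ioc_self (hs (subset_tsupport _ this))
  rw [← intervalIntegral.integral_eq_integral_of_support_subset s1,
    ← intervalIntegral.integral_eq_integral_of_support_subset s2]
  have h0 : (0 : ℝ) ∈ uIcc (-R) R := by
    rw [uIcc_of_le (by linarith)]
    constructor <;> linarith
  have hG := (hgi (-R) R).absolutelyContinuousOnInterval_intervalIntegral h0
  have hηac : AbsolutelyContinuousOnInterval η (-R) R :=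
    ContDiffOn.absolutelyContinuousOnInterval (hη.of_le (by simp)).contDiffOn
  have ibp := hηac.integral_mul_deriv_eq_deriv_mul hG
  rw [hηR, hηR'] at ibp
  have h3 : ∫ x in (-R)..R, η x * deriv (fun x => ∫ t in (0 : ℝ)..x, g t) x
      = ∫ x in (-R)..R, η x * g x := by
    refine intervalIntegral.integral_congr_ae ?_
    filter_upwards [LocallyIntegrable.ae_hasDerivAt_integral hg] with x hx _
    rw [(hx 0).deriv]
  rw [h3] at ibp
  linarith

theorem hasWeakDeriv_primitive {g : ℝ → ℂ} (hg : LocallyIntegrable g) :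
    HasWeakDeriv (fun x => ∫ t in (0 : ℝ)..x, g t) g := by
  intro η hη hc
  have hgi : ∀ a b, IntervalIntegrable g volume a b := fun a b =>
    (hg.integrableOn_isCompact isCompact_uIcc).intervalIntegrable
  have hGc : Continuous (fun x => ∫ t in (0 : ℝ)..x, g t) :=
    intervalIntegral.continuous_primitive hgi 0
  have hd : Continuous (deriv η) := hη.continuous_deriv (by simp)
  have i1 : Integrable (fun x => deriv η x • ∫ t in (0 : ℝ)..x, g t) :=
    hGc.locallyIntegrable.integrable_smul_left_of_hasCompactSupport hd hc.deriv
  have i2 : Integrable (fun x => η x • g x) :=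
    hg.integrable_smul_left_of_hasCompactSupport hη.continuous hc
  have key : ∀ L : ℂ →L[ℝ] ℝ, L (∫ x, deriv η x • ∫ t in (0 : ℝ)..x, g t)
      = L (- ∫ x, η x • g x) := by
    intro L
    have hLg : LocallyIntegrable (fun x => L (g x)) := by
      intro x
      obtain ⟨s, hs, hi⟩ := hg x
      exact ⟨s, hs, L.integrable_comp hi⟩
    have := integral_deriv_mul_primitive hLg hη hc
    rw [map_neg, ← L.integral_comp_comm i1, ← L.integral_comp_comm i2]
    simp only [map_smul, smul_eq_mul]
    rw [← this]
    refine integral_congr_ae (Eventually.of_forall fun x => ?_)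
    simp only
    rw [L.intervalIntegral_comp_comm (hgi 0 x)]
  exact Complex.ext (key Complex.reCLM) (key Complex.imCLM)

theorem ae_eq_const_of_integral_deriv_smul {h : ℝ → ℂ} (hh : LocallyIntegrable h)
    (h0 : ∀ η : ℝ → ℝ, ContDiff ℝ ∞ η → HasCompactSupport η → ∫ x, deriv η x • h x = 0) :
    ∃ c : ℂ, h =ᵐ[volume] fun _ => c := by
  let b : ContDiffBump (0 : ℝ) := ⟨1, 2, by norm_num, by norm_num⟩
  set ρ : ℝ → ℝ := b.normed volume with hρ
  have hρs : ContDiff ℝ ∞ ρ := b.contDiff_normed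
  have hρc : HasCompactSupport ρ := b.hasCompactSupport_normed
  have hρi : ∫ x, ρ x = 1 := b.integral_normed
  set c : ℂ := ∫ x, ρ x • h x with hc
  refine ⟨c, ?_⟩
  have hk : LocallyIntegrable (fun x => h x - c) := hh.sub (locallyIntegrable_const c)
  have := ae_eq_zero_of_integral_contDiff_smul_eq_zero hk (fun ψ hψ hψc => ?_)
  · filter_upwards [this] with x hx
    exact sub_eq_zero.mp hx
  set m : ℝ := ∫ x, ψ x with hm
  set ζ : ℝ → ℝ := fun x => ψ x - m * ρ x with hζ
  have hζs : ContDiff ℝ ∞ ζ := hψ.sub (contDiff_const.mul hρs)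
  have hζc : HasCompactSupport ζ := hψc.sub (hρc.mul_left (f := fun _ => m))
  have hψi : Integrable ψ := hψ.continuous.integrable_of_hasCompactSupport hψc
  have hρint : Integrable ρ := hρs.continuous.integrable_of_hasCompactSupport hρc
  have hζi : Integrable ζ := hζs.continuous.integrable_of_hasCompactSupport hζc
  have hζ0 : ∫ x, ζ x = 0 := by
    simp only [hζ]
    rw [integral_sub hψi (hρint.const_mul m), integral_const_mul, hρi, ← hm]
    ring
  obtain ⟨R, hR, hs⟩ := exists_support_subset_Ioc hζc
  have hζz : ∀ x, x ∉ Ioo (-R) R → ζ x = 0 := fun x hx => by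
    by_contra h
    exact hx (hs (subset_tsupport _ h))
  set Z : ℝ → ℝ := fun x => ∫ t in (-R)..x, ζ t with hZ
  have hZd : ∀ x, HasDerivAt Z (ζ x) x := fun x =>
    intervalIntegral.integral_hasDerivAt_right (hζi.intervalIntegrable)
      (hζs.continuous.stronglyMeasurableAtFilter _ _) hζs.continuous.continuousAt
  have hZderiv : deriv Z = ζ := funext fun x => (hZd x).deriv
  have hZs : ContDiff ℝ ∞ Z := by
    rw [contDiff_infty_iff_deriv]
    exact ⟨fun x => (hZd x).differentiableAt, hZderiv ▸ hζs⟩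
  have hZc : HasCompactSupport Z := by
    refine HasCompactSupport.intro (isCompact_Icc (a := -R) (b := R)) (fun x hx => ?_)
    by_cases h1 : x < -R
    · refine intervalIntegral.integral_zero_ae (Eventually.of_forall fun t ht => hζz t ?_)
      rw [uIoc_of_ge h1.le] at ht
      intro h
      linarith [ht.2, h.1]
    · have h2 : R < x := by
        by_contra h2
        exact hx ⟨not_lt.mp h1, not_lt.mp h2⟩
      rw [← hζ0]
      refine intervalIntegral.integral_eq_integral_of_support_subset (fun t ht => ?_)
      by_contra h
      exact ht (hζz t fun h' => h ⟨h'.1, h'.2.le.trans h2.le⟩)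
  have e := h0 Z hZs hZc
  rw [hZderiv] at e
  have i1 : Integrable (fun x => ψ x • h x) :=
    hh.integrable_smul_left_of_hasCompactSupport hψ.continuous hψc
  have i2 : Integrable (fun x => ρ x • h x) :=
    hh.integrable_smul_left_of_hasCompactSupport hρs.continuous hρc
  have e2 : ∫ x, ζ x • h x = (∫ x, ψ x • h x) - m • c := by
    rw [hc, ← integral_smul, ← integral_sub i1 (i2.fun_smul m)]
    refine integral_congr_ae (Eventually.of_forall fun x => ?_)
    simp only [hζ, sub_smul, mul_smul]
  simp only [smul_sub]
  rw [integral_sub i1 (hψi.smul_const c), integral_smul_const, ← hm, ← e2, e]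

/-- Every element of `H¹(ℝ)` has a continuous representative. -/
theorem H1.exists_continuous_rep (v : H1) :
    ∃ f : ℝ → ℂ, Continuous f ∧ (v.toL2 : ℝ → ℂ) =ᵐ[volume] f := by
  have hf : LocallyIntegrable (v.toL2 : ℝ → ℂ) :=
    (Lp.memLp v.toL2).locallyIntegrable (by norm_num)
  have hg : LocallyIntegrable (v.dx : ℝ → ℂ) :=
    (Lp.memLp v.dx).locallyIntegrable (by norm_num)
  have hGc : Continuous (fun x => ∫ t in (0 : ℝ)..x, v.dx t) :=
    intervalIntegral.continuous_primitive (fun a b =>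
    (hg.integrableOn_isCompact isCompact_uIcc).intervalIntegrable) 0
  obtain ⟨c, hc⟩ := ae_eq_const_of_integral_deriv_smul (hf.sub hGc.locallyIntegrable)
    (fun η hη hηc => by
      have hd : Continuous (deriv η) := hη.continuous_deriv (by simp)
      have e1 := v.hasWeakDeriv η hη hηc
      have e2 := hasWeakDeriv_primitive hg η hη hηc
      simp only [Pi.sub_apply, smul_sub]
      rw [integral_sub (hf.integrable_smul_left_of_hasCompactSupport hd hηc.deriv)
        (hGc.locallyIntegrable.integrable_smul_left_of_hasCompactSupport hd hηc.deriv), e1, e2,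
        sub_self])
  refine ⟨fun x => c + ∫ t in (0 : ℝ)..x, v.dx t, continuous_const.add hGc, ?_⟩
  filter_upwards [hc] with x hx
  rw [← hx]
  simp

/-- The (unique) continuous representative of an element of `H¹(ℝ)`. -/
def H1.rep (v : H1) : ℝ → ℂ := v.exists_continuous_rep.choose

theorem H1.continuous_rep (v : H1) : Continuous v.rep := v.exists_continuous_rep.choose_spec.1

theorem H1.coeFn_ae_eq_rep (v : H1) : (v.toL2 : ℝ → ℂ) =ᵐ[volume] v.rep :=
  v.exists_continuous_rep.choose_spec.2

end Sobolev

/-! ## The dual space `H⁻¹(ℝ)` -/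

/-- `H⁻¹(ℝ)`: the continuous conjugate-linear functionals on `H¹(ℝ)`, with the dual norm. -/
abbrev Hm1 : Type := H1 →L⋆[ℂ] ℂ

/-- The canonical embedding `H¹(ℝ) → H⁻¹(ℝ)`, `v ↦ (w ↦ ∫ v w̄)`. -/
def H1.toHm1 (v : H1) : Hm1 := ((innerSL ℂ).flip v.toL2).comp H1.toL2

theorem H1.toHm1_apply (v w : H1) : v.toHm1 w = ∫ x, v.rep x * conj (w.rep x) := by
  change inner ℂ w.toL2 v.toL2 = _
  rw [L2.inner_def]
  refine integral_congr_ae ?_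
  filter_upwards [v.coeFn_ae_eq_rep, w.coeFn_ae_eq_rep] with x hv hw
  simp [hv, hw]

/-! ## The equation `i ∂ₜu = -∂ₓ²u - γ δ u - |u|^(p-1) u` -/

/-- The pairing `⟨-∂ₓ²v - γ δ v - |v|^(p-1) v, w⟩` of an element of `H⁻¹(ℝ)` with `w ∈ H¹(ℝ)`. -/
def nlsForm (γ p : ℝ) (v w : H1) : ℂ :=
  (∫ x, v.dx x * conj (w.dx x)) - γ * (v.rep 0 * conj (w.rep 0))
    - ∫ x, ((‖v.rep x‖ ^ (p - 1) : ℝ) : ℂ) * v.rep x * conj (w.rep x)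

/-- `u ∈ C([0,T), H¹(ℝ)) ∩ C¹([0,T), H⁻¹(ℝ))` solves the equation on `[0,T)`, as an equality in
`H⁻¹(ℝ)` (at `t = 0` the time derivative is one-sided). -/
def IsSolution (γ p T : ℝ) (u : ℝ → H1) : Prop :=
  ContinuousOn u (Ico 0 T) ∧
  ∃ u' : ℝ → Hm1, ContinuousOn u' (Ico 0 T) ∧
    ∀ t ∈ Ico 0 T, HasDerivWithinAt (fun s => (u s).toHm1) (u' t) (Ico 0 T) t ∧
      ∀ w : H1, Complex.I * u' t w = nlsForm γ p (u t) w

/-- `φ ∈ H¹(ℝ) \ {0}` solves `-φ'' + ω φ - γ δ φ - |φ|^(p-1) φ = 0`, that is, `e^{iωt} φ(x)` is a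
standing wave. -/
def IsStandingWave (γ ω p : ℝ) (φ : H1) : Prop :=
  φ ≠ 0 ∧ ∀ w : H1, nlsForm γ p φ w + ω * φ.toHm1 w = 0

/-- The solution with initial value `u₀` exists on `[0,T)`, it is unique and cannot be
continued, and `‖∂ₓu(t)‖` tends to `∞` as `t ↑ T`. -/
def BlowsUpAt (γ p T : ℝ) (u₀ : H1) : Prop :=
  ∃ u : ℝ → H1, IsSolution γ p T u ∧ u 0 = u₀ ∧
    (∀ (T' : ℝ) (v : ℝ → H1), IsSolution γ p T' v → v 0 = u₀ →
      T' ≤ T ∧ EqOn v u (Ico 0 T')) ∧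
    Tendsto (fun t => ‖(u t).dx‖) (𝓝[<] T) atTop

/-- The standing wave `e^{iωt} φ(x)` is strongly unstable in `H¹(ℝ)`. -/
def IsStronglyUnstable (γ ω p : ℝ) (φ : H1) : Prop :=
  IsStandingWave γ ω p φ ∧
  ∀ ε > 0, ∃ u₀ : H1, ‖u₀ - φ‖ < ε ∧ ∃ T : ℝ, 0 < T ∧ BlowsUpAt γ p T u₀

/-- The explicit profile
`[(p+1)ω/2 · sech²((p-1)√ω/2 · |x| + artanh(γ/(2√ω)))]^(1/(p-1))`. -/
def profile (γ ω p x : ℝ) : ℝ :=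
  ((p + 1) * ω / 2 *
    (1 / Real.cosh ((p - 1) * √ω / 2 * |x| + Real.artanh (γ / (2 * √ω)))) ^ 2) ^ (1 / (p - 1))

end DeltaNLS

end

noncomputable section

namespace DeltaNLS

open MeasureTheory Set Filter Topology
open scoped ComplexConjugate ContDiff

/-! ### Primitives of locally integrable functions: chain rule, product rule, integration by parts.
-/

section Primitive

/-! The proof is instability by blow-up. Put `κ² = -γ`, let `S` be the action (energy plus `ω/2`
times the mass), let `N(v) = ∫ |v|^(p+1)`, and let `P` be the virial functional `H1.pohozaev`, which
vanishes at the standing wave `φ`. The initial value is `μ φ` with `μ > 1` close to `1`: it is real,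
even, of finite variance, with `S(μ φ) < S(φ)` and `P(μ φ) < 0` (`action_smul_lt`,
`pohozaev_smul_neg`). For every even `v ≠ 0` with `P(v) ≤ 0` one has `S(φ) ≤ S(v) - P(v)/2`
(`action_solitonH1_le`). The flow preserves parity, mass and energy, so by continuity in time
`P(u(t)) ≤ -δ` with `δ = 2 (S(φ) - S(u(0))) > 0` as long as the solution exists
(`EvolvesOn.pohozaev_le`). Since the second derivative of `∫ x² |u|²` is `8 P(u)` and the first
vanishes at `t = 0` for real data, `4 δ t² ≤ ∫ x² |u(0)|²` (`EvolvesOn.virial_inequality`), and the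
solution cannot be global. The blow-up alternative makes the norm tend to infinity; the mass being
conserved, it is the gradient that does so.

The variational inequality is obtained without compactness. Let `v_l(x) = √l v(l x)`, with `l` such
that `N(v_l) = N(φ)`. A calibration argument of Modica-Mortola type (`calibration_Ioi`,
`calibration`) shows that `φ` minimizes the quadratic part of `S` among even functions with its
value of `N` (`potential_solitonH1_le`), hence `S(φ) ≤ S(v_l)`. Bernoulli's inequality with exponent
`(p-1)/4 ≥ 1` then compares `S(v_l) - l² P(v)/2` with `S(v) - P(v)/2`; this is where `p ≥ 5` matters
for the dynamics.

For the Cauchy problem, `H¹` is given the norm of the form of `-∂ₓ² + κ² δ + 1`. The inverse `J` of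
this operator is a bounded injective self-adjoint operator, and the free evolution is `U(t) =
e^{-it(1/J - 1)}`, constructed by continuous functional calculus. In the interaction picture `v(t) =
U(-t) u(t)` the equation becomes an ordinary differential equation with locally Lipschitz field
(`evolvesOn_iff`), and `isSolution_iff` identifies its solutions with those of the equation in
`H⁻¹`.

Solutions are not differentiable in `H¹`. Conservation laws and virial identities therefore rest on
two substitutes: the expansion `u(s) = U(s - t) u(t) + r(s)` with `r(t) = 0` and `r'(t) = i
|u(t)|^(p-1) u(t)`, and the fact that `‖u(s) - u(t)‖²` in `L²` is `o(s - t)`. -/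

theorem absolutelyContinuousOnInterval_of_dist_le {X : Type*} [PseudoMetricSpace X] {f : ℝ → X}
    {h : ℝ → ℝ} {a b K : ℝ} (hh : AbsolutelyContinuousOnInterval h a b)
    (hf : ∀ x ∈ uIcc a b, ∀ y ∈ uIcc a b, dist (f x) (f y) ≤ K * dist (h x) (h y)) :
    AbsolutelyContinuousOnInterval f a b := by
  rw [absolutelyContinuousOnInterval_iff] at hh ⊢
  intro ε hε
  obtain ⟨δ, hδ, H⟩ := hh (ε / (|K| + 1)) (by positivity)
  refine ⟨δ, hδ, fun E hE hlt => ?_⟩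
  have h1 := H E hE hlt
  calc ∑ i ∈ Finset.range E.1, dist (f (E.2 i).1) (f (E.2 i).2)
      ≤ ∑ i ∈ Finset.range E.1, (|K| + 1) * dist (h (E.2 i).1) (h (E.2 i).2) := by
        refine Finset.sum_le_sum fun i hi => ?_
        have hm := hE.1 i hi
        refine (hf _ hm.1 _ hm.2).trans ?_
        gcongr
        linarith [le_abs_self K]
    _ = (|K| + 1) * ∑ i ∈ Finset.range E.1, dist (h (E.2 i).1) (h (E.2 i).2) := by
        rw [Finset.mul_sum]
    _ < (|K| + 1) * (ε / (|K| + 1)) := by gcongr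
    _ = ε := by field_simp

theorem locallyIntegrable_norm {E : Type*} [NormedAddCommGroup E] {g : ℝ → E}
    (hg : LocallyIntegrable g) :
    LocallyIntegrable (fun t => ‖g t‖) := fun x =>
  let ⟨s, hs, hi⟩ := hg x
  ⟨s, hs, hi.norm⟩

theorem LocallyIntegrable.intervalIntegrable' {E : Type*} [NormedAddCommGroup E] {g : ℝ → E}
    (hg : LocallyIntegrable g) (a b : ℝ) :
    IntervalIntegrable g volume a b :=
  (hg.integrableOn_isCompact isCompact_uIcc).intervalIntegrable

variable {E F : Type*} [NormedAddCommGroup E] [NormedSpace ℝ E]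
  [NormedAddCommGroup F] [NormedSpace ℝ F]

/-- `f` is a primitive of the locally integrable function `g` on the line. -/
structure IsPrimitive (f g : ℝ → E) : Prop where
  locInt : LocallyIntegrable g
  sub_eq : ∀ x y, f y - f x = ∫ t in x..y, g t

theorem IsPrimitive.continuous {f g : ℝ → E} (h : IsPrimitive f g) : Continuous f := by
  have : f = fun x => f 0 + ∫ t in (0 : ℝ)..x, g t := by
    funext x
    rw [← h.sub_eq]; abel
  rw [this]
  exact continuous_const.add (intervalIntegral.continuous_primitive
    (fun a b => LocallyIntegrable.intervalIntegrable' h.locInt a b) 0)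

theorem IsPrimitive.ae_hasDerivAt [CompleteSpace E] {f g : ℝ → E} (h : IsPrimitive f g) :
    ∀ᵐ x, HasDerivAt f (g x) x := by
  filter_upwards [LocallyIntegrable.ae_hasDerivAt_integral h.locInt] with x hx
  have : f = fun x => f 0 + ∫ t in (0 : ℝ)..x, g t := by
    funext x
    rw [← h.sub_eq]; abel
  rw [this]
  exact (hx 0).const_add _

/-- The real-valued primitive of `‖g‖` dominates the increments of `f`, so absolute continuity of
vector-valued primitives and of their Lipschitz images reduces to the scalar case. -/
theorem IsPrimitive.dist_le {f g : ℝ → E} (h : IsPrimitive f g) (x y : ℝ) :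
    dist (f x) (f y) ≤ dist (∫ t in (0 : ℝ)..x, ‖g t‖) (∫ t in (0 : ℝ)..y, ‖g t‖) := by
  have hn : LocallyIntegrable (fun t => ‖g t‖) := locallyIntegrable_norm h.locInt
  rw [dist_comm, dist_eq_norm, h.sub_eq, dist_comm, Real.dist_eq,
    intervalIntegral.integral_interval_sub_left (LocallyIntegrable.intervalIntegrable' hn _ _)
      (LocallyIntegrable.intervalIntegrable' hn _ _)]
  exact intervalIntegral.norm_integral_le_abs_integral_norm

theorem IsPrimitive.absolutelyContinuousOnInterval {f g : ℝ → E} (h : IsPrimitive f g)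
    (a b : ℝ) : AbsolutelyContinuousOnInterval f a b := by
  have hn : LocallyIntegrable (fun t => ‖g t‖) := locallyIntegrable_norm h.locInt
  have h2 : AbsolutelyContinuousOnInterval (fun x => ∫ t in a..x, ‖g t‖) a b :=
    (LocallyIntegrable.intervalIntegrable' hn
      a b).absolutelyContinuousOnInterval_intervalIntegral left_mem_uIcc
  refine absolutelyContinuousOnInterval_of_dist_le (K := 1) h2 fun x _ y _ => ?_
  refine (h.dist_le x y).trans ?_
  have i := fun a b => LocallyIntegrable.intervalIntegrable' hn a b
  rw [one_mul, Real.dist_eq, Real.dist_eq, intervalIntegral.integral_interval_sub_left (i _ _)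
    (i _ _), intervalIntegral.integral_interval_sub_left (i _ _) (i _ _)]

theorem isPrimitive_integral {g : ℝ → E} (hg : LocallyIntegrable g) (a : ℝ) :
    IsPrimitive (fun x => ∫ t in a..x, g t) g :=
  ⟨hg, fun _ _ => intervalIntegral.integral_interval_sub_left
      (LocallyIntegrable.intervalIntegrable' hg _ _) (LocallyIntegrable.intervalIntegrable' hg _ _)⟩

/-- The chain rule for primitives. -/
theorem IsPrimitive.comp [CompleteSpace E] [ProperSpace E] [CompleteSpace F] {f g : ℝ → E}
    (h : IsPrimitive f g) {Φ : E → F} (hΦ : ContDiff ℝ 1 Φ) :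
    IsPrimitive (fun x => Φ (f x)) (fun x => fderiv ℝ Φ (f x) (g x)) := by
  have hc := h.continuous
  have hd : Continuous fun x => fderiv ℝ Φ (f x) :=
    (hΦ.continuous_fderiv (by simp)).comp hc
  have hl : LocallyIntegrable (fun x => fderiv ℝ Φ (f x) (g x)) := by
    rw [locallyIntegrable_iff]
    intro k hk
    obtain ⟨C, hC⟩ := (hk.image hd).isBounded.exists_norm_le
    have hgk := h.locInt.integrableOn_isCompact hk
    refine Integrable.mono' (hgk.norm.const_mul C) ?_ ?_
    · exact isBoundedBilinearMap_apply.continuous.comp_aestronglyMeasurable₂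
        hd.aestronglyMeasurable hgk.aestronglyMeasurable
    · filter_upwards [ae_restrict_mem hk.measurableSet] with x hx
      exact (ContinuousLinearMap.le_opNorm _ _).trans
        (mul_le_mul_of_nonneg_right (hC _ ⟨x, hx, rfl⟩) (norm_nonneg _))
  refine ⟨hl, fun a b => ?_⟩
  -- `Φ` is Lipschitz on a ball containing the compact image of `f`, so `Φ ∘ f` is absolutely
  -- continuous. It then differs by a constant from the integral of its almost everywhere
  -- derivative.
  obtain ⟨R, hR⟩ := ((isCompact_uIcc (a := a) (b := b)).image hc).isBounded.subset_closedBall 0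
  have hcd : ContDiffOn ℝ 1 Φ (Metric.closedBall (0 : E) R) := hΦ.contDiffOn
  obtain ⟨K, hK⟩ : ∃ K, LipschitzOnWith K Φ (Metric.closedBall (0 : E) R) :=
    hcd.exists_lipschitzOnWith one_ne_zero (convex_closedBall _ _) (isCompact_closedBall _ _)
  have hlip : ∀ x ∈ uIcc a b, ∀ y ∈ uIcc a b, dist (Φ (f x)) (Φ (f y)) ≤
      (K : ℝ) * dist (∫ t in (0 : ℝ)..x, ‖g t‖) (∫ t in (0 : ℝ)..y, ‖g t‖) := by
    intro x hx y hy
    have hx' : f x ∈ Metric.closedBall (0 : E) R := hR (mem_image_of_mem f hx)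
    have hy' : f y ∈ Metric.closedBall (0 : E) R := hR (mem_image_of_mem f hy)
    refine (hK.dist_le_mul (f x) hx' (f y) hy').trans ?_
    gcongr
    exact h.dist_le x y
  have hfac := (isPrimitive_integral (locallyIntegrable_norm h.locInt)
    0).absolutelyContinuousOnInterval a b
  have ac1 : AbsolutelyContinuousOnInterval (fun x => Φ (f x)) a b :=
    absolutelyContinuousOnInterval_of_dist_le hfac hlip
  have hp := isPrimitive_integral hl a
  have ac2 := hp.absolutelyContinuousOnInterval a b
  have hd0 : ∀ᵐ x, x ∈ uIcc a b → HasDerivAt ((fun x => Φ (f x)) -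
      fun x => ∫ t in a..x, fderiv ℝ Φ (f t) (g t)) 0 x := by
    filter_upwards [h.ae_hasDerivAt, hp.ae_hasDerivAt] with x h1 h2 _
    have h3 : HasDerivAt (fun x => Φ (f x)) (fderiv ℝ Φ (f x) (g x)) x :=
      ((hΦ.differentiable one_ne_zero) (f x)).hasFDerivAt.comp_hasDerivAt x h1
    have h4 := h3.sub h2
    rw [sub_self] at h4
    exact h4
  obtain ⟨C, hC⟩ := (ac1.sub ac2).const_of_ae_hasDerivAt_zero hd0
  have e1 := hC a left_mem_uIcc
  have e2 := hC b right_mem_uIcc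
  simp only [Pi.sub_apply, intervalIntegral.integral_same, sub_zero] at e1 e2
  rw [e1, ← e2]; abel

/-- Product rules become instances of the chain rule, applied to a bilinear `Φ` on pairs. -/
theorem IsPrimitive.prodMk {f g : ℝ → E} {f' g' : ℝ → F} [CompleteSpace E] [CompleteSpace F]
    (h : IsPrimitive f g)
    (h' : IsPrimitive f' g') : IsPrimitive (fun x => (f x, f' x)) (fun x => (g x, g' x)) := by
  have hl : LocallyIntegrable (fun x => (g x, g' x)) := by
    rw [locallyIntegrable_iff]
    intro k hk
    exact (h.locInt.integrableOn_isCompact hk).prodMk (h'.locInt.integrableOn_isCompact hk)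
  refine ⟨hl, fun x y => ?_⟩
  have hi := LocallyIntegrable.intervalIntegrable' hl x y
  refine Prod.ext ?_ ?_
  · have := (ContinuousLinearMap.fst ℝ E F).intervalIntegral_comp_comm hi
    simp only [ContinuousLinearMap.coe_fst'] at this
    rw [Prod.fst_sub, h.sub_eq, ← this]
  · have := (ContinuousLinearMap.snd ℝ E F).intervalIntegral_comp_comm hi
    simp only [ContinuousLinearMap.coe_snd'] at this
    rw [Prod.snd_sub, h'.sub_eq, ← this]

theorem isPrimitive_of_hasDerivAt [CompleteSpace E] {f g : ℝ → E}
    (h : ∀ x, HasDerivAt f (g x) x) (hg : Continuous g) : IsPrimitive f g :=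
  ⟨hg.locallyIntegrable, fun _ _ => (intervalIntegral.integral_eq_sub_of_hasDerivAt
    (fun t _ => h t) (hg.intervalIntegrable _ _)).symm⟩

theorem IsPrimitive.integral_eq {f g : ℝ → E} {l₁ l₂ : E} [CompleteSpace E]
    (h : IsPrimitive f g) (hg : Integrable g)
    (h1 : Tendsto f atBot (𝓝 l₁)) (h2 : Tendsto f atTop (𝓝 l₂)) : ∫ x, g x = l₂ - l₁ := by
  have e := intervalIntegral_tendsto_integral (a := fun n : ℝ => -n) (b := fun n : ℝ => n)
    hg tendsto_neg_atTop_atBot tendsto_id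
  refine tendsto_nhds_unique e ?_
  simp only [← h.sub_eq]
  exact (h2.comp tendsto_id).sub (h1.comp tendsto_neg_atTop_atBot)

theorem IsPrimitive.integral_Ioi_eq {f g : ℝ → E} {l : E} [CompleteSpace E] (a : ℝ)
    (h : IsPrimitive f g) (hg : IntegrableOn g (Ioi a))
    (h2 : Tendsto f atTop (𝓝 l)) : ∫ x in Ioi a, g x = l - f a := by
  have e := intervalIntegral_tendsto_integral_Ioi (b := fun n : ℝ => n) a hg tendsto_id
  refine tendsto_nhds_unique e ?_
  simp only [← h.sub_eq]
  exact (h2.comp tendsto_id).sub tendsto_const_nhds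

theorem IsPrimitive.smul {f g : ℝ → ℂ} {a a' : ℝ → ℝ} (h : IsPrimitive f g)
    (ha : IsPrimitive a a') :
    IsPrimitive (fun x => (a x : ℂ) * f x) (fun x => (a' x : ℂ) * f x + (a x : ℂ) * g x) := by
  have := (ha.prodMk h).comp (Φ := fun z : ℝ × ℂ => (z.1 : ℂ) * z.2)
    ((Complex.ofRealCLM.contDiff.comp contDiff_fst).mul contDiff_snd)
  convert! this using 1
  funext x
  have hd : HasFDerivAt (fun z : ℝ × ℂ => (z.1 : ℂ) * z.2)
    ((a x : ℂ) • ContinuousLinearMap.snd ℝ ℝ ℂ +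
      f x • (Complex.ofRealCLM.comp (ContinuousLinearMap.fst ℝ ℝ ℂ))) (a x, f x) := by
    have h1 : HasFDerivAt (fun z : ℝ × ℂ => (z.1 : ℂ))
        (Complex.ofRealCLM.comp (ContinuousLinearMap.fst ℝ ℝ ℂ)) (a x, f x) :=
      (Complex.ofRealCLM.comp (ContinuousLinearMap.fst ℝ ℝ ℂ)).hasFDerivAt
    have h2 : HasFDerivAt (fun z : ℝ × ℂ => z.2) (ContinuousLinearMap.snd ℝ ℝ ℂ) (a x, f x) :=
      (ContinuousLinearMap.snd ℝ ℝ ℂ).hasFDerivAt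
    exact h1.mul h2
  rw [hd.fderiv]
  simp [mul_comm]
  ring

theorem IsPrimitive.mul_conj {f g f' g' : ℝ → ℂ} (h : IsPrimitive f g) (h' : IsPrimitive f' g') :
    IsPrimitive (fun x => f x * conj (f' x)) (fun x => g x * conj (f' x) + f x * conj (g' x)) := by
  have := (h.prodMk h').comp (Φ := fun z : ℂ × ℂ => z.1 * conj z.2)
    (contDiff_fst.mul (Complex.conjCLE.contDiff.comp contDiff_snd))
  convert! this using 1
  funext x
  have hd : HasFDerivAt (fun z : ℂ × ℂ => z.1 * conj z.2)
    (f x • ((Complex.conjCLE : ℂ →L[ℝ] ℂ).comp (ContinuousLinearMap.snd ℝ ℂ ℂ)) +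
      conj (f' x) • (ContinuousLinearMap.fst ℝ ℂ ℂ)) (f x, f' x) := by
    have h1 : HasFDerivAt (fun z : ℂ × ℂ => conj z.2)
        ((Complex.conjCLE : ℂ →L[ℝ] ℂ).comp (ContinuousLinearMap.snd ℝ ℂ ℂ)) (f x, f' x) :=
      ((Complex.conjCLE : ℂ →L[ℝ] ℂ).comp (ContinuousLinearMap.snd ℝ ℂ ℂ)).hasFDerivAt
    have h2 : HasFDerivAt (fun z : ℂ × ℂ => z.1) (ContinuousLinearMap.fst ℝ ℂ ℂ) (f x, f' x) :=
      (ContinuousLinearMap.fst ℝ ℂ ℂ).hasFDerivAt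
    exact h2.mul h1
  rw [hd.fderiv]
  simp [mul_comm]
  ring

end Primitive

end DeltaNLS

namespace DeltaNLS

open MeasureTheory Set Filter Topology
open scoped ComplexConjugate ContDiff

/-! ### The space `H¹`: completeness, continuous representatives, decay and sup bound. -/

section SobolevBasics

theorem L2.locallyIntegrable (f : L2) : LocallyIntegrable (f : ℝ → ℂ) :=
  (Lp.memLp f).locallyIntegrable (by norm_num)

/-- The pairing with a test function is an inner product with a fixed element of `L²`; hence the
weak-derivative condition is closed and `H¹` is complete. -/
theorem L2.continuous_integral_smul {ξ : ℝ → ℝ} (hξ : Continuous ξ) (hc : HasCompactSupport ξ) :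
    Continuous fun f : L2 => ∫ x, ξ x • f x := by
  have hm : MemLp (fun x => (ξ x : ℂ)) 2 (volume : Measure ℝ) :=
    (Complex.continuous_ofReal.comp hξ).memLp_of_hasCompactSupport
      (hc.comp_left Complex.ofReal_zero)
  have : (fun f : L2 => ∫ x, ξ x • f x) = fun f : L2 => inner ℂ (hm.toLp _) f := by
    funext f
    rw [L2.inner_def]
    refine integral_congr_ae ?_
    filter_upwards [hm.coeFn_toLp] with x hx
    simp [hx, mul_comm]
  rw [this]
  fun_prop

theorem isClosed_sobolevH1 : IsClosed (sobolevH1 : Set (WithLp 2 (L2 × L2))) := by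
  have : (sobolevH1 : Set (WithLp 2 (L2 × L2))) = ⋂ (η : ℝ → ℝ) (_ : ContDiff ℝ ∞ η)
      (_ : HasCompactSupport η), {v | ∫ x, deriv η x • v.fst x = - ∫ x, η x • v.snd x} := by
    ext v
    simp only [mem_iInter]
    rfl
  rw [this]
  refine isClosed_iInter fun η => isClosed_iInter fun hη => isClosed_iInter fun hc => ?_
  refine isClosed_eq ?_ ?_
  · exact (L2.continuous_integral_smul (hη.continuous_deriv (by simp)) hc.deriv).comp
      (WithLp.fstL 2 ℂ L2 L2).continuous
  · exact ((L2.continuous_integral_smul hη.continuous hc).comp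
      (WithLp.sndL 2 ℂ L2 L2).continuous).neg

instance : CompleteSpace H1 :=
  haveI := isClosed_sobolevH1.completeSpace_coe
  inferInstanceAs (CompleteSpace sobolevH1)

theorem H1.inner_eq (v w : H1) : inner ℂ v w = inner ℂ v.toL2 w.toL2 + inner ℂ v.dx w.dx := rfl

theorem H1.norm_sq_eq (v : H1) : ‖v‖ ^ 2 = ‖v.toL2‖ ^ 2 + ‖v.dx‖ ^ 2 := by
  have h := H1.inner_eq v v
  rw [inner_self_eq_norm_sq_to_K, inner_self_eq_norm_sq_to_K, inner_self_eq_norm_sq_to_K] at h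
  exact_mod_cast h

theorem H1.norm_toL2_le (v : H1) : ‖v.toL2‖ ≤ ‖v‖ :=
  le_of_sq_le_sq (by have := v.norm_sq_eq; nlinarith [sq_nonneg ‖v.dx‖]) (norm_nonneg _)

theorem H1.norm_dx_le (v : H1) : ‖v.dx‖ ≤ ‖v‖ :=
  le_of_sq_le_sq (by have := v.norm_sq_eq; nlinarith [sq_nonneg ‖v.toL2‖]) (norm_nonneg _)

theorem H1.ext_toL2 {v w : H1} (h : v.toL2 = w.toL2) : v = w := by
  have h0 : (v - w).toL2 = 0 := by rw [map_sub, h, sub_self]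
  have h1 : ((v - w).dx : ℝ → ℂ) =ᵐ[volume] 0 := by
    refine ae_eq_zero_of_integral_contDiff_smul_eq_zero (L2.locallyIntegrable _)
      fun η hη hc => ?_
    have := (v - w).hasWeakDeriv η hη hc
    rw [h0] at this
    have h2 : ∫ x, deriv η x • (0 : L2) x = 0 := by
      refine integral_eq_zero_of_ae ?_
      filter_upwards [Lp.coeFn_zero ℂ 2 (volume : Measure ℝ)] with x hx
      rw [hx]; simp
    rw [h2] at this
    exact (neg_eq_zero.mp this.symm)
  have h2 : (v - w).dx = 0 := (Lp.eq_zero_iff_ae_eq_zero).mpr h1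
  have h3 := (v - w).norm_sq_eq
  rw [h0, h2] at h3
  simp at h3
  exact sub_eq_zero.mp h3

/-- The function minus the primitive of its weak derivative has zero weak derivative, so it is
almost everywhere constant; continuity of the representative turns this into an identity at every
point. -/
theorem H1.isPrimitive_rep (v : H1) : IsPrimitive v.rep v.dx := by
  have hf : LocallyIntegrable (v.toL2 : ℝ → ℂ) := L2.locallyIntegrable _
  have hg : LocallyIntegrable (v.dx : ℝ → ℂ) := L2.locallyIntegrable _
  have hGc : Continuous (fun x => ∫ t in (0 : ℝ)..x, v.dx t) := (isPrimitive_integral hg 0).continuous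
  obtain ⟨c, hc⟩ := ae_eq_const_of_integral_deriv_smul (hf.sub hGc.locallyIntegrable)
    (fun η hη hηc => by
      have hd : Continuous (deriv η) := hη.continuous_deriv (by simp)
      have e1 := v.hasWeakDeriv η hη hηc
      have e2 := hasWeakDeriv_primitive hg η hη hηc
      simp only [Pi.sub_apply, smul_sub]
      rw [integral_sub (hf.integrable_smul_left_of_hasCompactSupport hd hηc.deriv)
        (hGc.locallyIntegrable.integrable_smul_left_of_hasCompactSupport hd hηc.deriv), e1, e2,
        sub_self])
  have h1 : v.rep = fun x => c + ∫ t in (0 : ℝ)..x, v.dx t := by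
    refine (Continuous.ae_eq_iff_eq volume v.continuous_rep (continuous_const.add hGc)).mp ?_
    filter_upwards [hc, v.coeFn_ae_eq_rep] with x hx hx2
    rw [← hx2, ← hx]
    simp
  refine ⟨hg, fun x y => ?_⟩
  rw [h1, ← (isPrimitive_integral hg 0).sub_eq x y]
  simp

theorem IsPrimitive.hasWeakDeriv {f g : ℝ → ℂ} (h : IsPrimitive f g) : HasWeakDeriv f g := by
  intro η hη hc
  have hd : Continuous (deriv η) := hη.continuous_deriv (by simp)
  have hηp : IsPrimitive η (deriv η) :=
    isPrimitive_of_hasDerivAt (fun x => (hη.differentiable (by simp) x).hasDerivAt) hd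
  have i1 : Integrable fun x => deriv η x • f x :=
    h.continuous.locallyIntegrable.integrable_smul_left_of_hasCompactSupport hd hc.deriv
  have i2 : Integrable fun x => η x • g x :=
    h.locInt.integrable_smul_left_of_hasCompactSupport hη.continuous hc
  have hp := h.smul hηp
  have hcs : HasCompactSupport fun x => (η x : ℂ) * f x :=
    (hc.comp_left (g := Complex.ofReal) Complex.ofReal_zero).mul_right
  have h0 := HasCompactSupport.is_zero_at_infty hcs
  rw [cocompact_eq_atBot_atTop] at h0
  have := hp.integral_eq (i1.add i2)
    (h0.mono_left le_sup_left) (h0.mono_left le_sup_right)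
  simp only [← Complex.real_smul] at this
  rw [integral_add i1 i2, sub_zero] at this
  exact eq_neg_of_add_eq_zero_left this

/-- The element of `H¹(ℝ)` given by a primitive `f ∈ L²` of `g ∈ L²`. -/
def H1.ofPrimitive {f g : ℝ → ℂ} (h : IsPrimitive f g) (hf : MemLp f 2) (hg : MemLp g 2) : H1 :=
  ⟨WithLp.toLp 2 (hf.toLp f, hg.toLp g), by
    intro η hη hc
    have := h.hasWeakDeriv η hη hc
    change ∫ x, deriv η x • (hf.toLp f) x = - ∫ x, η x • (hg.toLp g) x
    have e1 : ∫ x, deriv η x • (hf.toLp f) x = ∫ x, deriv η x • f x := by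
      refine integral_congr_ae ?_
      filter_upwards [hf.coeFn_toLp] with x hx
      rw [hx]
    have e2 : ∫ x, η x • (hg.toLp g) x = ∫ x, η x • g x := by
      refine integral_congr_ae ?_
      filter_upwards [hg.coeFn_toLp] with x hx
      rw [hx]
    rw [e1, e2, this]⟩

section
variable {f g : ℝ → ℂ} (h : IsPrimitive f g) (hf : MemLp f 2) (hg : MemLp g 2)

theorem H1.toL2_ofPrimitive : (H1.ofPrimitive h hf hg).toL2 = hf.toLp f := rfl

theorem H1.dx_ofPrimitive : (H1.ofPrimitive h hf hg).dx = hg.toLp g := rfl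

theorem H1.dx_ofPrimitive_ae : ((H1.ofPrimitive h hf hg).dx : ℝ → ℂ) =ᵐ[volume] g :=
  hg.coeFn_toLp

theorem H1.rep_eq_of_ae {v : H1} {f : ℝ → ℂ} (hf : Continuous f)
    (h : (v.toL2 : ℝ → ℂ) =ᵐ[volume] f) : v.rep = f :=
  (Continuous.ae_eq_iff_eq volume v.continuous_rep hf).mp (v.coeFn_ae_eq_rep.symm.trans h)

theorem H1.rep_ofPrimitive : (H1.ofPrimitive h hf hg).rep = f :=
  H1.rep_eq_of_ae h.continuous hf.coeFn_toLp

end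

theorem H1.rep_add (v w : H1) : (v + w).rep = v.rep + w.rep :=
  H1.rep_eq_of_ae (v.continuous_rep.add w.continuous_rep) (by
    rw [map_add]
    filter_upwards [Lp.coeFn_add v.toL2 w.toL2, v.coeFn_ae_eq_rep, w.coeFn_ae_eq_rep] with x h h1 h2
    rw [h, Pi.add_apply, Pi.add_apply, h1, h2])

theorem H1.rep_smul (c : ℂ) (v : H1) : (c • v).rep = c • v.rep :=
  H1.rep_eq_of_ae (v.continuous_rep.const_smul c) (by
    rw [map_smul]
    filter_upwards [Lp.coeFn_smul c v.toL2, v.coeFn_ae_eq_rep] with x h h1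
    rw [h, Pi.smul_apply, Pi.smul_apply, h1])

theorem H1.rep_zero : (0 : H1).rep = 0 := by
  have := H1.rep_smul 0 (0 : H1)
  simpa using this

theorem H1.rep_sub (v w : H1) : (v - w).rep = v.rep - w.rep := by
  have h := H1.rep_add (v - w) w
  rw [sub_add_cancel] at h
  rw [h, add_sub_cancel_right]

theorem H1.ext_rep {v w : H1} (h : v.rep = w.rep) : v = w :=
  H1.ext_toL2 (Lp.ext ((v.coeFn_ae_eq_rep.trans (by rw [h])).trans w.coeFn_ae_eq_rep.symm))

theorem H1.memLp_rep (v : H1) : MemLp v.rep 2 :=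
  (memLp_congr_ae v.coeFn_ae_eq_rep).mp (Lp.memLp _)

theorem H1.memLp_dx (v : H1) : MemLp (v.dx : ℝ → ℂ) 2 := Lp.memLp _

theorem L2.norm_sq_eq (f : L2) : ‖f‖ ^ 2 = ∫ x, ‖f x‖ ^ 2 := by
  have h : inner ℂ f f = ((∫ x, ‖f x‖ ^ 2 : ℝ) : ℂ) := by
    rw [L2.inner_def, ← integral_complex_ofReal]
    refine integral_congr_ae (Eventually.of_forall fun x => ?_)
    simp only [inner_self_eq_norm_sq_to_K]
    simp
  rw [inner_self_eq_norm_sq_to_K] at h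
  exact Complex.ofReal_injective ((Complex.ofReal_pow _ _).trans h)

theorem H1.norm_sq_toL2 (v : H1) : ‖v.toL2‖ ^ 2 = ∫ x, ‖v.rep x‖ ^ 2 := by
  rw [L2.norm_sq_eq]
  refine integral_congr_ae ?_
  filter_upwards [v.coeFn_ae_eq_rep] with x hx
  rw [hx]

theorem H1.norm_sq_dx (v : H1) : ‖v.dx‖ ^ 2 = ∫ x, ‖v.dx x‖ ^ 2 := L2.norm_sq_eq _

theorem H1.integrable_sq_rep (v : H1) : Integrable fun x => ‖v.rep x‖ ^ 2 :=
  v.memLp_rep.integrable_norm_pow (by norm_num)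

theorem H1.integrable_sq_dx (v : H1) : Integrable fun x => ‖v.dx x‖ ^ 2 :=
  v.memLp_dx.integrable_norm_pow (by norm_num)

theorem H1.isPrimitive_norm_sq (v : H1) : IsPrimitive (fun x => ‖v.rep x‖ ^ 2)
    (fun x => 2 * inner ℝ (v.rep x) (v.dx x)) := by
  have := v.isPrimitive_rep.comp (Φ := fun z : ℂ => ‖z‖ ^ 2) (contDiff_norm_sq ℝ)
  convert! this using 1
  funext x
  rw [fderiv_norm_sq_apply]
  simp
  ring

theorem H1.integrable_inner (v : H1) : Integrable fun x => 2 * inner ℝ (v.rep x) (v.dx x) := by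
  refine (v.integrable_sq_rep.add v.integrable_sq_dx).mono' ?_ (Eventually.of_forall fun x => ?_)
  · exact (v.continuous_rep.aestronglyMeasurable.inner (Lp.aestronglyMeasurable _)).const_mul 2
  · rw [norm_mul, Real.norm_eq_abs, Real.norm_eq_abs]
    have h1 := abs_real_inner_le_norm (v.rep x) (v.dx x)
    have h2 : |(2 : ℝ)| = 2 := by norm_num
    rw [h2, Pi.add_apply]
    nlinarith [sq_nonneg (‖v.rep x‖ - ‖v.dx x‖)]

theorem IsPrimitive.exists_tendsto_atTop {E : Type*} [NormedAddCommGroup E] [NormedSpace ℝ E]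
    [CompleteSpace E] {f g : ℝ → E} (h : IsPrimitive f g)
    (hg : Integrable g) : ∃ l, Tendsto f atTop (𝓝 l) := by
  refine ⟨f 0 + ∫ x in Ioi 0, g x, ?_⟩
  have := (intervalIntegral_tendsto_integral_Ioi (b := fun n : ℝ => n) 0 hg.integrableOn
    tendsto_id).const_add (f 0)
  refine this.congr fun x => ?_
  rw [← h.sub_eq]; abel

theorem IsPrimitive.exists_tendsto_atBot {E : Type*} [NormedAddCommGroup E] [NormedSpace ℝ E]
    [CompleteSpace E] {f g : ℝ → E} (h : IsPrimitive f g)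
    (hg : Integrable g) : ∃ l, Tendsto f atBot (𝓝 l) := by
  refine ⟨f 0 - ∫ x in Iic 0, g x, ?_⟩
  have := (intervalIntegral_tendsto_integral_Iic (a := fun n : ℝ => n) 0 hg.integrableOn
    tendsto_id).const_sub (f 0)
  refine this.congr fun x => ?_
  rw [← h.sub_eq]; abel

/-- A nonzero limit would keep `|f|` above `|l|/2` on a half-line, a set of infinite measure. -/
theorem eq_zero_of_tendsto_of_integrable {f : ℝ → ℝ} (hf : Integrable f) {l : ℝ} {F : Filter ℝ}
    (hF : F = atTop ∨ F = atBot)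
    (h : Tendsto f F (𝓝 l)) : l = 0 := by
  by_contra hl
  have h1 : ∀ᶠ x in F, |l| / 2 < |f x| :=
    h.abs.eventually (lt_mem_nhds (half_lt_self (abs_pos.mpr hl)))
  have h2 : volume {x | |l| / 2 ≤ ‖f x‖} < ⊤ :=
    hf.measure_norm_ge_lt_top (half_pos (abs_pos.mpr hl))
  rcases hF with rfl | rfl
  · obtain ⟨a, ha⟩ := eventually_atTop.mp h1
    have : volume (Ici a) ≤ volume {x | |l| / 2 ≤ ‖f x‖} :=
      measure_mono fun x hx => (ha x hx).le
    rw [Real.volume_Ici] at this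
    exact absurd (this.trans_lt h2) (lt_irrefl _)
  · obtain ⟨a, ha⟩ := eventually_atBot.mp h1
    have : volume (Iic a) ≤ volume {x | |l| / 2 ≤ ‖f x‖} :=
      measure_mono fun x hx => (ha x hx).le
    rw [Real.volume_Iic] at this
    exact absurd (this.trans_lt h2) (lt_irrefl _)

theorem H1.tendsto_norm_sq_atTop (v : H1) : Tendsto (fun x => ‖v.rep x‖ ^ 2) atTop (𝓝 0) := by
  obtain ⟨l, hl⟩ := v.isPrimitive_norm_sq.exists_tendsto_atTop v.integrable_inner
  rwa [eq_zero_of_tendsto_of_integrable v.integrable_sq_rep (Or.inl rfl) hl] at hl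

theorem H1.tendsto_norm_sq_atBot (v : H1) : Tendsto (fun x => ‖v.rep x‖ ^ 2) atBot (𝓝 0) := by
  obtain ⟨l, hl⟩ := v.isPrimitive_norm_sq.exists_tendsto_atBot v.integrable_inner
  rwa [eq_zero_of_tendsto_of_integrable v.integrable_sq_rep (Or.inr rfl) hl] at hl

theorem tendsto_zero_of_norm_sq {F : Filter ℝ} {f : ℝ → ℂ}
    (h : Tendsto (fun x => ‖f x‖ ^ 2) F (𝓝 0)) : Tendsto f F (𝓝 0) := by
  rw [tendsto_zero_iff_norm_tendsto_zero]
  have := h.sqrt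
  simpa using this

theorem H1.tendsto_rep_atTop (v : H1) : Tendsto v.rep atTop (𝓝 0) :=
  tendsto_zero_of_norm_sq v.tendsto_norm_sq_atTop

theorem H1.tendsto_rep_atBot (v : H1) : Tendsto v.rep atBot (𝓝 0) :=
  tendsto_zero_of_norm_sq v.tendsto_norm_sq_atBot

/-- The Sobolev embedding `H¹(ℝ) ⊆ L^∞(ℝ)`. -/
theorem H1.norm_rep_le (v : H1) (x : ℝ) : ‖v.rep x‖ ≤ ‖v‖ := by
  refine le_of_sq_le_sq ?_ (norm_nonneg _)
  have h := v.isPrimitive_norm_sq.integral_Ioi_eq x v.integrable_inner.integrableOn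
    v.tendsto_norm_sq_atTop
  have i := (v.integrable_sq_rep.add v.integrable_sq_dx)
  rw [zero_sub] at h
  calc ‖v.rep x‖ ^ 2 = - ∫ y in Ioi x, 2 * inner ℝ (v.rep y) (v.dx y) := by rw [h, neg_neg]
    _ = ∫ y in Ioi x, - (2 * inner ℝ (v.rep y) (v.dx y)) := by rw [integral_neg]
    _ ≤ ∫ y in Ioi x, (‖v.rep y‖ ^ 2 + ‖v.dx y‖ ^ 2) := by
        refine integral_mono v.integrable_inner.integrableOn.neg i.integrableOn fun y => ?_
        have h1 := neg_le_of_abs_le (abs_real_inner_le_norm (v.rep y) (v.dx y))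
        simp only
        nlinarith [sq_nonneg (‖v.rep y‖ - ‖v.dx y‖)]
    _ ≤ ∫ y, (‖v.rep y‖ ^ 2 + ‖v.dx y‖ ^ 2) :=
        setIntegral_le_integral i (Eventually.of_forall fun y => by positivity)
    _ = ‖v‖ ^ 2 := by
        rw [integral_add v.integrable_sq_rep v.integrable_sq_dx, v.norm_sq_eq, v.norm_sq_toL2,
          v.norm_sq_dx]

/-- Evaluation at a point, as a continuous functional on `H¹(ℝ)`. -/
def H1.eval (x : ℝ) : H1 →L[ℂ] ℂ :=
  LinearMap.mkContinuous
    { toFun := fun v => v.rep x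
      map_add' := fun v w => by rw [H1.rep_add]; rfl
      map_smul' := fun c v => by rw [H1.rep_smul]; rfl } 1
    fun v => by simpa using v.norm_rep_le x

theorem H1.eval_apply (x : ℝ) (v : H1) : H1.eval x v = v.rep x := rfl

end SobolevBasics

end DeltaNLS

namespace DeltaNLS

open MeasureTheory Set Filter Topology
open scoped ComplexConjugate ContDiff BoundedContinuousFunction

/-! ### Multiplication, Nemytskii and reflection operators on `H¹`. -/

section Operators

theorem H1.norm_le_add (v : H1) : ‖v‖ ≤ ‖v.toL2‖ + ‖v.dx‖ :=
  le_of_sq_le_sq (by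
    have := v.norm_sq_eq
    nlinarith [mul_nonneg (norm_nonneg v.toL2) (norm_nonneg v.dx)]) (by positivity)

theorem L2.norm_sq_le_add {f g h : L2} {a b : ℝ}
    (H : ∀ᵐ x, ‖f x‖ ^ 2 ≤ a * ‖g x‖ ^ 2 + b * ‖h x‖ ^ 2) :
    ‖f‖ ^ 2 ≤ a * ‖g‖ ^ 2 + b * ‖h‖ ^ 2 := by
  have i : ∀ k : L2, Integrable fun x => ‖k x‖ ^ 2 := fun k =>
    (Lp.memLp k).integrable_norm_pow (by norm_num)
  rw [L2.norm_sq_eq, L2.norm_sq_eq, L2.norm_sq_eq, ← integral_const_mul, ← integral_const_mul,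
    ← integral_add ((i g).const_mul a) ((i h).const_mul b)]
  exact integral_mono_ae (i f) (((i g).const_mul a).add ((i h).const_mul b)) H

theorem L2.memLp_mul (a : ℝ →ᵇ ℝ) (f : L2) : MemLp (fun x => (a x : ℂ) * f x) 2 := by
  refine (Lp.memLp f).of_le_mul (c := ‖a‖) ?_ (Eventually.of_forall fun x => ?_)
  · exact (Complex.continuous_ofReal.comp a.continuous).aestronglyMeasurable.mul
      (Lp.aestronglyMeasurable f)
  · rw [norm_mul, Complex.norm_real]
    gcongr
    exact a.norm_coe_le_norm x

/-- Multiplication by a bounded continuous function on `L²(ℝ)`. -/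
def L2.mul (a : ℝ →ᵇ ℝ) : L2 →L[ℂ] L2 :=
  LinearMap.mkContinuous
    { toFun := fun f => (L2.memLp_mul a f).toLp _
      map_add' := fun f g => by
        refine Lp.ext ?_
        filter_upwards [(L2.memLp_mul a (f + g)).coeFn_toLp, (L2.memLp_mul a f).coeFn_toLp,
          (L2.memLp_mul a g).coeFn_toLp, Lp.coeFn_add f g,
          Lp.coeFn_add ((L2.memLp_mul a f).toLp _) ((L2.memLp_mul a g).toLp _)]
          with x h1 h2 h3 h4 h5
        rw [h1, h5, Pi.add_apply, h2, h3, h4, Pi.add_apply, mul_add]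
      map_smul' := fun c f => by
        refine Lp.ext ?_
        filter_upwards [(L2.memLp_mul a (c • f)).coeFn_toLp, (L2.memLp_mul a f).coeFn_toLp,
          Lp.coeFn_smul c f, Lp.coeFn_smul c ((L2.memLp_mul a f).toLp _)] with x h1 h2 h3 h4
        rw [h1, RingHom.id_apply, h4, Pi.smul_apply, h2, h3, Pi.smul_apply, smul_eq_mul,
          smul_eq_mul]
        ring } ‖a‖
    fun f => by
      refine Lp.norm_le_mul_norm_of_ae_le_mul ?_
      filter_upwards [(L2.memLp_mul a f).coeFn_toLp] with x hx
      change ‖((L2.memLp_mul a f).toLp _) x‖ ≤ _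
      rw [hx, norm_mul, Complex.norm_real]
      gcongr
      exact a.norm_coe_le_norm x

theorem L2.mul_ae (a : ℝ →ᵇ ℝ) (f : L2) :
    (L2.mul a f : ℝ → ℂ) =ᵐ[volume] fun x => (a x : ℂ) * f x :=
  (L2.memLp_mul a f).coeFn_toLp

theorem isPrimitive_of_bounded {a a' : ℝ →ᵇ ℝ} (h : ∀ x, HasDerivAt a (a' x) x) :
    IsPrimitive a a' := isPrimitive_of_hasDerivAt h a'.continuous

theorem IsPrimitive.congr_ae {E : Type*} [NormedAddCommGroup E] [NormedSpace ℝ E] {f g g' : ℝ → E}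
    (h : IsPrimitive f g) (hg : g =ᵐ[volume] g') : IsPrimitive f g' := by
  refine ⟨fun x => ?_, fun x y => ?_⟩
  · obtain ⟨s, hs, hi⟩ := h.locInt x
    exact ⟨s, hs, hi.congr (ae_restrict_of_ae hg)⟩
  · rw [h.sub_eq]
    exact intervalIntegral.integral_congr_ae (hg.mono fun t ht _ => ht)

theorem H1.mul_aux {a a' : ℝ →ᵇ ℝ} (h : ∀ x, HasDerivAt a (a' x) x) (v : H1) :
    IsPrimitive (fun x => (a x : ℂ) * v.rep x) (L2.mul a' v.toL2 + L2.mul a v.dx : L2) := by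
  refine (v.isPrimitive_rep.smul (isPrimitive_of_bounded h)).congr_ae ?_
  filter_upwards [v.coeFn_ae_eq_rep, L2.mul_ae a' v.toL2, L2.mul_ae a v.dx,
    Lp.coeFn_add (L2.mul a' v.toL2) (L2.mul a v.dx)] with x h1 h2 h3 h4
  rw [h4, Pi.add_apply, h2, h3, h1]

theorem H1.memLp_mul_rep (a : ℝ →ᵇ ℝ) (v : H1) : MemLp (fun x => (a x : ℂ) * v.rep x) 2 := by
  refine (memLp_congr_ae ?_).mp (L2.memLp_mul a v.toL2)
  filter_upwards [v.coeFn_ae_eq_rep] with x h1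
  rw [h1]

/-- The product of an element of `H¹(ℝ)` and a bounded `C¹` function with bounded derivative. -/
def H1.mulAux {a a' : ℝ →ᵇ ℝ} (h : ∀ x, HasDerivAt a (a' x) x) (v : H1) : H1 :=
  H1.ofPrimitive (H1.mul_aux h v) (H1.memLp_mul_rep a v) (Lp.memLp _)

theorem H1.toL2_mulAux {a a' : ℝ →ᵇ ℝ} (h : ∀ x, HasDerivAt a (a' x) x) (v : H1) :
    (H1.mulAux h v).toL2 = L2.mul a v.toL2 := by
  refine Lp.ext ?_
  filter_upwards [v.coeFn_ae_eq_rep, L2.mul_ae a v.toL2, (H1.memLp_mul_rep a v).coeFn_toLp]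
    with x h1 h2 h3
  rw [h2, H1.mulAux, H1.toL2_ofPrimitive, h3, h1]

theorem H1.dx_mulAux {a a' : ℝ →ᵇ ℝ} (h : ∀ x, HasDerivAt a (a' x) x) (v : H1) :
    (H1.mulAux h v).dx = L2.mul a' v.toL2 + L2.mul a v.dx := by
  rw [H1.mulAux, H1.dx_ofPrimitive, Lp.toLp_coeFn]

/-- Multiplication by a bounded `C¹` function with bounded derivative on `H¹(ℝ)`. -/
def H1.mul {a a' : ℝ →ᵇ ℝ} (h : ∀ x, HasDerivAt a (a' x) x) : H1 →L[ℂ] H1 :=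
  LinearMap.mkContinuous
    { toFun := H1.mulAux h
      map_add' := fun v w => H1.ext_toL2 (by simp only [H1.toL2_mulAux, map_add])
      map_smul' := fun c v => H1.ext_toL2 (by
        simp only [H1.toL2_mulAux, map_smul, RingHom.id_apply]) }
    (2 * ‖L2.mul a‖ + ‖L2.mul a'‖)
    fun v => by
      refine (H1.norm_le_add _).trans ?_
      change ‖(H1.mulAux h v).toL2‖ + ‖(H1.mulAux h v).dx‖ ≤ _
      rw [H1.toL2_mulAux, H1.dx_mulAux]
      have e1 := (L2.mul a).le_opNorm v.toL2
      have e2 := (L2.mul a').le_opNorm v.toL2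
      have e3 := (L2.mul a).le_opNorm v.dx
      have e4 := norm_add_le (L2.mul a' v.toL2) (L2.mul a v.dx)
      have e5 := mul_le_mul_of_nonneg_left v.norm_toL2_le (norm_nonneg (L2.mul a))
      have e6 := mul_le_mul_of_nonneg_left v.norm_toL2_le (norm_nonneg (L2.mul a'))
      have e7 := mul_le_mul_of_nonneg_left v.norm_dx_le (norm_nonneg (L2.mul a))
      linarith

section
variable {a a' : ℝ →ᵇ ℝ} (h : ∀ x, HasDerivAt a (a' x) x) (v : H1)

theorem H1.toL2_mul : (H1.mul h v).toL2 = L2.mul a v.toL2 := H1.toL2_mulAux h v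

theorem H1.dx_mul : (H1.mul h v).dx = L2.mul a' v.toL2 + L2.mul a v.dx := H1.dx_mulAux h v

theorem H1.rep_mul : (H1.mul h v).rep = fun x => (a x : ℂ) * v.rep x :=
  H1.rep_ofPrimitive (H1.mul_aux h v) (H1.memLp_mul_rep a v) (Lp.memLp _)

end

/-- The derivative of `g ∘ v` is `Dg(v) v'`, so a Lipschitz estimate in `H¹` needs bounds on `Dg`
and on its increments; hence two derivatives of `g`. -/
theorem exists_lipschitz_bound {g : ℂ → ℂ} (hg : ContDiff ℝ 2 g) (R : ℝ) :
    ∃ C, 0 ≤ C ∧ ∀ z w : ℂ, ‖z‖ ≤ R → ‖w‖ ≤ R → ‖g z - g w‖ ≤ C * ‖z - w‖ ∧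
      ‖fderiv ℝ g z - fderiv ℝ g w‖ ≤ C * ‖z - w‖ ∧ ‖fderiv ℝ g z‖ ≤ C := by
  have hd : ContDiff ℝ 1 (fderiv ℝ g) := hg.fderiv_right (by norm_num)
  have h1 : ContDiffOn ℝ 1 g (Metric.closedBall (0 : ℂ) R) := (hg.of_le (by norm_num)).contDiffOn
  obtain ⟨K, hK⟩ := h1.exists_lipschitzOnWith one_ne_zero (convex_closedBall _ _)
    (isCompact_closedBall _ _)
  obtain ⟨K', hK'⟩ := (hd.contDiffOn (s := Metric.closedBall (0 : ℂ) R)).exists_lipschitzOnWith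
    one_ne_zero (convex_closedBall _ _) (isCompact_closedBall _ _)
  obtain ⟨B, hB⟩ := ((isCompact_closedBall (0 : ℂ) R).image
    hd.continuous).isBounded.exists_norm_le
  refine ⟨max (max K K') |B|, le_max_of_le_right (abs_nonneg B), fun z w hz hw => ?_⟩
  have hz' : z ∈ Metric.closedBall (0 : ℂ) R := mem_closedBall_zero_iff.mpr hz
  have hw' : w ∈ Metric.closedBall (0 : ℂ) R := mem_closedBall_zero_iff.mpr hw
  refine ⟨?_, ?_, ?_⟩
  · refine (hK.norm_sub_le hz' hw').trans ?_
    gcongr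
    exact (le_max_left _ _).trans (le_max_left _ _)
  · refine (hK'.norm_sub_le hz' hw').trans ?_
    gcongr
    exact (le_max_right _ _).trans (le_max_left _ _)
  · exact (hB _ (mem_image_of_mem _ hz')).trans ((le_abs_self B).trans (le_max_right _ _))

section Nemytskii

variable {g : ℂ → ℂ}

theorem H1.memLp_comp (hg : ContDiff ℝ 2 g) (h0 : g 0 = 0) (v : H1) : MemLp (fun x => g (v.rep x)) 2 := by
  obtain ⟨C, hC, H⟩ := exists_lipschitz_bound hg ‖v‖
  refine v.memLp_rep.of_le_mul (c := C) (hg.continuous.comp v.continuous_rep).aestronglyMeasurable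
    (Eventually.of_forall fun x => ?_)
  have := (H (v.rep x) 0 (v.norm_rep_le x) (by simp)).1
  rwa [h0, sub_zero, sub_zero] at this

theorem H1.isPrimitive_comp (hg : ContDiff ℝ 2 g) (v : H1) :
    IsPrimitive (fun x => g (v.rep x)) (fun x => fderiv ℝ g (v.rep x) (v.dx x)) :=
  v.isPrimitive_rep.comp (hg.of_le (by norm_num))

theorem H1.memLp_fderiv_comp (hg : ContDiff ℝ 2 g) (v : H1) :
    MemLp (fun x => fderiv ℝ g (v.rep x) (v.dx x)) 2 := by
  obtain ⟨C, hC, H⟩ := exists_lipschitz_bound hg ‖v‖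
  refine v.memLp_dx.of_le_mul (c := C) (H1.isPrimitive_comp hg v).locInt.aestronglyMeasurable
    (Eventually.of_forall fun x => ?_)
  have := (H (v.rep x) 0 (v.norm_rep_le x) (by simp)).2.2
  exact (ContinuousLinearMap.le_opNorm _ _).trans
    (mul_le_mul_of_nonneg_right this (norm_nonneg _))

/-- The Nemytskii operator `v ↦ g ∘ v` on `H¹(ℝ)`. -/
def H1.comp (hg : ContDiff ℝ 2 g) (h0 : g 0 = 0) (v : H1) : H1 :=
  H1.ofPrimitive (H1.isPrimitive_comp hg v) (H1.memLp_comp hg h0 v) (H1.memLp_fderiv_comp hg v)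

theorem H1.rep_comp (hg : ContDiff ℝ 2 g) (h0 : g 0 = 0) (v : H1) :
    (H1.comp hg h0 v).rep = fun x => g (v.rep x) :=
  H1.rep_ofPrimitive _ _ _

theorem H1.dx_comp_ae (hg : ContDiff ℝ 2 g) (h0 : g 0 = 0) (v : H1) :
    ((H1.comp hg h0 v).dx : ℝ → ℂ) =ᵐ[volume]
    fun x => fderiv ℝ g (v.rep x) (v.dx x) :=
  H1.dx_ofPrimitive_ae _ _ _

/-- Write `Dg(v) v' - Dg(w) w' = Dg(v) (v' - w') + (Dg(v) - Dg(w)) w'`. In the second term the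
increment of `Dg` is bounded pointwise by `C ‖v - w‖` through the sup bound, and `w'` stays in `L²`.
-/
theorem H1.exists_lipschitz_comp (hg : ContDiff ℝ 2 g) (h0 : g 0 = 0) (R : ℝ) :
    ∃ C, 0 ≤ C ∧ ∀ v w : H1, ‖v‖ ≤ R → ‖w‖ ≤ R →
    ‖H1.comp hg h0 v - H1.comp hg h0 w‖ ≤ C * ‖v - w‖ := by
  obtain ⟨C, hC, H⟩ := exists_lipschitz_bound hg R
  refine ⟨C + (2 * C + 2 * C * |R|), by positivity, fun v w hv hw => ?_⟩
  refine (H1.norm_le_add _).trans ?_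
  have e1 : ‖(H1.comp hg h0 v - H1.comp hg h0 w).toL2‖ ≤ C * ‖v - w‖ := by
    refine le_trans (Lp.norm_le_mul_norm_of_ae_le_mul (c := C) (g := (v - w).toL2) ?_)
      (by gcongr; exact (v - w).norm_toL2_le)
    filter_upwards [(H1.comp hg h0 v - H1.comp hg h0 w).coeFn_ae_eq_rep,
      (v - w).coeFn_ae_eq_rep] with x h1 h2
    rw [h1, h2, H1.rep_sub, H1.rep_sub, H1.rep_comp, H1.rep_comp]
    exact (H _ _ ((v.norm_rep_le x).trans hv) ((w.norm_rep_le x).trans hw)).1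
  have e2 : ‖(H1.comp hg h0 v - H1.comp hg h0 w).dx‖ ^ 2 ≤
      2 * C ^ 2 * ‖(v - w).dx‖ ^ 2 + 2 * C ^ 2 * ‖v - w‖ ^ 2 * ‖w.dx‖ ^ 2 := by
    refine L2.norm_sq_le_add ?_
    rw [map_sub, map_sub]
    filter_upwards [H1.dx_comp_ae hg h0 v, H1.dx_comp_ae hg h0 w,
      Lp.coeFn_sub (H1.comp hg h0 v).dx (H1.comp hg h0 w).dx,
      Lp.coeFn_sub v.dx w.dx] with x h1 h2 h3 h4
    rw [h3, h4, Pi.sub_apply, Pi.sub_apply, h1, h2]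
    obtain ⟨-, k2, k3⟩ := H (v.rep x) (w.rep x) ((v.norm_rep_le x).trans hv)
      ((w.norm_rep_le x).trans hw)
    have k4 : ‖v.rep x - w.rep x‖ ≤ ‖v - w‖ := by
      have := (v - w).norm_rep_le x
      rwa [H1.rep_sub] at this
    have k5 : ‖fderiv ℝ g (v.rep x) (v.dx x) - fderiv ℝ g (w.rep x) (w.dx x)‖ ≤
        C * ‖v.dx x - w.dx x‖ + C * ‖v - w‖ * ‖w.dx x‖ := by
      have : fderiv ℝ g (v.rep x) (v.dx x) - fderiv ℝ g (w.rep x) (w.dx x) =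
          fderiv ℝ g (v.rep x) (v.dx x - w.dx x) +
            (fderiv ℝ g (v.rep x) - fderiv ℝ g (w.rep x)) (w.dx x) := by
        simp
      rw [this]
      refine (norm_add_le _ _).trans (add_le_add ?_ ?_)
      · exact (ContinuousLinearMap.le_opNorm _ _).trans (by gcongr)
      · refine (ContinuousLinearMap.le_opNorm _ _).trans ?_
        gcongr
        exact k2.trans (by gcongr)
    calc _ ≤ (C * ‖v.dx x - w.dx x‖ + C * ‖v - w‖ * ‖w.dx x‖) ^ 2 := by gcongr
      _ ≤ _ := by nlinarith [sq_nonneg (C * ‖v.dx x - w.dx x‖ - C * ‖v - w‖ * ‖w.dx x‖)]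
  have e3 : ‖(H1.comp hg h0 v - H1.comp hg h0 w).dx‖ ≤ (2 * C + 2 * C * |R|) * ‖v - w‖ := by
    refine le_of_sq_le_sq (e2.trans ?_) (by positivity)
    have k1 : ‖(v - w).dx‖ ^ 2 ≤ ‖v - w‖ ^ 2 := by gcongr; exact (v - w).norm_dx_le
    have k2 : ‖w.dx‖ ^ 2 ≤ |R| ^ 2 := by
      gcongr; exact w.norm_dx_le.trans (hw.trans (le_abs_self R))
    calc _ ≤ 2 * C ^ 2 * ‖v - w‖ ^ 2 + 2 * C ^ 2 * ‖v - w‖ ^ 2 * |R| ^ 2 := by gcongr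
      _ ≤ _ := by
        have : 0 ≤ C ^ 2 * ‖v - w‖ ^ 2 := by positivity
        have h3 : 0 ≤ C ^ 2 * ‖v - w‖ ^ 2 * |R| := by positivity
        have h4 : 0 ≤ C ^ 2 * ‖v - w‖ ^ 2 * |R| ^ 2 := by positivity
        nlinarith
  linarith

end Nemytskii

section Reflection

theorem H1.isPrimitive_reflect (v : H1) :
    IsPrimitive (fun x => v.rep (-x)) (fun x => - v.dx (-x)) := by
  have hm : MemLp (fun x => v.dx (-x)) 2 :=
    v.memLp_dx.comp_measurePreserving (Measure.measurePreserving_neg volume)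
  refine ⟨hm.neg.locallyIntegrable (by norm_num), fun x y => ?_⟩
  rw [v.isPrimitive_rep.sub_eq, intervalIntegral.integral_neg,
    intervalIntegral.integral_comp_neg, ← intervalIntegral.integral_symm]

theorem H1.memLp_rep_neg (v : H1) : MemLp (fun x => v.rep (-x)) 2 :=
  v.memLp_rep.comp_measurePreserving (Measure.measurePreserving_neg volume)

theorem H1.memLp_dx_neg (v : H1) : MemLp (fun x => - v.dx (-x)) 2 :=
  MemLp.neg (v.memLp_dx.comp_measurePreserving (Measure.measurePreserving_neg volume))

/-- The reflection `v(x) ↦ v(-x)` on `H¹(ℝ)`. -/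
def H1.reflectAux (v : H1) : H1 :=
  H1.ofPrimitive v.isPrimitive_reflect v.memLp_rep_neg v.memLp_dx_neg

theorem H1.rep_reflectAux (v : H1) : v.reflectAux.rep = fun x => v.rep (-x) :=
  H1.rep_ofPrimitive _ _ _

theorem H1.norm_sq_dx_reflectAux (v : H1) : ‖v.reflectAux.dx‖ ^ 2 = ‖v.dx‖ ^ 2 := by
  rw [H1.norm_sq_dx, H1.norm_sq_dx, ← integral_neg_eq_self (fun x => ‖v.dx x‖ ^ 2)]
  refine integral_congr_ae ?_
  filter_upwards [H1.dx_ofPrimitive_ae v.isPrimitive_reflect v.memLp_rep_neg v.memLp_dx_neg]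
    with x hx
  rw [H1.reflectAux, hx, norm_neg]

theorem H1.norm_sq_toL2_reflectAux (v : H1) : ‖v.reflectAux.toL2‖ ^ 2 = ‖v.toL2‖ ^ 2 := by
  rw [H1.norm_sq_toL2, H1.norm_sq_toL2, ← integral_neg_eq_self (fun x => ‖v.rep x‖ ^ 2),
    H1.rep_reflectAux]

/-- The reflection `v(x) ↦ v(-x)` as an isometry of `H¹(ℝ)`. -/
def H1.reflect : H1 →ₗᵢ[ℂ] H1 where
  toFun := H1.reflectAux
  map_add' v w := H1.ext_rep (by simp only [H1.rep_reflectAux, H1.rep_add]; rfl)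
  map_smul' c v := H1.ext_rep (by simp only [H1.rep_reflectAux, H1.rep_smul]; rfl)
  norm_map' v := by
    refine (sq_eq_sq₀ (norm_nonneg _) (norm_nonneg _)).mp ?_
    change ‖v.reflectAux‖ ^ 2 = _
    rw [H1.norm_sq_eq, H1.norm_sq_eq, H1.norm_sq_dx_reflectAux, H1.norm_sq_toL2_reflectAux]

theorem H1.rep_reflect (v : H1) : (H1.reflect v).rep = fun x => v.rep (-x) := v.rep_reflectAux

theorem H1.dx_reflect_ae (v : H1) : ((H1.reflect v).dx : ℝ → ℂ) =ᵐ[volume] fun x => - v.dx (-x) :=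
  H1.dx_ofPrimitive_ae v.isPrimitive_reflect v.memLp_rep_neg v.memLp_dx_neg

end Reflection

end Operators

end DeltaNLS

namespace DeltaNLS

open MeasureTheory Set Filter Topology
open scoped ComplexConjugate ContDiff

/-! ### The unitary group `e^{-it(1/J - 1)}` of an injective self-adjoint operator `J`. -/

section UnitaryGroup

/-- The function `s e^{-it(1/s - 1)}`. -/
def groupSymbol (t : ℝ) (z : ℂ) : ℂ := z * Complex.exp (-(t * Complex.I) * (z⁻¹ - 1))

theorem norm_exp_neg_ofReal_mul_I (t s : ℝ) :
    ‖Complex.exp (-(t * Complex.I) * ((s : ℂ)⁻¹ - 1))‖ = 1 := by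
  have : -(t * Complex.I) * ((s : ℂ)⁻¹ - 1) = ((-(t * (s⁻¹ - 1)) : ℝ) : ℂ) * Complex.I := by
    push_cast; ring
  rw [this, Complex.norm_exp_ofReal_mul_I]

theorem norm_groupSymbol (t s : ℝ) : ‖groupSymbol t s‖ = |s| := by
  rw [groupSymbol, norm_mul, norm_exp_neg_ofReal_mul_I, mul_one, Complex.norm_real, Real.norm_eq_abs]

theorem groupSymbol_mul (t s : ℝ) (z : ℂ) :
    groupSymbol t z * groupSymbol s z = z * groupSymbol (t + s) z := by
  have : -(((t + s : ℝ) : ℂ) * Complex.I) * (z⁻¹ - 1) =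
    -(t * Complex.I) * (z⁻¹ - 1) + -(s * Complex.I) * (z⁻¹ - 1) := by push_cast; ring
  rw [groupSymbol, groupSymbol, groupSymbol, this, Complex.exp_add]
  ring

theorem star_groupSymbol_mul (t s : ℝ) :
    star (groupSymbol t s) * groupSymbol t s = (s : ℂ) * s := by
  have h := Complex.conj_mul' (groupSymbol t s)
  rw [norm_groupSymbol] at h
  rw [Complex.star_def, h, ← Complex.ofReal_pow, sq_abs]
  push_cast; ring

/-- On the real axis the exponential has modulus one, so the factor `z` restores continuity at `0`,
where the phase oscillates. This is why the functional calculus is applied to `J U(t)` rather than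
to `U(t)`. -/
theorem continuousOn_groupSymbol (t : ℝ) {S : Set ℂ} (hS : ∀ z ∈ S, z = (z.re : ℂ)) :
    ContinuousOn (groupSymbol t) S := by
  intro z hz
  by_cases h : z = 0
  · subst h
    have : Tendsto (groupSymbol t) (𝓝[S] 0) (𝓝 0) := by
      rw [tendsto_zero_iff_norm_tendsto_zero]
      have h1 : Tendsto (fun z : ℂ => ‖z‖) (𝓝[S] 0) (𝓝 0) := by
        have := (continuous_norm (E := ℂ)).tendsto 0
        rw [norm_zero] at this
        exact this.mono_left nhdsWithin_le_nhds
      refine h1.congr' ?_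
      filter_upwards [self_mem_nhdsWithin] with w hw
      rw [hS w hw, norm_groupSymbol, Complex.norm_real, Real.norm_eq_abs]
    have h0 : groupSymbol t 0 = 0 := by simp [groupSymbol]
    rw [ContinuousWithinAt, h0]
    exact this
  · refine ContinuousAt.continuousWithinAt ?_
    unfold groupSymbol
    have := continuousAt_inv₀ h
    fun_prop

variable {X : Type*} [NormedAddCommGroup X] [InnerProductSpace ℂ X] [CompleteSpace X]
  (J : X →L[ℂ] X)

/-- The operator `J U(t)`, where `U(t) = e^{-it(1/J - 1)}`. -/
def regGroup (t : ℝ) : X →L[ℂ] X := cfc (groupSymbol t) J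

variable {J}

theorem spectrum_real (hJ : IsSelfAdjoint J) : ∀ z ∈ spectrum ℂ J, z = (z.re : ℂ) :=
  fun _ hz => hJ.mem_spectrum_eq_re hz

theorem abs_re_le (_ : IsSelfAdjoint J) : ∀ z ∈ spectrum ℂ J, |z.re| ≤ ‖J‖ := by
  intro z hz
  rcases subsingleton_or_nontrivial X with h | h
  · exact absurd hz (by
      have : Subsingleton (X →L[ℂ] X) := inferInstance
      simp [spectrum.of_subsingleton])
  · have := spectrum.norm_le_norm_of_mem hz
    exact (Complex.abs_re_le_norm z).trans this

theorem cfc_id_J (hJ : IsSelfAdjoint J) : cfc (fun z : ℂ => z) J = J :=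
  haveI := hJ.isStarNormal
  cfc_id' ℂ J

theorem regGroup_mul (hJ : IsSelfAdjoint J) (t s : ℝ) :
    regGroup J t * regGroup J s = J * regGroup J (t + s) := by
  have hn := hJ.isStarNormal
  have c := fun t => continuousOn_groupSymbol t (spectrum_real hJ)
  calc regGroup J t * regGroup J s = cfc (fun z => groupSymbol t z * groupSymbol s z) J :=
        (cfc_mul _ _ J (c t) (c s)).symm
    _ = cfc (fun z => z * groupSymbol (t + s) z) J := by
        congr 1; funext z; exact groupSymbol_mul t s z
    _ = cfc (fun z : ℂ => z) J * regGroup J (t + s) := cfc_mul _ _ J (by fun_prop) (c (t + s))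
    _ = J * regGroup J (t + s) := by rw [cfc_id_J hJ]

theorem regGroup_comm (hJ : IsSelfAdjoint J) (t : ℝ) : J * regGroup J t = regGroup J t * J := by
  have hn := hJ.isStarNormal
  have := cfc_commute_cfc (fun z : ℂ => z) (groupSymbol t) J
  rw [cfc_id_J hJ] at this
  exact this

theorem regGroup_zero (hJ : IsSelfAdjoint J) : regGroup J 0 = J := by
  have : groupSymbol 0 = fun z : ℂ => z := by funext z; simp [groupSymbol]
  rw [regGroup, this, cfc_id_J hJ]

theorem star_regGroup_mul (hJ : IsSelfAdjoint J) (t : ℝ) :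
    star (regGroup J t) * regGroup J t = J * J := by
  have hn := hJ.isStarNormal
  have c := continuousOn_groupSymbol t (spectrum_real hJ)
  rw [regGroup, ← cfc_star, ← cfc_mul _ _ J c.star c]
  calc _ = cfc (fun z : ℂ => z * z) J := by
        refine cfc_congr fun z hz => ?_
        change star (groupSymbol t z) * groupSymbol t z = z * z
        rw [spectrum_real hJ z hz, star_groupSymbol_mul]
    _ = cfc (fun z : ℂ => z) J * cfc (fun z : ℂ => z) J :=
        cfc_mul _ _ J (by fun_prop) (by fun_prop)
    _ = J * J := by rw [cfc_id_J hJ]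

/-- `regGroup J t x` is going to be the value of the group at `J x`, so this is isometry on the
range of `J`, which is dense when `J` is injective; it justifies the extension by continuity. -/
theorem norm_regGroup_apply (hJ : IsSelfAdjoint J) (t : ℝ) (x : X) :
    ‖regGroup J t x‖ = ‖J x‖ := by
  have h := star_regGroup_mul hJ t
  refine (sq_eq_sq₀ (norm_nonneg _) (norm_nonneg _)).mp ?_
  have e1 := ContinuousLinearMap.apply_norm_sq_eq_inner_adjoint_left (regGroup J t) x
  have e2 := ContinuousLinearMap.apply_norm_sq_eq_inner_adjoint_left J x
  rw [← ContinuousLinearMap.star_eq_adjoint, ← ContinuousLinearMap.mul_def] at e1 e2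
  rw [e1, e2, h, hJ.star_eq]

theorem norm_exp_sub_one_sub_le (x : ℝ) :
    ‖Complex.exp (x * Complex.I) - 1 - x * Complex.I‖ ≤ 3 * x ^ 2 := by
  have hx : ‖(x : ℂ) * Complex.I‖ = |x| := by simp
  rcases le_total |x| 1 with h | h
  · refine (Complex.norm_exp_sub_one_sub_id_le (hx.trans_le h)).trans ?_
    rw [hx, sq_abs]
    nlinarith [sq_nonneg x]
  -- For `|x| ≥ 1` the crude bound `2 + |x| ≤ 3 x²` suffices.
  · refine (norm_sub_le _ _).trans ?_
    have h2 : ‖Complex.exp (x * Complex.I) - 1‖ ≤ 2 := by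
      refine (norm_sub_le _ _).trans ?_
      rw [Complex.norm_exp_ofReal_mul_I, norm_one]
      norm_num
    rw [hx, ← sq_abs]
    nlinarith

theorem exp_symbol_eq (t s : ℝ) : Complex.exp (-(t * Complex.I) * ((s : ℂ)⁻¹ - 1)) =
    Complex.exp (((-(t * (s⁻¹ - 1)) : ℝ) : ℂ) * Complex.I) := by
  congr 1; push_cast; ring

theorem norm_symbol_sub_le (t s : ℝ) :
    ‖groupSymbol t s - s + t * Complex.I * (1 - s)‖ ≤ 2 * (1 + |s|) * |t| := by
  have h1 : ‖(t : ℂ) * Complex.I * (1 - s)‖ ≤ (1 + |s|) * |t| := by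
    have : ‖(1 : ℂ) - s‖ ≤ 1 + |s| := by
      refine (norm_sub_le _ _).trans ?_
      simp
    rw [norm_mul, norm_mul, Complex.norm_real, Complex.norm_I, mul_one, Real.norm_eq_abs, mul_comm]
    gcongr
  have h2 : ‖groupSymbol t s - s‖ ≤ (1 + |s|) * |t| := by
    by_cases hs : s = 0
    · subst hs
      simp [groupSymbol]
    · have : groupSymbol t s - s = s * (Complex.exp (Complex.I * ((-(t * (s⁻¹ - 1)) : ℝ) : ℂ)) - 1) := by
        rw [groupSymbol, exp_symbol_eq, mul_comm Complex.I]; ring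
      rw [this, norm_mul, Complex.norm_real, Real.norm_eq_abs]
      calc _ ≤ |s| * ‖-(t * (s⁻¹ - 1))‖ := by
            gcongr
            exact Real.norm_exp_I_mul_ofReal_sub_one_le
        _ = |1 - s| * |t| := by
            rw [Real.norm_eq_abs, ← abs_mul, ← abs_mul, ← abs_neg]
            congr 1; field_simp
        _ ≤ _ := by
            gcongr
            refine (abs_sub _ _).trans ?_
            simp
  exact (norm_add_le _ _).trans (by linarith)

/-- The second-order Taylor remainder has size `t² (1/s - 1)²`. The factor `s` of the symbol and the
additional one absorb `1/s²`, uniformly down to `s = 0`; with a single factor `s` only a bound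
linear in `t` survives. -/
theorem norm_symbol_sub_mul_le (t s : ℝ) :
    ‖(groupSymbol t s - s + t * Complex.I * (1 - s)) * s‖ ≤ 3 * (1 + |s|) ^ 2 * t ^ 2 := by
  by_cases hs : s = 0
  · subst hs
    simp
    positivity
  · have hs' : (s : ℂ) ≠ 0 := by exact_mod_cast hs
    have : (groupSymbol t s - s + t * Complex.I * (1 - s)) * s = s ^ 2 *
        (Complex.exp (((-(t * (s⁻¹ - 1)) : ℝ) : ℂ) * Complex.I) - 1 -
          ((-(t * (s⁻¹ - 1)) : ℝ) : ℂ) * Complex.I) := by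
      rw [groupSymbol, exp_symbol_eq]
      push_cast
      field_simp
      ring
    rw [this, norm_mul, norm_pow, Complex.norm_real, Real.norm_eq_abs, sq_abs]
    calc _ ≤ s ^ 2 * (3 * (-(t * (s⁻¹ - 1))) ^ 2) := by
          gcongr
          exact norm_exp_sub_one_sub_le _
      _ = 3 * |1 - s| ^ 2 * t ^ 2 := by
          rw [sq_abs]; field_simp
      _ ≤ _ := by
          gcongr
          refine (abs_sub _ _).trans ?_
          simp

/-- The error of the first-order expansion of `J U(t)` at `t = 0`. -/
def regDefect (J : X →L[ℂ] X) (t : ℝ) : X →L[ℂ] X :=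
  regGroup J t - J + ((t : ℂ) * Complex.I) • (1 - J)

theorem regDefect_eq (hJ : IsSelfAdjoint J) (t : ℝ) : regDefect J t =
    cfc (fun z => groupSymbol t z - z + t * Complex.I * (1 - z)) J := by
  have hn := hJ.isStarNormal
  have c := continuousOn_groupSymbol t (spectrum_real hJ)
  rw [cfc_add (R := ℂ) J (fun z => groupSymbol t z - z) (fun z => t * Complex.I * (1 - z))
      (by fun_prop) (by fun_prop),
    cfc_sub (R := ℂ) (groupSymbol t) (fun z => z) J c (by fun_prop),
    cfc_const_mul (R := ℂ) (t * Complex.I) (fun z => 1 - z) J (by fun_prop),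
    cfc_sub (R := ℂ) (fun _ => 1) (fun z => z) J (by fun_prop) (by fun_prop), cfc_id_J hJ,
    show cfc (fun _ : ℂ => (1 : ℂ)) J = 1 from cfc_const_one ℂ J]
  rfl

theorem norm_regDefect_le (hJ : IsSelfAdjoint J) (t : ℝ) :
    ‖regDefect J t‖ ≤ 2 * (1 + ‖J‖) * |t| := by
  have hn := hJ.isStarNormal
  rw [regDefect_eq hJ]
  refine norm_cfc_le (by positivity) fun z hz => ?_
  rw [spectrum_real hJ z hz]
  refine (norm_symbol_sub_le t z.re).trans ?_
  gcongr
  exact abs_re_le hJ z hz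

theorem norm_regDefect_mul_le (hJ : IsSelfAdjoint J) (t : ℝ) :
    ‖regDefect J t * J‖ ≤ 3 * (1 + ‖J‖) ^ 2 * t ^ 2 := by
  have hn := hJ.isStarNormal
  have c := continuousOn_groupSymbol t (spectrum_real hJ)
  have e : regDefect J t * J =
      cfc (fun z => (groupSymbol t z - z + t * Complex.I * (1 - z)) * z) J := by
    rw [cfc_mul (R := ℂ) (fun z => groupSymbol t z - z + t * Complex.I * (1 - z)) (fun z => z) J
      (by fun_prop) (by fun_prop), cfc_id_J hJ, regDefect_eq hJ]
  rw [e]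
  refine norm_cfc_le (by positivity) fun z hz => ?_
  rw [spectrum_real hJ z hz]
  refine (norm_symbol_sub_mul_le t z.re).trans ?_
  gcongr
  exact abs_re_le hJ z hz

theorem denseRange_of_isSelfAdjoint (hJ : IsSelfAdjoint J) (hi : Function.Injective J) :
    DenseRange J := by
  have h1 : (LinearMap.range J.toLinearMap)ᗮ = ⊥ := by
    rw [ContinuousLinearMap.orthogonal_range, ← ContinuousLinearMap.star_eq_adjoint, hJ.star_eq]
    exact LinearMap.ker_eq_bot.mpr hi
  have h2 := (Submodule.topologicalClosure_eq_top_iff (K := LinearMap.range J.toLinearMap)).mpr h1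
  have h3 := Submodule.dense_iff_topologicalClosure_eq_top.mpr h2
  exact h3

/-- The unitary group `U(t) = e^{-it(1/J - 1)}` of an injective self-adjoint operator `J`. -/
def unitaryGroup (J : X →L[ℂ] X) (t : ℝ) : X →L[ℂ] X :=
  (regGroup J t).toLinearMap.extendOfNorm J.toLinearMap

theorem unitaryGroup_apply_J (hJ : IsSelfAdjoint J) (hi : Function.Injective J) (t : ℝ) (x : X) : unitaryGroup J t (J x) = regGroup J t x :=
  LinearMap.extendOfNorm_eq (f := (regGroup J t).toLinearMap) (e := J.toLinearMap)
    (denseRange_of_isSelfAdjoint hJ hi)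
    ⟨1, fun x => by simpa using (norm_regGroup_apply hJ t x).le⟩ x

theorem norm_unitaryGroup (hJ : IsSelfAdjoint J) (hi : Function.Injective J) (t : ℝ) (x : X) : ‖unitaryGroup J t x‖ = ‖x‖ := by
  refine (denseRange_of_isSelfAdjoint hJ hi).induction_on (p := fun x => ‖unitaryGroup J t x‖ = ‖x‖)
    x (isClosed_eq (by fun_prop) (by fun_prop)) fun y => ?_
  rw [unitaryGroup_apply_J hJ hi, norm_regGroup_apply hJ]

theorem J_unitaryGroup (hJ : IsSelfAdjoint J) (hi : Function.Injective J) (t : ℝ) (x : X) : J (unitaryGroup J t x) = regGroup J t x := by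
  refine (denseRange_of_isSelfAdjoint hJ hi).induction_on
    (p := fun x => J (unitaryGroup J t x) = regGroup J t x)
    x (isClosed_eq (by fun_prop) (by fun_prop)) fun y => ?_
  rw [unitaryGroup_apply_J hJ hi]
  exact congrArg (fun T : X →L[ℂ] X => T y) (regGroup_comm hJ t)

theorem unitaryGroup_comm_J (hJ : IsSelfAdjoint J) (hi : Function.Injective J) (t : ℝ) (x : X) :
    unitaryGroup J t (J x) = J (unitaryGroup J t x) := by
  rw [J_unitaryGroup hJ hi, unitaryGroup_apply_J hJ hi]

theorem unitaryGroup_zero (hJ : IsSelfAdjoint J) (hi : Function.Injective J) (x : X) : unitaryGroup J 0 x = x :=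
  hi (by rw [J_unitaryGroup hJ hi, regGroup_zero hJ])

theorem unitaryGroup_add (hJ : IsSelfAdjoint J) (hi : Function.Injective J) (t s : ℝ) (x : X) :
    unitaryGroup J (t + s) x = unitaryGroup J t (unitaryGroup J s x) := by
  -- Two applications of `J` turn both sides into products of regularized operators, to which
  -- `regGroup_mul` applies.
  refine hi (hi ?_)
  have e1 : J (unitaryGroup J (t + s) x) = regGroup J (t + s) x := J_unitaryGroup hJ hi _ _
  have e2 : J (unitaryGroup J t (unitaryGroup J s x)) = regGroup J t (unitaryGroup J s x) :=
    J_unitaryGroup hJ hi _ _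
  have e3 : J (regGroup J t (unitaryGroup J s x)) = regGroup J t (J (unitaryGroup J s x)) :=
    congrArg (fun T : X →L[ℂ] X => T (unitaryGroup J s x)) (regGroup_comm hJ t)
  have e4 : regGroup J t (regGroup J s x) = J (regGroup J (t + s) x) :=
    congrArg (fun T : X →L[ℂ] X => T x) (regGroup_mul hJ t s)
  rw [e1, e2, e3, J_unitaryGroup hJ hi, e4]

theorem unitaryGroup_neg_apply (hJ : IsSelfAdjoint J) (hi : Function.Injective J) (t : ℝ) (x : X) :
    unitaryGroup J (-t) (unitaryGroup J t x) = x := by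
  rw [← unitaryGroup_add hJ hi, neg_add_cancel, unitaryGroup_zero hJ hi]

theorem unitaryGroup_apply_neg (hJ : IsSelfAdjoint J) (hi : Function.Injective J) (t : ℝ) (x : X) :
    unitaryGroup J t (unitaryGroup J (-t) x) = x := by
  rw [← unitaryGroup_add hJ hi, add_neg_cancel, unitaryGroup_zero hJ hi]

theorem inner_unitaryGroup (hJ : IsSelfAdjoint J) (hi : Function.Injective J) (t : ℝ) (x y : X) :
    inner ℂ (unitaryGroup J t x) (unitaryGroup J t y) = inner ℂ x y :=
  (LinearIsometry.mk (unitaryGroup J t).toLinearMap (norm_unitaryGroup hJ hi t)).inner_map_map x y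

/-- The generator `-i(1/J - 1)` sends `J x` to `-i(x - J x)`. The remainder is `O(t)` in operator
norm and `O(t²)` on the range of `J`; approximating `x` by elements `J y` gives `o(t)`. -/
theorem hasDerivAt_unitaryGroup_zero (hJ : IsSelfAdjoint J) (hi : Function.Injective J) (x : X) :
    HasDerivAt (fun t => unitaryGroup J t (J x)) (-Complex.I • (x - J x)) 0 := by
  rw [hasDerivAt_iff_isLittleO, Asymptotics.isLittleO_iff]
  intro c hc
  set A := 2 * (1 + ‖J‖) with hA
  have hApos : 0 < A := by positivity
  obtain ⟨y, hy⟩ : ∃ y, ‖x - J y‖ < c / (2 * A) := by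
    obtain ⟨z, ⟨y, rfl⟩, hz⟩ := Metric.mem_closure_iff.mp (denseRange_of_isSelfAdjoint hJ hi x)
      (c / (2 * A)) (by positivity)
    exact ⟨y, by rwa [dist_eq_norm] at hz⟩
  set B := 3 * (1 + ‖J‖) ^ 2 * ‖y‖ with hB
  have hB0 : 0 ≤ B := by positivity
  have hev : ∀ᶠ t : ℝ in 𝓝 0, B * |t| ≤ c / 2 := by
    have : Tendsto (fun t : ℝ => B * |t|) (𝓝 0) (𝓝 0) := by
      have h : Continuous fun t : ℝ => B * |t| := by fun_prop
      simpa using h.tendsto 0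
    exact (this.eventually (gt_mem_nhds (half_pos hc))).mono fun t ht => ht.le
  filter_upwards [hev] with t ht
  have e : unitaryGroup J t (J x) - unitaryGroup J 0 (J x) - (t - 0) • (-Complex.I • (x - J x)) =
      regDefect J t x := by
    rw [unitaryGroup_zero hJ hi, unitaryGroup_apply_J hJ hi, regDefect]
    simp only [add_apply, sub_apply, smul_apply, one_apply_eq_self, sub_zero]
    rw [neg_smul, smul_neg, sub_neg_eq_add, mul_smul]
    rfl
  have e2 : regDefect J t x = regDefect J t (x - J y) + (regDefect J t * J) y := by
    simp
  rw [e, e2, sub_zero, Real.norm_eq_abs]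
  have k1 : ‖regDefect J t (x - J y)‖ ≤ A * |t| * (c / (2 * A)) :=
    (ContinuousLinearMap.le_opNorm _ _).trans
      (mul_le_mul (norm_regDefect_le hJ t) hy.le (norm_nonneg _) (by positivity))
  have k2 : ‖(regDefect J t * J) y‖ ≤ B * |t| * |t| := by
    refine (ContinuousLinearMap.le_opNorm _ _).trans ?_
    calc _ ≤ 3 * (1 + ‖J‖) ^ 2 * t ^ 2 * ‖y‖ := by
          gcongr
          exact norm_regDefect_mul_le hJ t
      _ = B * |t| * |t| := by rw [hB, ← sq_abs t]; ring
  calc _ ≤ A * |t| * (c / (2 * A)) + B * |t| * |t| := (norm_add_le _ _).trans (add_le_add k1 k2)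
    _ ≤ c / 2 * |t| + c / 2 * |t| := by
        refine add_le_add (le_of_eq (by field_simp)) ?_
        gcongr
    _ = c * |t| := by ring

theorem hasDerivAt_unitaryGroup (hJ : IsSelfAdjoint J) (hi : Function.Injective J) (x : X) (t : ℝ) :
    HasDerivAt (fun t => unitaryGroup J t (J x)) (-Complex.I • unitaryGroup J t (x - J x)) t := by
  have h0 : HasDerivAt (fun s => unitaryGroup J s (J x)) (-Complex.I • (x - J x)) (t - t) := by
    rw [sub_self]; exact hasDerivAt_unitaryGroup_zero hJ hi x
  have h1 := h0.comp_sub_const t t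
  have h2 := ((unitaryGroup J t).restrictScalars ℝ).hasFDerivAt.comp_hasDerivAt t h1
  refine (h2.congr_deriv ?_).congr_of_eventuallyEq (Eventually.of_forall fun s => ?_)
  · simp
  · change _ = unitaryGroup J t (unitaryGroup J (s - t) (J x))
    rw [← unitaryGroup_add hJ hi, add_sub_cancel]

theorem continuous_unitaryGroup_apply (hJ : IsSelfAdjoint J) (hi : Function.Injective J) (x : X) :
    Continuous fun t => unitaryGroup J t x := by
  refine continuous_of_uniform_approx_of_continuous (f := fun t => unitaryGroup J t x) fun u hu => ?_
  obtain ⟨ε, hε, hεu⟩ := Metric.mem_uniformity_dist.mp hu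
  obtain ⟨z, ⟨y, rfl⟩, hz⟩ := Metric.mem_closure_iff.mp (denseRange_of_isSelfAdjoint hJ hi x) ε hε
  refine ⟨fun t => unitaryGroup J t (J y),
    continuous_iff_continuousAt.mpr fun t => (hasDerivAt_unitaryGroup hJ hi y t).continuousAt,
    fun t => hεu ?_⟩
  rw [dist_eq_norm, ← map_sub, norm_unitaryGroup hJ hi, ← dist_eq_norm]
  exact hz

/-- Isometry upgrades strong continuity to joint continuity in time and vector. -/
theorem tendsto_unitaryGroup (hJ : IsSelfAdjoint J) (hi : Function.Injective J) {α : Type*}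
    {l : Filter α} {τ : α → ℝ} {y : α → X} {t : ℝ} {x : X} (hτ : Tendsto τ l (𝓝 t))
    (hy : Tendsto y l (𝓝 x)) :
    Tendsto (fun a => unitaryGroup J (τ a) (y a)) l (𝓝 (unitaryGroup J t x)) := by
  have h1 : Tendsto (fun a => unitaryGroup J (τ a) (y a - x)) l (𝓝 0) := by
    rw [tendsto_zero_iff_norm_tendsto_zero]
    simp only [norm_unitaryGroup hJ hi]
    have := (hy.sub_const x).norm
    simpa using this
  have h2 := ((continuous_unitaryGroup_apply hJ hi x).tendsto t).comp hτ
  have := h1.add h2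
  rw [zero_add] at this
  refine this.congr fun a => ?_
  simp

theorem continuousOn_unitaryGroup (hJ : IsSelfAdjoint J) (hi : Function.Injective J)
    {S : Set ℝ} {τ : ℝ → ℝ} {y : ℝ → X} (hτ : ContinuousOn τ S) (hy : ContinuousOn y S) :
    ContinuousOn (fun a => unitaryGroup J (τ a) (y a)) S := fun a ha =>
  tendsto_unitaryGroup hJ hi (hτ a ha) (hy a ha)

end UnitaryGroup

end DeltaNLS

namespace DeltaNLS

open MeasureTheory Set Filter Topology
open scoped ComplexConjugate ContDiff NNReal

/-! ### Maximal solutions of locally Lipschitz time-dependent differential equations. -/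

section ODE

variable {X : Type*} [NormedAddCommGroup X] [NormedSpace ℝ X]

/-- A time-dependent vector field, continuous in time, which vanishes at `0` and is Lipschitz
continuous on balls uniformly in time. -/
structure IsLocLipField (G : ℝ → X → X) : Prop where
  zero : ∀ t, G t 0 = 0
  cont : ∀ x, Continuous fun t => G t x
  lip : ∀ R : ℝ, ∃ K : ℝ≥0, ∀ t, LipschitzOnWith K (G t) (Metric.closedBall 0 R)

/-- `v` solves `v' = G(t, v)` on `[0, T)`. -/
def SolvesOn (G : ℝ → X → X) (T : ℝ) (v : ℝ → X) : Prop :=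
  ∀ t ∈ Ico 0 T, HasDerivWithinAt v (G t (v t)) (Ici 0) t

variable {G : ℝ → X → X} {T : ℝ} {v w : ℝ → X}

theorem SolvesOn.mono (h : SolvesOn G T v) {T' : ℝ} (hT : T' ≤ T) : SolvesOn G T' v :=
  fun t ht => h t ⟨ht.1, ht.2.trans_le hT⟩

theorem nhdsWithin_Ico_eq {a t T : ℝ} (ht : t < T) : 𝓝[Ico a T] t = 𝓝[Ici a] t := by
  rw [← Ici_inter_Iio]
  exact nhdsWithin_inter_of_mem' (mem_nhdsWithin_of_mem_nhds (Iio_mem_nhds ht))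

theorem SolvesOn.continuousWithinAt (h : SolvesOn G T v) {t : ℝ} (ht : t ∈ Ico 0 T) :
    ContinuousWithinAt v (Ici 0) t := (h t ht).continuousWithinAt

theorem SolvesOn.continuousOn (h : SolvesOn G T v) : ContinuousOn v (Ico 0 T) := fun _ ht =>
  (h.continuousWithinAt ht).mono Ico_subset_Ici_self

theorem SolvesOn.congr (h : SolvesOn G T v) (e : EqOn w v (Ico 0 T)) : SolvesOn G T w := by
  intro t ht
  have h1 := h t ht
  rw [← e ht] at h1
  refine h1.congr_of_eventuallyEq ?_ (e ht)
  rw [← nhdsWithin_Ico_eq ht.2]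
  filter_upwards [self_mem_nhdsWithin] with s hs using e hs

theorem SolvesOn.unique (hG : IsLocLipField G) (hv : SolvesOn G T v) (hw : SolvesOn G T w)
    (h0 : v 0 = w 0) : EqOn v w (Ico 0 T) := by
  intro t ht
  have hsub : Icc 0 t ⊆ Ico 0 T := fun s hs => ⟨hs.1, hs.2.trans_lt ht.2⟩
  have cv := hv.continuousOn.mono hsub
  have cw := hw.continuousOn.mono hsub
  obtain ⟨R1, h1⟩ := (isCompact_Icc.image_of_continuousOn cv).isBounded.exists_norm_le
  obtain ⟨R2, h2⟩ := (isCompact_Icc.image_of_continuousOn cw).isBounded.exists_norm_le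
  obtain ⟨K, hK⟩ := hG.lip (max R1 R2)
  refine ODE_solution_unique_of_mem_Icc_right (v := G) (K := K)
    (s := fun _ => Metric.closedBall 0 (max R1 R2)) (a := 0) (b := t)
    (fun s _ => hK s) cv (fun s hs => ?_) (fun s hs => ?_) cw (fun s hs => ?_) (fun s hs => ?_) h0
    ⟨ht.1, le_rfl⟩
  · exact (hv s (hsub (Ico_subset_Icc_self hs))).mono (Ici_subset_Ici.mpr hs.1)
  · exact mem_closedBall_zero_iff.mpr
      ((h1 _ (mem_image_of_mem v (Ico_subset_Icc_self hs))).trans (le_max_left _ _))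
  · exact (hw s (hsub (Ico_subset_Icc_self hs))).mono (Ici_subset_Ici.mpr hs.1)
  · exact mem_closedBall_zero_iff.mpr
      ((h2 _ (mem_image_of_mem w (Ico_subset_Icc_self hs))).trans (le_max_right _ _))

/-- The existence time depends only on a bound for the initial value, neither on `t₀` nor on `x₀`:
this uniformity is what yields the blow-up alternative. -/
theorem IsLocLipField.exists_local [CompleteSpace X] (hG : IsLocLipField G) (R : ℝ) : ∃ τ > 0, ∀ (t₀ : ℝ) (x₀ : X),
    ‖x₀‖ ≤ R → ∃ v : ℝ → X, v t₀ = x₀ ∧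
      ∀ t ∈ Icc t₀ (t₀ + τ), HasDerivWithinAt v (G t (v t)) (Icc t₀ (t₀ + τ)) t := by
  obtain ⟨K, hK⟩ := hG.lip (|R| + 1)
  -- Since `G t 0 = 0`, the field is bounded by `L` on the ball of radius `|R| + 1`, so during a
  -- time `1 / (L + 1)` the solution stays within distance one of `x₀`.
  set L : ℝ≥0 := K * Real.toNNReal (|R| + 1) with hL
  refine ⟨1 / (L + 1), by positivity, fun t₀ x₀ hx => ?_⟩
  have hτ : (0 : ℝ) < 1 / (L + 1) := by positivity
  have hsub : Metric.closedBall x₀ ((1 : ℝ≥0) : ℝ) ⊆ Metric.closedBall 0 (|R| + 1) := by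
    intro y hy
    rw [mem_closedBall_zero_iff]
    rw [mem_closedBall_iff_norm] at hy
    have := norm_le_norm_add_norm_sub' y x₀
    simp only [NNReal.coe_one] at hy
    linarith [le_abs_self R]
  have hpl : IsPicardLindelof G (tmin := t₀) (tmax := t₀ + 1 / (L + 1))
      ⟨t₀, left_mem_Icc.mpr (by linarith)⟩ x₀ 1 0 L K :=
    { lipschitzOnWith := fun t _ => (hK t).mono hsub
      continuousOn := fun x _ => (hG.cont x).continuousOn
      norm_le := fun t _ x hx => by
        have h1 := (hK t).norm_sub_le (hsub hx)
          (mem_closedBall_zero_iff.mpr (by simp; positivity) : (0 : X) ∈ _)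
        rw [hG.zero, sub_zero, sub_zero] at h1
        refine h1.trans ?_
        rw [hL, NNReal.coe_mul, Real.coe_toNNReal _ (by positivity)]
        gcongr
        exact mem_closedBall_zero_iff.mp (hsub hx)
      mul_max_le := by
        simp only [add_sub_cancel_left, sub_self, NNReal.coe_one, NNReal.coe_zero, sub_zero]
        rw [max_eq_left hτ.le, mul_one_div, div_le_one (by positivity)]
        linarith }
  obtain ⟨v, h1, h2⟩ := hpl.exists_eq_forall_mem_Icc_hasDerivWithinAt₀
  exact ⟨v, h1, h2⟩

/-- Concatenation of a solution on `[0,T)` with a solution on `[t₀, t₀+τ]`. -/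
theorem SolvesOn.exists_extend (hv : SolvesOn G T v) {t₀ τ : ℝ} (ht₀ : t₀ ∈ Ico 0 T)
    {w : ℝ → X} (h0 : w t₀ = v t₀)
    (hw : ∀ t ∈ Icc t₀ (t₀ + τ), HasDerivWithinAt w (G t (w t)) (Icc t₀ (t₀ + τ)) t) :
    ∃ z : ℝ → X, z 0 = v 0 ∧ SolvesOn G (t₀ + τ) z := by
  classical
  set z : ℝ → X := fun t => if t ≤ t₀ then v t else w t with hz
  have ez1 : ∀ t ≤ t₀, z t = v t := fun t ht => by simp [hz, ht]
  have ez2 : ∀ t, t₀ ≤ t → z t = w t := fun t ht => by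
    rcases ht.eq_or_lt with rfl | h
    · rw [ez1 _ le_rfl, h0]
    · simp [hz, not_le.mpr h]
  refine ⟨z, ez1 0 ht₀.1, fun t ht => ?_⟩
  have hwr : ∀ s ∈ Ico t₀ (t₀ + τ), HasDerivWithinAt z (G s (z s)) (Ici t₀) s := by
    intro s hs
    rw [ez2 s hs.1]
    have h1 : HasDerivWithinAt w (G s (w s)) (Ici t₀) s := by
      refine (hw s (Ico_subset_Icc_self hs)).mono_of_mem_nhdsWithin ?_
      rw [← nhdsWithin_Ico_eq hs.2]
      exact mem_of_superset self_mem_nhdsWithin Ico_subset_Icc_self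
    exact h1.congr (fun r hr => ez2 r hr) (ez2 s hs.1)
  rcases lt_or_ge t t₀ with h | h
  · rw [ez1 t h.le]
    refine (hv t ⟨ht.1, h.trans ht₀.2⟩).congr_of_eventuallyEq ?_ (ez1 t h.le)
    filter_upwards [mem_nhdsWithin_of_mem_nhds (Iio_mem_nhds h)] with s hs using ez1 s hs.le
  · have h2 := hwr t ⟨h, ht.2⟩
    rcases h.eq_or_lt with rfl | h
    · have h3 : HasDerivWithinAt z (G t₀ (z t₀)) (Icc 0 t₀) t₀ := by
        rw [ez1 _ le_rfl]
        refine ((hv t₀ ht₀).mono Icc_subset_Ici_self).congr (fun r hr => ez1 r hr.2) (ez1 _ le_rfl)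
      have h4 := h3.union h2
      rwa [Icc_union_Ici_eq_Ici ht₀.1] at h4
    · refine h2.mono_of_mem_nhdsWithin (mem_nhdsWithin_of_mem_nhds (Ici_mem_nhds h))

/-- A solution of `v' = G(t, v)` is either global or blows up in finite time. -/
theorem IsLocLipField.exists_maximal [CompleteSpace X] (hG : IsLocLipField G) (x₀ : X) :
    (∃ v : ℝ → X, v 0 = x₀ ∧ ∀ T, SolvesOn G T v) ∨
      ∃ T > 0, ∃ v : ℝ → X, v 0 = x₀ ∧ SolvesOn G T v ∧
        Tendsto (fun t => ‖v t‖) (𝓝[<] T) atTop := by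
  classical
  set S : Set ℝ := {T | ∃ v : ℝ → X, v 0 = x₀ ∧ SolvesOn G T v} with hS
  -- By uniqueness, solutions on different intervals agree where both are defined, so they glue to a
  -- single function.
  have hglue : ∃ v : ℝ → X, v 0 = x₀ ∧
      ∀ T, (∀ t < T, ∃ T' ∈ S, t < T') → SolvesOn G T v := by
    set v : ℝ → X := fun t => if h : ∃ T' ∈ S, t < T' then h.choose_spec.1.choose t else x₀ with hv
    have key : ∀ t, 0 ≤ t → ∀ T' ∈ S, t < T' → ∀ w : ℝ → X, w 0 = x₀ → SolvesOn G T' w →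
        v t = w t := by
      intro t ht T' hT' htT w hw0 hw
      have h : ∃ T' ∈ S, t < T' := ⟨T', hT', htT⟩
      have e : v t = h.choose_spec.1.choose t := by simp only [hv]; rw [dif_pos h]
      rw [e]
      have h1 := h.choose_spec.1.choose_spec
      have h2 := h.choose_spec.2
      refine SolvesOn.unique hG (h1.2.mono (min_le_left _ T')) (hw.mono (min_le_right _ _))
        (h1.1.trans hw0.symm) ⟨ht, lt_min h2 htT⟩
    refine ⟨v, ?_, fun T hT => ?_⟩
    · by_cases h : ∃ T' ∈ S, (0 : ℝ) < T'
      · obtain ⟨T', ⟨w, h1, h2⟩, h3⟩ := h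
        rw [key 0 le_rfl T' ⟨w, h1, h2⟩ h3 w h1 h2, h1]
      · simp only [hv]; rw [dif_neg h]
    · intro t ht
      obtain ⟨T', hT', htT⟩ := hT t ht.2
      obtain ⟨w, h1, h2⟩ := id hT'
      have : SolvesOn G T' v := h2.congr fun s hs => key s hs.1 T' hT' hs.2 w h1 h2
      exact this t ⟨ht.1, htT⟩
  obtain ⟨v, hv0, hv⟩ := hglue
  by_cases hb : BddAbove S
  · right
    obtain ⟨τ, hτ, hloc⟩ := hG.exists_local ‖x₀‖
    obtain ⟨w, hw0, hw⟩ := hloc 0 x₀ le_rfl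
    have hτS : τ ∈ S := by
      refine ⟨w, hw0, fun t ht => ?_⟩
      rw [zero_add] at hw
      refine (hw t (Ico_subset_Icc_self ht)).mono_of_mem_nhdsWithin ?_
      rw [← nhdsWithin_Ico_eq ht.2]
      exact mem_of_superset self_mem_nhdsWithin Ico_subset_Icc_self
    set T := sSup S with hT
    have hT0 : 0 < T := hτ.trans_le (le_csSup hb hτS)
    have hsol : SolvesOn G T v := hv T fun t ht => exists_lt_of_lt_csSup ⟨τ, hτS⟩ ht
    refine ⟨T, hT0, v, hv0, hsol, ?_⟩
    rw [tendsto_atTop]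
    intro R
    -- At a time later than `T - τ'` with norm below `R` the solution could be restarted and would
    -- reach beyond `T = sSup S`.
    obtain ⟨τ', hτ', hloc'⟩ := hG.exists_local R
    have hmem : Ioo (max 0 (T - τ')) T ∈ 𝓝[<] T :=
      Ioo_mem_nhdsLT (max_lt hT0 (by linarith))
    filter_upwards [hmem] with t ht
    by_contra hcon
    obtain ⟨w, h1, h2⟩ := hloc' t (v t) (not_le.mp hcon).le
    have ht0 : 0 ≤ t := (le_max_left _ _).trans ht.1.le
    obtain ⟨z, hz0, hz⟩ := hsol.exists_extend ⟨ht0, ht.2⟩ h1 h2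
    have hle := le_csSup hb (show t + τ' ∈ S from ⟨z, hz0.trans hv0, hz⟩)
    have := (le_max_right _ _).trans_lt ht.1
    linarith
  · left
    refine ⟨v, hv0, fun T => hv T fun t _ => ?_⟩
    rw [not_bddAbove_iff] at hb
    obtain ⟨T', h1, h2⟩ := hb t
    exact ⟨T', h1, h2⟩

end ODE

end DeltaNLS

namespace DeltaNLS

open MeasureTheory Set Filter Topology
open scoped ComplexConjugate ContDiff NNReal

/-! ### The semilinear equation in the interaction picture. -/

section Semilinear

variable {X : Type*} [NormedAddCommGroup X] [InnerProductSpace ℂ X] [CompleteSpace X]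
  {J : X →L[ℂ] X} {F : X → X} {T : ℝ} {u : ℝ → X}

/-- `u` solves `i u' = (1/J - 1) u - F(u)` on `[0, T)`, in the form
`i (J u)' = u - J u - J F(u)`. -/
def EvolvesOn (J : X →L[ℂ] X) (F : X → X) (T : ℝ) (u : ℝ → X) : Prop :=
  ContinuousOn u (Ico 0 T) ∧ ∀ t ∈ Ico 0 T,
    HasDerivWithinAt (fun s => J (u s)) (-Complex.I • (u t - J (u t) - J (F (u t)))) (Ici 0) t

/-- The vector field of the equation in the interaction picture. -/
def interactionField (J : X →L[ℂ] X) (F : X → X) (t : ℝ) (x : X) : X :=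
  Complex.I • unitaryGroup J (-t) (F (unitaryGroup J t x))

/-- `F` vanishes at `0` and is Lipschitz continuous on balls. -/
structure IsLocLip {X : Type*} [NormedAddCommGroup X] (F : X → X) : Prop where
  zero : F 0 = 0
  lip : ∀ R : ℝ, ∃ K : ℝ≥0, LipschitzOnWith K F (Metric.closedBall 0 R)

theorem IsLocLip.continuous {X : Type*} [NormedAddCommGroup X] {F : X → X} (hF : IsLocLip F) :
    Continuous F := by
  refine continuous_iff_continuousAt.mpr fun x => ?_
  obtain ⟨K, hK⟩ := hF.lip (‖x‖ + 1)
  refine hK.continuousOn.continuousAt (Metric.closedBall_mem_nhds_of_mem ?_)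
  simp

theorem isLocLipField_interactionField (hJ : IsSelfAdjoint J) (hi : Function.Injective J)
    (hF : IsLocLip F) : IsLocLipField (interactionField J F) where
  zero t := by simp [interactionField, hF.zero]
  cont x := by
    have h1 := (hF.continuous.comp (continuous_unitaryGroup_apply hJ hi x))
    have h2 : Continuous fun t => unitaryGroup J (-t) (F (unitaryGroup J t x)) :=
      continuous_iff_continuousAt.mpr fun t =>
        tendsto_unitaryGroup hJ hi (continuous_neg.tendsto t) (h1.tendsto t)
    exact h2.const_smul Complex.I
  lip R := by
    obtain ⟨K, hK⟩ := hF.lip R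
    refine ⟨K, fun t => LipschitzOnWith.of_dist_le_mul fun x hx y hy => ?_⟩
    rw [dist_eq_norm, interactionField, interactionField, ← smul_sub, norm_smul, Complex.norm_I,
      one_mul, ← map_sub, norm_unitaryGroup hJ hi]
    have e : ∀ z ∈ Metric.closedBall (0 : X) R, unitaryGroup J t z ∈ Metric.closedBall (0 : X) R := by
      intro z hz
      rw [mem_closedBall_zero_iff, norm_unitaryGroup hJ hi]
      exact mem_closedBall_zero_iff.mp hz
    have := hK.norm_sub_le (e x hx) (e y hy)
    rwa [← map_sub, norm_unitaryGroup hJ hi, ← dist_eq_norm x y] at this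

/-- As `z t = 0`, the slope of the product is `U(τ s)` applied to the slope of `z`. The derivative
of the group, available only on the range of `J`, does not enter. -/
theorem hasDerivWithinAt_unitaryGroup_apply (hJ : IsSelfAdjoint J) (hi : Function.Injective J)
    {z : ℝ → X} {z' : X} {S : Set ℝ} {t : ℝ} {τ : ℝ → ℝ} (hτ : ContinuousWithinAt τ S t)
    (hz : HasDerivWithinAt z z' S t) (h0 : z t = 0) :
    HasDerivWithinAt (fun s => unitaryGroup J (τ s) (z s)) (unitaryGroup J (τ t) z') S t := by
  rw [hasDerivWithinAt_iff_tendsto_slope] at hz ⊢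
  refine (tendsto_unitaryGroup hJ hi (hτ.mono_left (nhdsWithin_mono t sdiff_subset)) hz).congr
    fun s => ?_
  rw [slope_def_module, slope_def_module, h0, map_zero, sub_zero, sub_zero,
    ContinuousLinearMap.map_smul_of_tower]

/-- The expansion `u(s) = U(s - t) u(t) + i (s - t) F(u(t)) + o(s - t)`. -/
theorem SolvesOn.hasDerivWithinAt_sub (hJ : IsSelfAdjoint J) (hi : Function.Injective J)
    (hv : SolvesOn (interactionField J F) T fun t => unitaryGroup J (-t) (u t)) {t : ℝ}
    (ht : t ∈ Ico 0 T) :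
    HasDerivWithinAt (fun s => u s - unitaryGroup J (s - t) (u t)) (Complex.I • F (u t))
      (Ici 0) t := by
  have h1 := (hv t ht).sub_const (unitaryGroup J (-t) (u t))
  have h2 := hasDerivWithinAt_unitaryGroup_apply hJ hi (τ := fun s => s) continuousWithinAt_id h1
    (sub_self _)
  rw [interactionField, unitaryGroup_apply_neg hJ hi, map_smul, unitaryGroup_apply_neg hJ hi] at h2
  refine h2.congr_of_eventuallyEq (Eventually.of_forall fun s => ?_) ?_
  · simp only
    rw [map_sub, unitaryGroup_apply_neg hJ hi, ← unitaryGroup_add hJ hi, ← sub_eq_add_neg]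
  · simp [unitaryGroup_zero hJ hi]

/-- Set `v(t) = U(-t) u(t)`. Only `J u`, hence only `J v`, is assumed differentiable, with `(J v)' =
J g` and `g` continuous. Integrating and cancelling the injective `J` gives `v = v(0) + ∫ g`, so `v`
itself is differentiable. Conversely `J` is applied to the expansion of `u` around the free flow,
and `J U(s - t) u(t)` is differentiable in `s`. -/
theorem evolvesOn_iff (hJ : IsSelfAdjoint J) (hi : Function.Injective J) (hF : IsLocLip F) :
    EvolvesOn J F T u ↔ SolvesOn (interactionField J F) T fun t => unitaryGroup J (-t) (u t) := by
  constructor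
  · rintro ⟨hc, hd⟩
    set v : ℝ → X := fun t => unitaryGroup J (-t) (u t) with hv
    set g : ℝ → X := fun t => Complex.I • unitaryGroup J (-t) (F (u t)) with hg
    have hgc : ContinuousOn g (Ico 0 T) :=
      (continuousOn_unitaryGroup hJ hi continuousOn_id.neg
        (hF.continuous.comp_continuousOn hc)).const_smul Complex.I
    have hvc : ContinuousOn v (Ico 0 T) := continuousOn_unitaryGroup hJ hi continuousOn_id.neg hc
    have hJv : ∀ t ∈ Ico 0 T, HasDerivWithinAt (fun s => J (v s)) (J (g t)) (Ici 0) t := by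
      intro t ht
      have h1 := hasDerivWithinAt_unitaryGroup_apply hJ hi (τ := fun s => -s)
        continuousWithinAt_id.neg ((hd t ht).sub_const (J (u t))) (sub_self _)
      have h2 : HasDerivWithinAt (fun s => unitaryGroup J (-s) (J (u t)))
          (-(-Complex.I • unitaryGroup J (-t) (u t - J (u t)))) (Ici 0) t := by
        have := (hasDerivAt_unitaryGroup hJ hi (u t) (-t)).scomp t (hasDerivAt_neg t)
        rw [neg_one_smul] at this
        exact this.hasDerivWithinAt
      refine ((h1.add h2).congr_of_eventuallyEq (Eventually.of_forall fun s => ?_) ?_).congr_deriv ?_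
      · simp only [hv, Pi.add_apply]
        rw [← unitaryGroup_comm_J hJ hi, ← map_add, sub_add_cancel]
      · simp only [hv, Pi.add_apply]
        rw [← unitaryGroup_comm_J hJ hi, ← map_add, sub_add_cancel]
      · simp only [hg, map_smul, map_sub, unitaryGroup_comm_J hJ hi]
        module
    have key : ∀ t ∈ Ico 0 T, v t = v 0 + ∫ s in (0 : ℝ)..t, g s := by
      intro t ht
      have hsub : Icc 0 t ⊆ Ico 0 T := fun s hs => ⟨hs.1, hs.2.trans_lt ht.2⟩
      have hgi : IntervalIntegrable g volume 0 t := by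
        refine ContinuousOn.intervalIntegrable ?_
        rw [uIcc_of_le ht.1]
        exact hgc.mono hsub
      have e := intervalIntegral.integral_eq_sub_of_hasDeriv_right_of_le (a := 0) (b := t)
        (f := fun s => J (v s)) (f' := fun s => J (g s)) ht.1
        (J.continuous.comp_continuousOn (hvc.mono hsub))
        (fun s hs => (hJv s (hsub (Ioo_subset_Icc_self hs))).mono
          ((Ioi_subset_Ici_self).trans (Ici_subset_Ici.mpr hs.1.le)))
        ⟨J.integrable_comp hgi.1, J.integrable_comp hgi.2⟩
      rw [J.intervalIntegral_comp_comm hgi] at e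
      have : J (∫ s in (0 : ℝ)..t, g s) = J (v t - v 0) := by rw [e, map_sub]
      rw [hi this]; abel
    intro t ht
    have e : interactionField J F t (v t) = g t := by
      simp only [interactionField, hv, hg]
      rw [unitaryGroup_apply_neg hJ hi]
    rw [e]
    obtain ⟨T', h1, h2⟩ := exists_between ht.2
    have hsub : Icc 0 T' ⊆ Ico 0 T := fun s hs => ⟨hs.1, hs.2.trans_lt h2⟩
    have ht' : t ∈ Icc 0 T' := ⟨ht.1, h1.le⟩
    have : Fact (t ∈ Icc 0 T') := ⟨ht'⟩
    have hgc' := hgc.mono hsub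
    have hd1 : HasDerivWithinAt (fun s => ∫ r in (0 : ℝ)..s, g r) (g t) (Icc 0 T') t := by
      refine intervalIntegral.integral_hasDerivWithinAt_right ?_ ?_ (hgc' t ht')
      · refine ContinuousOn.intervalIntegrable ?_
        rw [uIcc_of_le ht.1]
        exact hgc'.mono (Icc_subset_Icc_right h1.le)
      · exact hgc'.stronglyMeasurableAtFilter_nhdsWithin measurableSet_Icc t
    have hd2 := (hd1.const_add (v 0)).congr (fun s hs => key s (hsub hs)) (key t ht)
    refine hd2.mono_of_mem_nhdsWithin ?_
    rw [← nhdsWithin_Ico_eq h1]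
    exact mem_of_superset self_mem_nhdsWithin Ico_subset_Icc_self
  · intro hv
    have hc : ContinuousOn u (Ico 0 T) := by
      have := continuousOn_unitaryGroup hJ hi continuousOn_id hv.continuousOn
      simpa only [id, unitaryGroup_apply_neg hJ hi] using this
    refine ⟨hc, fun t ht => ?_⟩
    have h1 := (J.restrictScalars ℝ).hasFDerivAt.comp_hasDerivWithinAt t
      (hv.hasDerivWithinAt_sub hJ hi ht)
    have h2 : HasDerivWithinAt (fun s => unitaryGroup J (s - t) (J (u t)))
        (-Complex.I • (u t - J (u t))) (Ici 0) t := by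
      have h0 : HasDerivAt (fun s => unitaryGroup J s (J (u t))) (-Complex.I • (u t - J (u t)))
        (t - t) := by
        rw [sub_self]; exact hasDerivAt_unitaryGroup_zero hJ hi (u t)
      exact (h0.comp_sub_const t t).hasDerivWithinAt
    refine ((h1.add h2).congr_of_eventuallyEq (Eventually.of_forall fun s => ?_) ?_).congr_deriv ?_
    · simp [unitaryGroup_comm_J hJ hi]
    · simp [unitaryGroup_comm_J hJ hi]
    · simp only [ContinuousLinearMap.coe_restrictScalars', map_smul]
      module

theorem EvolvesOn.unique (hJ : IsSelfAdjoint J) (hi : Function.Injective J) (hF : IsLocLip F)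
    {w : ℝ → X} (hu : EvolvesOn J F T u) (hw : EvolvesOn J F T w) (h0 : u 0 = w 0) :
    EqOn u w (Ico 0 T) := by
  have h := SolvesOn.unique (isLocLipField_interactionField hJ hi hF)
    ((evolvesOn_iff hJ hi hF).mp hu) ((evolvesOn_iff hJ hi hF).mp hw)
    (by simp only [h0])
  intro t ht
  have := congrArg (unitaryGroup J t) (h ht)
  simpa only [unitaryGroup_apply_neg hJ hi] using this

theorem exists_maximal_evolution (hJ : IsSelfAdjoint J) (hi : Function.Injective J)
    (hF : IsLocLip F) (x₀ : X) :
    (∃ u : ℝ → X, u 0 = x₀ ∧ ∀ T, EvolvesOn J F T u) ∨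
      ∃ T > 0, ∃ u : ℝ → X, u 0 = x₀ ∧ EvolvesOn J F T u ∧
        Tendsto (fun t => ‖u t‖) (𝓝[<] T) atTop := by
  have e : ∀ (v : ℝ → X) (T : ℝ), SolvesOn (interactionField J F) T v →
      EvolvesOn J F T fun t => unitaryGroup J t (v t) := by
    intro v T hv
    rw [evolvesOn_iff hJ hi hF]
    simpa only [unitaryGroup_neg_apply hJ hi] using hv
  rcases (isLocLipField_interactionField hJ hi hF).exists_maximal x₀ with
    ⟨v, h0, hv⟩ | ⟨T, hT, v, h0, hv, hlim⟩
  · exact Or.inl ⟨_, by rw [unitaryGroup_zero hJ hi, h0], fun T => e v T (hv T)⟩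
  · refine Or.inr ⟨T, hT, _, by rw [unitaryGroup_zero hJ hi, h0], e v T hv, ?_⟩
    simpa only [norm_unitaryGroup hJ hi] using hlim

end Semilinear

end DeltaNLS

namespace DeltaNLS

open MeasureTheory Set Filter Topology
open scoped ComplexConjugate ContDiff NNReal

/-! ### The energy space and the resolvent of the Hamiltonian with delta potential. -/

section EnergySpace

/-- The form domain of `-∂ₓ² + κ² δ + 1` with its energy norm, realized as the graph of the
functional `v ↦ κ v(0)`. -/
def energySubmodule (κ : ℝ) : Submodule ℂ (WithLp 2 (H1 × ℂ)) where
  carrier := {z | z.snd = (κ : ℂ) * H1.eval 0 z.fst}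
  zero_mem' := by simp
  add_mem' := by
    intro a b ha hb
    simp only [mem_ofPred_eq, WithLp.add_fst, WithLp.add_snd, map_add] at *
    rw [ha, hb]; ring
  smul_mem' := by
    intro c a ha
    simp only [mem_ofPred_eq, WithLp.smul_fst, WithLp.smul_snd, map_smul, smul_eq_mul] at *
    rw [ha]; ring

/-- The form domain of `-∂ₓ² + κ² δ + 1` with its energy norm. -/
def EnergySpace (κ : ℝ) : Type := energySubmodule κ

instance (κ : ℝ) : NormedAddCommGroup (EnergySpace κ) :=
  inferInstanceAs (NormedAddCommGroup (energySubmodule κ))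

instance (κ : ℝ) : InnerProductSpace ℂ (EnergySpace κ) :=
  inferInstanceAs (InnerProductSpace ℂ (energySubmodule κ))

theorem isClosed_energySubmodule (κ : ℝ) :
    IsClosed (energySubmodule κ : Set (WithLp 2 (H1 × ℂ))) := by
  refine isClosed_eq (WithLp.sndL 2 ℂ H1 ℂ).continuous ?_
  exact continuous_const.mul ((H1.eval 0).continuous.comp (WithLp.fstL 2 ℂ H1 ℂ).continuous)

instance (κ : ℝ) : CompleteSpace (EnergySpace κ) :=
  have := (isClosed_energySubmodule κ).completeSpace_coe
  inferInstanceAs (CompleteSpace (energySubmodule κ))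

/-- The embedding of `H¹(ℝ)` into the energy space. -/
def toEnergyL (κ : ℝ) : H1 →L[ℂ] EnergySpace κ :=
  (ContinuousLinearMap.codRestrict
      ((WithLp.prodContinuousLinearEquiv 2 ℂ H1 ℂ).symm.toContinuousLinearMap.comp
        ((ContinuousLinearMap.id ℂ H1).prod ((κ : ℂ) • H1.eval 0)))
      (energySubmodule κ) (fun v => by
        change ((κ : ℂ) • H1.eval 0) v = (κ : ℂ) * H1.eval 0 v
        simp) : H1 →L[ℂ] energySubmodule κ)

/-- The projection of the energy space onto `H¹(ℝ)`. -/
def ofEnergyL (κ : ℝ) : EnergySpace κ →L[ℂ] H1 :=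
  ((WithLp.fstL 2 ℂ H1 ℂ).comp (energySubmodule κ).subtypeL : energySubmodule κ →L[ℂ] H1)

/-- The identification of `H¹(ℝ)` with the energy space. -/
def toEnergy (κ : ℝ) : H1 ≃L[ℂ] EnergySpace κ :=
  ContinuousLinearEquiv.equivOfInverse (toEnergyL κ) (ofEnergyL κ) (fun v => rfl) (fun z => by
    refine Subtype.ext ?_
    have hz : z.1.snd = (κ : ℂ) * H1.eval 0 z.1.fst := z.2
    refine (WithLp.ofLp_injective 2) (Prod.ext rfl ?_)
    change ((κ : ℂ) • H1.eval 0) z.1.fst = z.1.snd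
    rw [hz]; simp)

variable {κ : ℝ}

theorem inner_toEnergy (v w : H1) : inner ℂ (toEnergy κ v) (toEnergy κ w) =
    inner ℂ v w + (κ : ℂ) ^ 2 * (w.rep 0 * conj (v.rep 0)) := by
  change inner ℂ v w + inner ℂ (((κ : ℂ) • H1.eval 0) v) (((κ : ℂ) • H1.eval 0) w) = _
  simp [H1.eval_apply]
  ring

theorem norm_sq_toEnergy (v : H1) : ‖toEnergy κ v‖ ^ 2 = ‖v‖ ^ 2 + κ ^ 2 * ‖v.rep 0‖ ^ 2 := by
  have h := inner_toEnergy (κ := κ) v v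
  rw [inner_self_eq_norm_sq_to_K, inner_self_eq_norm_sq_to_K, Complex.mul_conj'] at h
  have h2 : ((‖toEnergy κ v‖ ^ 2 : ℝ) : ℂ) = ((‖v‖ ^ 2 + κ ^ 2 * ‖v.rep 0‖ ^ 2 : ℝ) : ℂ) := by
    push_cast; exact h
  exact Complex.ofReal_injective h2

theorem norm_le_norm_toEnergy (v : H1) : ‖v‖ ≤ ‖toEnergy κ v‖ :=
  le_of_sq_le_sq (by rw [norm_sq_toEnergy]; nlinarith [mul_nonneg (sq_nonneg κ) (sq_nonneg ‖v.rep 0‖)])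
    (norm_nonneg _)

/-- The inclusion of the energy space into `L²`. -/
def energyToL2 (κ : ℝ) : EnergySpace κ →L[ℂ] L2 := H1.toL2.comp (toEnergy κ).symm.toContinuousLinearMap

theorem energyToL2_toEnergy (v : H1) : energyToL2 κ (toEnergy κ v) = v.toL2 := by
  simp [energyToL2]

/-- The resolvent `(-∂ₓ² + κ² δ + 1)⁻¹` on the energy space. -/
def resolvent (κ : ℝ) : EnergySpace κ →L[ℂ] EnergySpace κ :=
  (ContinuousLinearMap.adjoint (energyToL2 κ)).comp (energyToL2 κ)

theorem isSelfAdjoint_resolvent (κ : ℝ) : IsSelfAdjoint (resolvent κ) := by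
  rw [ContinuousLinearMap.isSelfAdjoint_iff', resolvent, ContinuousLinearMap.adjoint_comp,
    ContinuousLinearMap.adjoint_adjoint]

theorem inner_resolvent (x y : EnergySpace κ) :
    inner ℂ x (resolvent κ y) = inner ℂ (energyToL2 κ x) (energyToL2 κ y) := by
  rw [resolvent, ContinuousLinearMap.comp_apply, ContinuousLinearMap.adjoint_inner_right]

theorem inner_resolvent_left (x y : EnergySpace κ) :
    inner ℂ (resolvent κ x) y = inner ℂ (energyToL2 κ x) (energyToL2 κ y) := by
  rw [resolvent, ContinuousLinearMap.comp_apply, ContinuousLinearMap.adjoint_inner_left]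

/-- This is the weak form of `(-∂ₓ² + κ² δ + 1) J w = w`; thus `1/J - 1` is the Hamiltonian `-∂ₓ² +
κ² δ`. -/
theorem inner_toEnergy_resolvent (v w : H1) :
    inner ℂ (toEnergy κ v) (resolvent κ (toEnergy κ w)) = inner ℂ v.toL2 w.toL2 := by
  rw [inner_resolvent, energyToL2_toEnergy, energyToL2_toEnergy]

theorem injective_resolvent (κ : ℝ) : Function.Injective (resolvent κ) := by
  rw [injective_iff_map_eq_zero]
  intro x hx
  obtain ⟨v, rfl⟩ := (toEnergy κ).surjective x
  have h := inner_toEnergy_resolvent (κ := κ) v v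
  rw [hx, inner_zero_right] at h
  have h1 : v.toL2 = 0 := inner_self_eq_zero.mp h.symm
  have : v = 0 := H1.ext_toL2 (by rw [h1, map_zero])
  rw [this, map_zero]

/-- The operator `U(t)` preserves the `L²` norm. -/
theorem inner_energyToL2_unitaryGroup (t : ℝ) (x y : EnergySpace κ) :
    inner ℂ (energyToL2 κ (unitaryGroup (resolvent κ) t x))
      (energyToL2 κ (unitaryGroup (resolvent κ) t y)) =
      inner ℂ (energyToL2 κ x) (energyToL2 κ y) := by
  have hJ := isSelfAdjoint_resolvent κ
  have hi := injective_resolvent κ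
  -- The `L²` product is the energy product with one `J` inserted, and `J` commutes with the
  -- isometry `U(t)`.
  rw [← inner_resolvent, ← unitaryGroup_comm_J hJ hi, inner_unitaryGroup hJ hi, inner_resolvent]

end EnergySpace

/-! ### The power nonlinearity. -/

section Nonlinearity

variable {p : ℝ}

/-- The nonlinearity `z ↦ |z|^(p-1) z`. -/
def powerFun (p : ℝ) (z : ℂ) : ℂ := ((‖z‖ ^ (p - 1) : ℝ) : ℂ) * z

theorem norm_rpow_eq (p : ℝ) (z : ℂ) : ‖z‖ ^ (p - 1) = (‖z‖ ^ 2) ^ ((p - 1) / 2) := by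
  rw [← Real.rpow_natCast_mul (norm_nonneg z)]
  congr 1
  push_cast; ring

/-- `|z|^(p-1) = (|z|²)^((p-1)/2)`, and for `p ≥ 5` the outer exponent is at least `2`, so the
function is `C²` at the origin too. -/
theorem contDiff_powerFun (hp : 5 ≤ p) : ContDiff ℝ 2 (powerFun p) := by
  have h1 : ContDiff ℝ 2 fun z : ℂ => ‖z‖ ^ (p - 1) := by
    simp only [norm_rpow_eq p]
    exact (contDiff_norm_sq ℝ).rpow_const_of_le (by norm_num; linarith)
  exact (Complex.ofRealCLM.contDiff.comp h1).mul contDiff_id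

theorem powerFun_zero (p : ℝ) : powerFun p 0 = 0 := by simp [powerFun]

/-- The nonlinearity `v ↦ |v|^(p-1) v` on `H¹(ℝ)`. -/
def H1.power (hp : 5 ≤ p) (v : H1) : H1 := H1.comp (contDiff_powerFun hp) (powerFun_zero p) v

theorem H1.rep_power (hp : 5 ≤ p) (v : H1) : (H1.power hp v).rep = fun x => powerFun p (v.rep x) :=
  H1.rep_comp _ _ v

theorem isLocLip_power (hp : 5 ≤ p) : IsLocLip (H1.power hp) where
  zero := H1.ext_rep (by rw [H1.rep_power, H1.rep_zero]; funext x; simp [powerFun_zero])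
  lip R := by
    obtain ⟨C, hC, H⟩ := H1.exists_lipschitz_comp (contDiff_powerFun hp) (powerFun_zero p) R
    refine ⟨C.toNNReal, LipschitzOnWith.of_dist_le_mul fun v hv w hw => ?_⟩
    rw [dist_eq_norm, dist_eq_norm, Real.coe_toNNReal _ hC]
    exact H v w (mem_closedBall_zero_iff.mp hv) (mem_closedBall_zero_iff.mp hw)

/-- The nonlinearity on the energy space. -/
def energyPower (κ : ℝ) (hp : 5 ≤ p) (x : EnergySpace κ) : EnergySpace κ :=
  toEnergy κ (H1.power hp ((toEnergy κ).symm x))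

theorem energyPower_toEnergy (κ : ℝ) (hp : 5 ≤ p) (v : H1) :
    energyPower κ hp (toEnergy κ v) = toEnergy κ (H1.power hp v) := by
  simp [energyPower]

theorem isLocLip_energyPower (κ : ℝ) (hp : 5 ≤ p) : IsLocLip (energyPower κ hp) where
  zero := by simp [energyPower, (isLocLip_power hp).zero]
  lip R := by
    obtain ⟨K, hK⟩ := (isLocLip_power hp).lip R
    have h1 := (toEnergy κ).toContinuousLinearMap.lipschitz
    have h2 := (toEnergy κ).symm.toContinuousLinearMap.lipschitz
    refine ⟨_, h1.comp_lipschitzOnWith (hK.comp h2.lipschitzOnWith fun x hx => ?_)⟩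
    rw [mem_closedBall_zero_iff] at hx ⊢
    have := norm_le_norm_toEnergy (κ := κ) ((toEnergy κ).symm x)
    rw [ContinuousLinearEquiv.apply_symm_apply] at this
    exact this.trans hx

end Nonlinearity

/-! ### Equivalence of the equation in `H⁻¹` with the abstract evolution. -/

section Translation

variable {κ p T : ℝ} {u : ℝ → H1}

theorem toHm1_eq_inner (v w : H1) :
    v.toHm1 w = inner ℂ (toEnergy κ w) (resolvent κ (toEnergy κ v)) := by
  rw [inner_toEnergy_resolvent]; rfl

/-- The Riesz map from the energy space to `H⁻¹(ℝ)`. -/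
def riesz (κ : ℝ) : EnergySpace κ →L[ℂ] Hm1 :=
  LinearMap.mkContinuous
    { toFun := fun z => ((innerSL ℂ).flip z).comp (toEnergy κ).toContinuousLinearMap
      map_add' := fun x y => by ext w; simp
      map_smul' := fun c x => by ext w; simp } ‖(toEnergy κ).toContinuousLinearMap‖
    fun z => by
      refine ContinuousLinearMap.opNorm_le_bound _ (by positivity) fun w => ?_
      change ‖inner ℂ (toEnergy κ w) z‖ ≤ _
      refine (norm_inner_le_norm _ _).trans ?_
      have := (toEnergy κ).toContinuousLinearMap.le_opNorm w
      calc _ ≤ (‖(toEnergy κ).toContinuousLinearMap‖ * ‖w‖) * ‖z‖ := by gcongr; exact this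
        _ = _ := by ring

theorem riesz_apply (z : EnergySpace κ) (w : H1) : riesz κ z w = inner ℂ (toEnergy κ w) z := rfl

theorem riesz_resolvent (v : H1) : riesz κ (resolvent κ (toEnergy κ v)) = v.toHm1 := by
  ext w
  rw [riesz_apply, toHm1_eq_inner]

/-- Because the Riesz map carries `J u` to `u` viewed in `H⁻¹`, differentiability of `u` in `H⁻¹`
becomes differentiability of `J u` in the energy space. -/
theorem isInducing_riesz (κ : ℝ) : IsInducing (riesz κ) := by
  set C := ‖(toEnergy κ).symm.toContinuousLinearMap‖ with hC
  have h : ∀ z : EnergySpace κ, ‖z‖ ≤ C.toNNReal * ‖riesz κ z‖ := by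
    intro z
    rw [Real.coe_toNNReal _ (hC ▸ norm_nonneg _)]
    by_cases hz : ‖z‖ = 0
    · rw [hz]; positivity
    have h1 : ‖riesz κ z ((toEnergy κ).symm z)‖ = ‖z‖ * ‖z‖ := by
      rw [riesz_apply, ContinuousLinearEquiv.apply_symm_apply, inner_self_eq_norm_sq_to_K, norm_pow,
        sq]
      simp
    have h2 := (riesz κ z).le_opNorm ((toEnergy κ).symm z)
    have h3 := (toEnergy κ).symm.toContinuousLinearMap.le_opNorm z
    have h4 : ‖z‖ * ‖z‖ ≤ (C * ‖riesz κ z‖) * ‖z‖ := by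
      rw [← h1]
      refine h2.trans ?_
      calc _ ≤ ‖riesz κ z‖ * (C * ‖z‖) := by gcongr; exact h3
        _ = _ := by ring
    exact le_of_mul_le_mul_right h4 ((norm_nonneg z).lt_of_ne (Ne.symm hz))
  have h1 : AntilipschitzWith C.toNNReal (riesz κ) :=
    AddMonoidHomClass.antilipschitz_of_bound _ h
  exact (h1.isUniformInducing (riesz κ).uniformContinuous).isInducing

/-- The energy product represents `-∂ₓ² + κ² δ + 1` and the term `-J v` removes the summand `1`. The
sign `γ ≤ 0` is what allows `κ² = -γ` with `κ` real. -/
theorem nlsForm_eq (hp : 5 ≤ p) {γ : ℝ} (hκ : κ ^ 2 = -γ) (v w : H1) :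
    nlsForm γ p v w = riesz κ (toEnergy κ v - resolvent κ (toEnergy κ v)
      - resolvent κ (energyPower κ hp (toEnergy κ v))) w := by
  rw [map_sub, map_sub, energyPower_toEnergy, riesz_resolvent, riesz_resolvent]
  change _ = riesz κ (toEnergy κ v) w - v.toHm1 w - (H1.power hp v).toHm1 w
  rw [riesz_apply, inner_toEnergy, H1.inner_eq]
  have e1 : v.toHm1 w = inner ℂ w.toL2 v.toL2 := rfl
  have e2 : (κ : ℂ) ^ 2 = -(γ : ℂ) := by exact_mod_cast hκ
  rw [e1, e2, H1.toHm1_apply, H1.rep_power, nlsForm]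
  have e3 : inner ℂ w.dx v.dx = ∫ x, v.dx x * conj (w.dx x) := by
    rw [L2.inner_def]
    refine integral_congr_ae (Eventually.of_forall fun x => ?_)
    simp
  rw [e3]
  simp only [powerFun]
  ring

theorem isSolution_iff (hp : 5 ≤ p) {γ : ℝ} (hκ : κ ^ 2 = -γ) :
    IsSolution γ p T u ↔ EvolvesOn (resolvent κ) (energyPower κ hp) T fun t => toEnergy κ (u t) := by
  set J := resolvent κ
  set y : ℝ → EnergySpace κ := fun t => -Complex.I • (toEnergy κ (u t) - J (toEnergy κ (u t))
    - J (energyPower κ hp (toEnergy κ (u t)))) with hy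
  have hyu : ∀ (t : ℝ) (w : H1), Complex.I * riesz κ (y t) w = nlsForm γ p (u t) w := by
    intro t w
    rw [nlsForm_eq hp hκ, hy]
    simp only [map_smul]
    change Complex.I * (-Complex.I * _) = _
    rw [← mul_assoc, mul_neg, Complex.I_mul_I, neg_neg, one_mul]
    rfl
  have hslope : ∀ t s : ℝ, slope (fun s => (u s).toHm1) t s =
      riesz κ (slope (fun s => J (toEnergy κ (u s))) t s) := by
    intro t s
    rw [slope_def_module, slope_def_module, ContinuousLinearMap.map_smul_of_tower, map_sub,
      riesz_resolvent, riesz_resolvent]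
  have hder : ∀ t ∈ Ico 0 T, HasDerivWithinAt (fun s => (u s).toHm1) (riesz κ (y t)) (Ico 0 T) t ↔
      HasDerivWithinAt (fun s => J (toEnergy κ (u s))) (y t) (Ici 0) t := by
    intro t ht
    have e : HasDerivWithinAt (fun s => J (toEnergy κ (u s))) (y t) (Ici 0) t ↔
        HasDerivWithinAt (fun s => J (toEnergy κ (u s))) (y t) (Ico 0 T) t := by
      constructor
      · exact fun h => h.mono Ico_subset_Ici_self
      · intro h
        refine h.mono_of_mem_nhdsWithin ?_
        rw [← nhdsWithin_Ico_eq ht.2]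
        exact self_mem_nhdsWithin
    rw [e, hasDerivWithinAt_iff_tendsto_slope, hasDerivWithinAt_iff_tendsto_slope,
      (isInducing_riesz κ).tendsto_nhds_iff]
    refine tendsto_congr fun s => hslope t s
  constructor
  · rintro ⟨hc, u', hu', h⟩
    refine ⟨(toEnergy κ).continuous.comp_continuousOn hc, fun t ht => (hder t ht).mp ?_⟩
    obtain ⟨h1, h2⟩ := h t ht
    have : u' t = riesz κ (y t) := by
      ext w
      have := (h2 w).trans (hyu t w).symm
      exact mul_left_cancel₀ Complex.I_ne_zero this
    rwa [← this]
  · rintro ⟨hc, h⟩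
    have hc' : ContinuousOn u (Ico 0 T) := by
      have := (toEnergy κ).symm.continuous.comp_continuousOn hc
      simpa [Function.comp_def] using this
    refine ⟨hc', fun t => riesz κ (y t), ?_, fun t ht => ⟨(hder t ht).mpr (h t ht), hyu t⟩⟩
    have hF := (isLocLip_energyPower κ hp).continuous
    refine (riesz κ).continuous.comp_continuousOn (ContinuousOn.const_smul ?_ (-Complex.I))
    exact (hc.sub (J.continuous.comp_continuousOn hc)).sub
      (J.continuous.comp_continuousOn (hF.comp_continuousOn hc))

end Translation

end DeltaNLS

namespace DeltaNLS

open MeasureTheory Set Filter Topology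
open scoped ComplexConjugate ContDiff NNReal

/-! ### Conservation of mass and energy. -/

section Conservation

theorem nhdsWithin_Ico_zero {t T : ℝ} (ht : t ∈ Ico 0 T) : 𝓝[Ico 0 T] t = 𝓝[Ici 0] t :=
  nhdsWithin_Ico_eq ht.2

/-- When one factor vanishes at `t`, mere continuity of the other is enough. It is used with factors
such as `U(s - t) u(t)`, which are only continuous in `s`. -/
theorem hasDerivWithinAt_inner_of_zero {E : Type*} [NormedAddCommGroup E] [InnerProductSpace ℂ E]
    {y c : ℝ → E} {y' : E} {S : Set ℝ} {t : ℝ} (hy : HasDerivWithinAt y y' S t) (h0 : y t = 0)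
    (hc : ContinuousWithinAt c S t) :
    HasDerivWithinAt (fun s => inner ℂ (y s) (c s)) (inner ℂ y' (c t)) S t := by
  rw [hasDerivWithinAt_iff_tendsto_slope] at hy ⊢
  refine (hy.inner (𝕜 := ℂ) (hc.mono_left (nhdsWithin_mono t sdiff_subset))).congr fun s => ?_
  rw [slope_def_module, slope_def_module, h0, inner_zero_left, sub_zero, sub_zero,
    RCLike.real_smul_eq_coe_smul (K := ℂ), inner_smul_left, RCLike.conj_ofReal,
    RCLike.real_smul_eq_coe_smul (K := ℂ)]
  rfl

theorem im_inner_comm {E : Type*} [NormedAddCommGroup E] [InnerProductSpace ℂ E] (x y : E) :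
    (inner ℂ x y).im = -(inner ℂ y x).im := by
  rw [← inner_conj_symm, Complex.conj_im]

theorem re_inner_comm {E : Type*} [NormedAddCommGroup E] [InnerProductSpace ℂ E] (x y : E) :
    (inner ℂ x y).re = (inner ℂ y x).re := by
  rw [← inner_conj_symm, Complex.conj_re]

theorem hasDerivWithinAt_re {f : ℝ → ℂ} {f' : ℂ} {S : Set ℝ} {t : ℝ}
    (h : HasDerivWithinAt f f' S t) : HasDerivWithinAt (fun s => (f s).re) f'.re S t :=
  Complex.reCLM.hasFDerivAt.comp_hasDerivWithinAt t h

theorem hasDerivWithinAt_im {f : ℝ → ℂ} {f' : ℂ} {S : Set ℝ} {t : ℝ}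
    (h : HasDerivWithinAt f f' S t) : HasDerivWithinAt (fun s => (f s).im) f'.im S t :=
  Complex.imCLM.hasFDerivAt.comp_hasDerivWithinAt t h

theorem EvolvesOn.continuousWithinAt {X : Type*} [NormedAddCommGroup X] [InnerProductSpace ℂ X]
    {J : X →L[ℂ] X} {F : X → X} {T : ℝ} {x : ℝ → X} (h : EvolvesOn J F T x) {t : ℝ} (ht : t ∈ Ico 0 T) :
    ContinuousWithinAt x (Ici 0) t := by
  have := h.1 t ht
  rwa [ContinuousWithinAt, nhdsWithin_Ico_zero ht] at this

section Abstract

variable {X : Type*} [NormedAddCommGroup X] [InnerProductSpace ℂ X] [CompleteSpace X]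
  {J : X →L[ℂ] X} {F : X → X} {T : ℝ} {x : ℝ → X}

theorem EvolvesOn.hasDerivWithinAt_sub (hJ : IsSelfAdjoint J) (hi : Function.Injective J)
    (hF : IsLocLip F) (h : EvolvesOn J F T x) {t : ℝ} (ht : t ∈ Ico 0 T) :
    HasDerivWithinAt (fun s => x s - unitaryGroup J (s - t) (x t)) (Complex.I • F (x t))
      (Ici 0) t :=
  SolvesOn.hasDerivWithinAt_sub hJ hi ((evolvesOn_iff hJ hi hF).mp h) ht

/-- Expand the square of `A x(s) = A U(s - t) x(t) + A r(s)` with `r(t) = 0` and `r'(t) = i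
F(x(t))`: the first square is constant by `hA`, the last has zero derivative, and the cross term
gives the result. Taking for `A` the identity or the inclusion into `L²` yields the energy norm or
the mass. -/
theorem EvolvesOn.hasDerivWithinAt_norm_sq (hJ : IsSelfAdjoint J) (hi : Function.Injective J)
    (hF : IsLocLip F) (h : EvolvesOn J F T x) {t : ℝ} (ht : t ∈ Ico 0 T)
    {Y : Type*} [NormedAddCommGroup Y] [InnerProductSpace ℂ Y] (A : X →L[ℂ] Y)
    (hA : ∀ t x, ‖A (unitaryGroup J t x)‖ = ‖A x‖) :
    HasDerivWithinAt (fun s => ‖A (x s)‖ ^ 2) (2 * (inner ℂ (A (F (x t))) (A (x t))).im)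
      (Ici 0) t := by
  set r : ℝ → X := fun s => x s - unitaryGroup J (s - t) (x t) with hr
  have hrd := h.hasDerivWithinAt_sub hJ hi hF ht
  have hAr : HasDerivWithinAt (fun s => A (r s)) (A (Complex.I • F (x t))) (Ici 0) t :=
    (A.restrictScalars ℝ).hasFDerivAt.comp_hasDerivWithinAt t hrd
  have hr0 : A (r t) = 0 := by simp [hr, unitaryGroup_zero hJ hi]
  have hcU : ContinuousWithinAt (fun s => A (unitaryGroup J (s - t) (x t))) (Ici 0) t := by
    have h1 : Continuous fun s => A (unitaryGroup J (s - t) (x t)) :=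
      A.continuous.comp ((continuous_unitaryGroup_apply hJ hi (x t)).comp (by fun_prop))
    exact h1.continuousWithinAt
  have d1 := hasDerivWithinAt_re (hasDerivWithinAt_inner_of_zero hAr hr0 hcU)
  have d2 := hasDerivWithinAt_re (hasDerivWithinAt_inner_of_zero hAr hr0 hAr.continuousWithinAt)
  have d3 := ((d1.const_mul 2).add d2).const_add (‖A (x t)‖ ^ 2)
  refine (d3.congr_of_eventuallyEq (Eventually.of_forall fun s => ?_) ?_).congr_deriv ?_
  · have e : A (x s) = A (unitaryGroup J (s - t) (x t)) + A (r s) := by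
      rw [← map_add, hr]; simp
    simp only [Pi.add_apply]
    rw [e, ← hA (s - t) (x t), norm_add_sq (𝕜 := ℂ), inner_re_symm, inner_self_eq_norm_sq_to_K (𝕜 := ℂ) (A (r s))]
    have : (((‖A (r s)‖ : ℝ) : ℂ) ^ 2).re = ‖A (r s)‖ ^ 2 := by
      rw [← Complex.ofReal_pow, Complex.ofReal_re]
    have e2 : ((RCLike.ofReal ‖A (r s)‖ : ℂ) ^ 2).re = ‖A (r s)‖ ^ 2 := this
    rw [e2]
    change _ + 2 * (inner ℂ (A (r s)) _).re + _ = _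
    ring
  · simp [hr0]
  · rw [hr0, inner_zero_right, sub_self, unitaryGroup_zero hJ hi, map_smul, inner_smul_left]
    simp

end Abstract

variable {κ p T : ℝ} {u : ℝ → H1}

theorem re_inner_toL2 (v w : H1) :
    (inner ℂ v.toL2 w.toL2).re = ∫ x, inner ℝ (v.rep x) (w.rep x) := by
  rw [L2.inner_def]
  refine (integral_re (𝕜 := ℂ) (L2.integrable_inner (𝕜 := ℂ) v.toL2 w.toL2)).symm.trans ?_
  refine integral_congr_ae ?_
  filter_upwards [v.coeFn_ae_eq_rep, w.coeFn_ae_eq_rep] with x h1 h2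
  rw [h1, h2]
  rfl

theorem H1.integrable_inner_rep (v w : H1) : Integrable fun x => inner ℝ (v.rep x) (w.rep x) := by
  have h := (L2.integrable_inner (𝕜 := ℂ) v.toL2 w.toL2).re
  refine h.congr ?_
  filter_upwards [v.coeFn_ae_eq_rep, w.coeFn_ae_eq_rep] with x h1 h2
  rw [h1, h2]
  rfl

theorem powerFun_real_smul (p : ℝ) (z : ℂ) : powerFun p z = (‖z‖ ^ (p - 1)) • z := by
  rw [powerFun, Complex.real_smul]

theorem norm_rpow_mul_sq (hp : 5 ≤ p) (z : ℂ) : ‖z‖ ^ (p - 1) * ‖z‖ ^ 2 = ‖z‖ ^ (p + 1) := by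
  rcases eq_or_ne z 0 with rfl | hz
  · rw [norm_zero, Real.zero_rpow (by linarith), Real.zero_rpow (by linarith)]; simp
  · rw [← Real.rpow_natCast, ← Real.rpow_add (norm_pos_iff.mpr hz)]
    congr 1; push_cast; ring

theorem inner_powerFun_self (hp : 5 ≤ p) (z : ℂ) : inner ℝ (powerFun p z) z = ‖z‖ ^ (p + 1) := by
  rw [powerFun_real_smul, real_inner_smul_left, real_inner_self_eq_norm_sq, norm_rpow_mul_sq hp]

theorem H1.integrable_norm_rpow (hp : 5 ≤ p) (v : H1) : Integrable fun x => ‖v.rep x‖ ^ (p + 1) := by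
  have := H1.integrable_inner_rep (H1.power hp v) v
  simpa only [H1.rep_power, inner_powerFun_self hp] using this

/-- `∫ |v|^(p+1)`. -/
def H1.potential (p : ℝ) (v : H1) : ℝ := ∫ x, ‖v.rep x‖ ^ (p + 1)

theorem re_inner_power_self (hp : 5 ≤ p) (v : H1) :
    (inner ℂ (H1.power hp v).toL2 v.toL2).re = v.potential p := by
  rw [re_inner_toL2, H1.potential]
  simp only [H1.rep_power, inner_powerFun_self hp]

theorem im_inner_power_self (hp : 5 ≤ p) (v : H1) :
    (inner ℂ (H1.power hp v).toL2 v.toL2).im = 0 := by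
  rw [L2.inner_def]
  refine (integral_im (𝕜 := ℂ)
    (L2.integrable_inner (𝕜 := ℂ) (H1.power hp v).toL2 v.toL2)).symm.trans ?_
  refine integral_eq_zero_of_ae ?_
  filter_upwards [v.coeFn_ae_eq_rep, (H1.power hp v).coeFn_ae_eq_rep] with x h1 h2
  rw [h1, h2, H1.rep_power]
  simp [powerFun, mul_comm]
  ring

/-- Convexity of `|z|^(p+1)`, by Young's inequality with exponents `(p+1)/p` and `p+1`. -/
theorem norm_rpow_ge (hp : 5 ≤ p) (z w : ℂ) :
    ‖z‖ ^ (p + 1) + (p + 1) * inner ℝ (powerFun p z) (w - z) ≤ ‖w‖ ^ (p + 1) := by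
  rw [inner_sub_right, inner_powerFun_self hp, powerFun_real_smul, real_inner_smul_left]
  have h1 : ‖z‖ ^ (p - 1) * inner ℝ z w ≤ ‖z‖ ^ p * ‖w‖ := by
    calc _ ≤ ‖z‖ ^ (p - 1) * (‖z‖ * ‖w‖) := by
          gcongr; exact real_inner_le_norm z w
      _ = ‖z‖ ^ p * ‖w‖ := by
          rw [← mul_assoc]
          congr 1
          rcases eq_or_ne z 0 with rfl | hz
          · rw [norm_zero, Real.zero_rpow (by linarith), Real.zero_rpow (by linarith)]; simp
          · rw [← Real.rpow_add_one (norm_pos_iff.mpr hz).ne']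
            congr 1; ring
  have hpq : Real.HolderConjugate ((p + 1) / p) (p + 1) := by
    rw [Real.holderConjugate_iff]
    refine ⟨by rw [lt_div_iff₀ (by linarith)]; linarith, ?_⟩
    have : p ≠ 0 := by linarith
    have : p + 1 ≠ 0 := by linarith
    field_simp
  have h2 := Real.young_inequality_of_nonneg (a := ‖z‖ ^ p) (b := ‖w‖) (by positivity)
    (norm_nonneg w) hpq
  rw [← Real.rpow_mul (norm_nonneg z), mul_div_cancel₀ _ (by linarith : p ≠ 0)] at h2
  have h3 : (p + 1) * (‖z‖ ^ p * ‖w‖) ≤ p * ‖z‖ ^ (p + 1) + ‖w‖ ^ (p + 1) := by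
    have hp1 : 0 < p + 1 := by linarith
    calc _ ≤ (p + 1) * (‖z‖ ^ (p + 1) / ((p + 1) / p) + ‖w‖ ^ (p + 1) / (p + 1)) := by gcongr
      _ = _ := by
        have : p ≠ 0 := by linarith
        field_simp
  nlinarith [mul_le_mul_of_nonneg_left h1 (by linarith : 0 ≤ p + 1)]

/-- Convexity used at both points places the pointwise remainder between `0` and `p + 1` times the
increment of the nonlinearity paired with `w - v`. The local Lipschitz bound makes this quadratic in
`|w - v|`, so the error is controlled by the `L²` norm alone. -/
theorem potential_expansion (hp : 5 ≤ p) (R : ℝ) : ∃ C, ∀ v w : H1, ‖v‖ ≤ R → ‖w‖ ≤ R →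
    |w.potential p - v.potential p -
      (inner ℂ (((p + 1 : ℝ) : ℂ) • H1.power hp v).toL2 (w - v).toL2).re| ≤
      C * ‖(w - v).toL2‖ ^ 2 := by
  obtain ⟨C, hC, H⟩ := exists_lipschitz_bound (contDiff_powerFun hp) R
  refine ⟨(p + 1) * C, fun v w hv hw => ?_⟩
  have hp1 : 0 < p + 1 := by linarith
  have i1 := H1.integrable_norm_rpow hp v
  have i2 := H1.integrable_norm_rpow hp w
  have i3 := (H1.integrable_inner_rep (H1.power hp v) (w - v)).const_mul (p + 1)
  have e : (inner ℂ (((p + 1 : ℝ) : ℂ) • H1.power hp v).toL2 (w - v).toL2).re =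
      ∫ x, (p + 1) * inner ℝ ((H1.power hp v).rep x) ((w - v).rep x) := by
    rw [map_smul, inner_smul_left, Complex.conj_ofReal, Complex.re_ofReal_mul, re_inner_toL2,
      integral_const_mul]
  have e' : (∫ x, ‖w.rep x‖ ^ (p + 1)) - (∫ x, ‖v.rep x‖ ^ (p + 1)) -
      (∫ x, (p + 1) * inner ℝ ((H1.power hp v).rep x) ((w - v).rep x)) =
      ∫ x, (‖w.rep x‖ ^ (p + 1) - ‖v.rep x‖ ^ (p + 1) -
        (p + 1) * inner ℝ ((H1.power hp v).rep x) ((w - v).rep x)) := by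
    rw [← integral_sub i2 i1]
    exact (integral_sub (i2.sub i1) i3).symm
  rw [e, H1.potential, H1.potential, e', H1.norm_sq_toL2, ← integral_const_mul]
  rw [← Real.norm_eq_abs]
  refine norm_integral_le_of_norm_le (((w - v).integrable_sq_rep).const_mul _)
    (Eventually.of_forall fun x => ?_)
  simp only [H1.rep_power, H1.rep_sub, Pi.sub_apply]
  have k1 := norm_rpow_ge hp (v.rep x) (w.rep x)
  have k2 := norm_rpow_ge hp (w.rep x) (v.rep x)
  have k3 := (H (w.rep x) (v.rep x) ((w.norm_rep_le x).trans hw) ((v.norm_rep_le x).trans hv)).1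
  have k4 : inner ℝ (powerFun p (w.rep x)) (w.rep x - v.rep x) -
      inner ℝ (powerFun p (v.rep x)) (w.rep x - v.rep x) ≤ C * ‖w.rep x - v.rep x‖ ^ 2 := by
    rw [← inner_sub_left]
    refine (real_inner_le_norm _ _).trans ?_
    nlinarith [norm_nonneg (w.rep x - v.rep x)]
  have k5 : inner ℝ (powerFun p (w.rep x)) (v.rep x - w.rep x) =
      - inner ℝ (powerFun p (w.rep x)) (w.rep x - v.rep x) := by
    rw [← inner_neg_right, neg_sub]
  rw [k5] at k2
  rw [Real.norm_eq_abs, abs_le]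
  constructor
  · have : 0 ≤ (p + 1) * C * ‖w.rep x - v.rep x‖ ^ 2 := by positivity
    linarith
  · nlinarith

/-- The derivative along a solution of a functional which is differentiable up to an error
quadratic in the `L²` norm. -/
theorem EvolvesOn.hasDerivWithinAt_functional (hp : 5 ≤ p)
    (h : EvolvesOn (resolvent κ) (energyPower κ hp) T fun t => toEnergy κ (u t))
    {Θ : H1 → ℝ} {g : H1 → H1}
    (hΘ : ∀ R : ℝ, ∃ C, ∀ v w : H1, ‖v‖ ≤ R → ‖w‖ ≤ R →
      |Θ w - Θ v - (inner ℂ (g v).toL2 (w - v).toL2).re| ≤ C * ‖(w - v).toL2‖ ^ 2)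
    {t : ℝ} (ht : t ∈ Ico 0 T) :
    HasDerivWithinAt (fun s => Θ (u s))
      (inner ℂ (toEnergy κ (g (u t))) (toEnergy κ (u t)) - inner ℂ (g (u t)).toL2 (u t).toL2
        - inner ℂ (g (u t)).toL2 (H1.power hp (u t)).toL2).im (Ici 0) t := by
  set J := resolvent κ
  set x : ℝ → EnergySpace κ := fun t => toEnergy κ (u t) with hx
  have hxc := h.continuousWithinAt ht
  have huc : ContinuousWithinAt u (Ici 0) t := by
    have : ContinuousWithinAt (fun s => (toEnergy κ).symm (toEnergy κ (u s))) (Ici 0) t :=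
      (toEnergy κ).symm.continuous.continuousAt.comp_continuousWithinAt hxc
    simpa only [ContinuousLinearEquiv.symm_apply_apply] using this
  have hd := (h.2 t ht).sub_const (J (x t))
  have d1 := hasDerivWithinAt_re (hasDerivWithinAt_inner_of_zero hd (sub_self _)
    (continuousWithinAt_const (b := toEnergy κ (g (u t)))))
  have d2 := hasDerivWithinAt_re (hasDerivWithinAt_inner_of_zero hd (sub_self _) (hxc.sub_const (x t)))
  -- The squared `L²` distance is `⟨J(x(s) - x(t)), x(s) - x(t)⟩`: the first factor is
  -- differentiable, the second tends to zero, so the product is `o(s - t)`. This absorbs the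
  -- quadratic error in `hΘ`.
  have e2 : ∀ s, (inner ℂ (J (x s) - J (x t)) (x s - x t)).re = ‖(u s - u t).toL2‖ ^ 2 := by
    intro s
    rw [← map_sub, inner_resolvent_left]
    simp only [hx]
    rw [← map_sub, energyToL2_toEnergy, inner_self_eq_norm_sq_to_K]
    exact (congrArg Complex.re (Complex.ofReal_pow _ 2)).symm.trans (Complex.ofReal_re _)
  simp only [e2, sub_self, inner_zero_right, Complex.zero_re] at d2
  have e1 : ∀ s, (inner ℂ (J (x s) - J (x t)) (toEnergy κ (g (u t)))).re =
      (inner ℂ (g (u t)).toL2 (u s - u t).toL2).re := by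
    intro s
    rw [← map_sub, inner_resolvent_left]
    simp only [hx]
    rw [← map_sub, energyToL2_toEnergy, energyToL2_toEnergy, ← inner_conj_symm, Complex.conj_re]
  simp only [e1] at d1
  obtain ⟨C, hC⟩ := hΘ (‖u t‖ + 1)
  have hbd : ∀ᶠ s in 𝓝[Ici 0] t, ‖u s‖ ≤ ‖u t‖ + 1 := by
    filter_upwards [huc.norm.eventually (gt_mem_nhds (lt_add_one ‖u t‖))] with s hs using hs.le
  have d3 : HasDerivWithinAt (fun s => Θ (u s) - Θ (u t) -
      (inner ℂ (g (u t)).toL2 (u s - u t).toL2).re) 0 (Ici 0) t := by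
    rw [hasDerivWithinAt_iff_isLittleO] at d2 ⊢
    refine Asymptotics.IsBigO.trans_isLittleO (g := fun s => ‖(u s - u t).toL2‖ ^ 2) ?_ ?_
    · refine Asymptotics.IsBigO.of_bound C ?_
      filter_upwards [hbd] with s hs
      have := hC (u t) (u s) (by linarith) hs
      simpa using this
    · simpa using d2
  have d4 := (d3.add d1).add_const (Θ (u t))
  refine (d4.congr_of_eventuallyEq (Eventually.of_forall fun s => ?_) ?_).congr_deriv ?_
  · simp
  · simp
  · rw [zero_add, inner_smul_left, inner_sub_left, inner_sub_left, inner_resolvent_left,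
      inner_resolvent_left]
    simp only [hx]
    rw [energyPower_toEnergy, energyToL2_toEnergy, energyToL2_toEnergy, energyToL2_toEnergy]
    simp only [Complex.sub_im, im_inner_comm (toEnergy κ (g (u t))), im_inner_comm (g (u t)).toL2]
    simp
    ring

theorem EvolvesOn.hasDerivWithinAt_potential (hp : 5 ≤ p)
    (h : EvolvesOn (resolvent κ) (energyPower κ hp) T fun t => toEnergy κ (u t))
    {t : ℝ} (ht : t ∈ Ico 0 T) :
    HasDerivWithinAt (fun s => (u s).potential p)
      ((p + 1) * (inner ℂ (toEnergy κ (H1.power hp (u t))) (toEnergy κ (u t))).im) (Ici 0) t := by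
  refine (h.hasDerivWithinAt_functional hp (Θ := fun v => v.potential p)
    (g := fun v => ((p + 1 : ℝ) : ℂ) • H1.power hp v) (potential_expansion hp) ht).congr_deriv ?_
  rw [map_smul, map_smul, inner_smul_left, inner_smul_left, inner_smul_left, Complex.conj_ofReal,
    Complex.sub_im, Complex.sub_im, Complex.im_ofReal_mul, Complex.im_ofReal_mul,
    Complex.im_ofReal_mul, im_inner_power_self]
  have : (inner ℂ (H1.power hp (u t)).toL2 (H1.power hp (u t)).toL2).im = 0 :=
    inner_self_im (𝕜 := ℂ) _
  rw [this]
  ring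

theorem constant_of_hasDerivWithinAt_zero {f : ℝ → ℝ} {T : ℝ}
    (h : ∀ t ∈ Ico 0 T, HasDerivWithinAt f 0 (Ici 0) t) : ∀ t ∈ Ico 0 T, f t = f 0 := by
  intro t ht
  have hsub : ∀ s ∈ Icc 0 t, s ∈ Ico 0 T := fun s hs => ⟨hs.1, hs.2.trans_lt ht.2⟩
  refine constant_of_has_deriv_right_zero (f := f) (a := 0) (b := t)
    (fun s hs => ((h s (hsub s hs)).continuousWithinAt).mono Icc_subset_Ici_self)
    (fun s hs => (h s (hsub s (Ico_subset_Icc_self hs))).mono (Ici_subset_Ici.mpr hs.1)) t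
    ⟨ht.1, le_rfl⟩

theorem EvolvesOn.mass_eq (hp : 5 ≤ p)
    (h : EvolvesOn (resolvent κ) (energyPower κ hp) T fun t => toEnergy κ (u t))
    {t : ℝ} (ht : t ∈ Ico 0 T) : ‖(u t).toL2‖ ^ 2 = ‖(u 0).toL2‖ ^ 2 := by
  refine constant_of_hasDerivWithinAt_zero (f := fun t => ‖(u t).toL2‖ ^ 2) (fun t ht => ?_) t ht
  have := h.hasDerivWithinAt_norm_sq (isSelfAdjoint_resolvent κ) (injective_resolvent κ)
    (isLocLip_energyPower κ hp) ht (energyToL2 κ) (fun t x => by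
      have := inner_energyToL2_unitaryGroup t x x
      rw [inner_self_eq_norm_sq_to_K, inner_self_eq_norm_sq_to_K] at this
      refine (sq_eq_sq₀ (norm_nonneg _) (norm_nonneg _)).mp ?_
      exact_mod_cast this)
  simp only [energyPower_toEnergy, energyToL2_toEnergy, im_inner_power_self, mul_zero] at this
  exact this

/-- The energy of the equation. -/
def H1.energy (κ p : ℝ) (v : H1) : ℝ :=
  (‖v.dx‖ ^ 2 + κ ^ 2 * ‖v.rep 0‖ ^ 2) / 2 - v.potential p / (p + 1)

/-- Half the squared energy norm and the potential divided by `p + 1` have the same derivative, the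
imaginary part of the energy product of `|u|^(p-1) u` with `u`. Conservation of mass then removes
the `L²` part of the norm. -/
theorem EvolvesOn.energy_eq (hp : 5 ≤ p)
    (h : EvolvesOn (resolvent κ) (energyPower κ hp) T fun t => toEnergy κ (u t))
    {t : ℝ} (ht : t ∈ Ico 0 T) : (u t).energy κ p = (u 0).energy κ p := by
  have key : ∀ t ∈ Ico 0 T, ‖toEnergy κ (u t)‖ ^ 2 / 2 - (u t).potential p / (p + 1) =
      ‖toEnergy κ (u 0)‖ ^ 2 / 2 - (u 0).potential p / (p + 1) := by
    refine constant_of_hasDerivWithinAt_zero (f := fun t =>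
      ‖toEnergy κ (u t)‖ ^ 2 / 2 - (u t).potential p / (p + 1)) (fun t ht => ?_)
    have h1 := h.hasDerivWithinAt_norm_sq (isSelfAdjoint_resolvent κ) (injective_resolvent κ)
      (isLocLip_energyPower κ hp) ht (ContinuousLinearMap.id ℂ _) (fun t x =>
        norm_unitaryGroup (isSelfAdjoint_resolvent κ) (injective_resolvent κ) t x)
    have h2 := h.hasDerivWithinAt_potential hp ht
    refine ((h1.div_const 2).sub (h2.div_const (p + 1))).congr_deriv ?_
    simp only [ContinuousLinearMap.id_apply, energyPower_toEnergy]
    have : p + 1 ≠ 0 := by linarith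
    field_simp
    ring
  have k1 := key t ht
  have k2 := h.mass_eq hp ht
  rw [norm_sq_toEnergy, norm_sq_toEnergy, H1.norm_sq_eq, H1.norm_sq_eq] at k1
  rw [H1.energy, H1.energy]
  linarith

end Conservation

end DeltaNLS

namespace DeltaNLS

open MeasureTheory Set Filter Topology
open scoped ComplexConjugate ContDiff NNReal BoundedContinuousFunction

/-! ### Virial identities with bounded weights. -/

section Virial

theorem L2.inner_mul_right (a : ℝ →ᵇ ℝ) (f g : L2) :
    inner ℂ f (L2.mul a g) = inner ℂ (L2.mul a f) g := by
  rw [L2.inner_def, L2.inner_def]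
  refine integral_congr_ae ?_
  filter_upwards [L2.mul_ae a f, L2.mul_ae a g] with x h1 h2
  rw [h1, h2]
  simp
  ring

theorem L2.inner_mul_self (a : ℝ →ᵇ ℝ) (f : L2) :
    inner ℂ f (L2.mul a f) = ((∫ x, a x * ‖f x‖ ^ 2 : ℝ) : ℂ) := by
  rw [L2.inner_def, ← integral_complex_ofReal]
  refine integral_congr_ae ?_
  filter_upwards [L2.mul_ae a f] with x h1
  rw [h1]
  simp only [RCLike.inner_apply]
  rw [mul_assoc, Complex.mul_conj']
  push_cast
  ring

theorem H1.inner_toL2_dx (v w : H1) : inner ℂ v.toL2 w.dx = - inner ℂ v.dx w.toL2 := by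
  have hp := w.isPrimitive_rep.mul_conj v.isPrimitive_rep
  have e1 : (fun x => inner ℂ (v.toL2 x) (w.dx x)) =ᵐ[volume] fun x => w.dx x * conj (v.rep x) := by
    filter_upwards [v.coeFn_ae_eq_rep] with x h
    rw [h, RCLike.inner_apply]
  have e2 : (fun x => inner ℂ (v.dx x) (w.toL2 x)) =ᵐ[volume] fun x => w.rep x * conj (v.dx x) := by
    filter_upwards [w.coeFn_ae_eq_rep] with x h
    rw [h, RCLike.inner_apply]
  have i1 := (L2.integrable_inner (𝕜 := ℂ) v.toL2 w.dx).congr e1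
  have i2 := (L2.integrable_inner (𝕜 := ℂ) v.dx w.toL2).congr e2
  have c0 : ∀ {F : Filter ℝ}, Tendsto w.rep F (𝓝 0) → Tendsto v.rep F (𝓝 0) →
      Tendsto (fun x => w.rep x * conj (v.rep x)) F (𝓝 0) := by
    intro F h1 h2
    have := h1.mul ((Complex.continuous_conj.tendsto 0).comp h2)
    simpa using this
  have h := hp.integral_eq (i1.add i2) (c0 w.tendsto_rep_atBot v.tendsto_rep_atBot)
    (c0 w.tendsto_rep_atTop v.tendsto_rep_atTop)
  rw [integral_add i1 i2, sub_zero] at h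
  rw [L2.inner_def, L2.inner_def, integral_congr_ae e1, integral_congr_ae e2]
  exact eq_neg_of_add_eq_zero_left h

variable {κ p T : ℝ} {u : ℝ → H1} {a a1 a2 b : ℝ →ᵇ ℝ}

/-- The operator `a ∂ₓ + a' / 2`. -/
def virialOp (a a1 : ℝ →ᵇ ℝ) : H1 →L[ℂ] L2 :=
  (L2.mul a).comp H1.dx + (1 / 2 : ℂ) • (L2.mul a1).comp H1.toL2

theorem virialOp_apply (w : H1) :
    virialOp a a1 w = L2.mul a w.dx + (1 / 2 : ℂ) • L2.mul a1 w.toL2 := rfl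

/-- The summand `a'/2` makes `a ∂ₓ + a'/2` skew-symmetric; hence the imaginary part of its
sesquilinear form is symmetric. -/
theorem inner_virialOp (ha : ∀ x, HasDerivAt a (a1 x) x) (v w : H1) :
    inner ℂ v.toL2 (virialOp a a1 w) = - inner ℂ (virialOp a a1 v) w.toL2 := by
  have h := H1.inner_toL2_dx v (H1.mul ha w)
  rw [H1.dx_mul, H1.toL2_mul, inner_add_right, L2.inner_mul_right a v.dx] at h
  rw [virialOp_apply, virialOp_apply, inner_add_right, inner_add_left, inner_smul_right,
    inner_smul_left, ← L2.inner_mul_right a1 v.toL2]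
  simp only [map_div₀, map_one, map_ofNat]
  linear_combination h

/-- The virial functional `Im ∫ a ū u'`. -/
def virial (a a1 : ℝ →ᵇ ℝ) (v : H1) : ℝ := (inner ℂ v.toL2 (virialOp a a1 v)).im

theorem im_inner_virialOp_comm (ha : ∀ x, HasDerivAt a (a1 x) x) (v w : H1) :
    (inner ℂ v.toL2 (virialOp a a1 w)).im = (inner ℂ w.toL2 (virialOp a a1 v)).im := by
  rw [inner_virialOp ha, Complex.neg_im, im_inner_comm w.toL2]

/-- Weak form of `-w'' + κ² δ w = z - w`: here `w = J z` plays the role of an element of the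
operator domain and `z - w` that of the Hamiltonian applied to it. -/
theorem H1.inner_dx_of_resolvent {w z : H1} (hw : toEnergy κ w = resolvent κ (toEnergy κ z))
    (v : H1) : inner ℂ v.dx w.dx + (κ : ℂ) ^ 2 * (w.rep 0 * conj (v.rep 0)) =
      inner ℂ v.toL2 (z - w).toL2 := by
  have h := inner_toEnergy_resolvent (κ := κ) v z
  rw [← hw, inner_toEnergy, H1.inner_eq] at h
  rw [map_sub, inner_sub_right, ← h]
  ring

/-- Smooth compactly supported functions belong to `H¹(ℝ)`. -/
theorem H1.exists_of_contDiff {η : ℝ → ℝ} (hη : ContDiff ℝ ∞ η) (hc : HasCompactSupport η) :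
    ∃ v : H1, v.rep = (fun x => (η x : ℂ)) ∧ (v.dx : ℝ → ℂ) =ᵐ[volume] fun x => ((deriv η x : ℝ) : ℂ) := by
  have hd : Continuous (deriv η) := hη.continuous_deriv (by simp)
  have h : IsPrimitive (fun x => (η x : ℂ)) (fun x => ((deriv η x : ℝ) : ℂ)) := by
    refine isPrimitive_of_hasDerivAt (fun x => ?_) (Complex.continuous_ofReal.comp hd)
    exact ((hη.differentiable (by simp)) x).hasDerivAt.ofReal_comp
  have m1 : MemLp (fun x => (η x : ℂ)) 2 (volume : Measure ℝ) :=
    (Complex.continuous_ofReal.comp hη.continuous).memLp_of_hasCompactSupport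
      (hc.comp_left Complex.ofReal_zero)
  have m2 : MemLp (fun x => ((deriv η x : ℝ) : ℂ)) 2 (volume : Measure ℝ) :=
    (Complex.continuous_ofReal.comp hd).memLp_of_hasCompactSupport
      (hc.deriv.comp_left Complex.ofReal_zero)
  exact ⟨H1.ofPrimitive h m1 m2, H1.rep_ofPrimitive _ _ _, H1.dx_ofPrimitive_ae _ _ _⟩

theorem abs_le_of_hasDerivAt (ha : ∀ x, HasDerivAt a (a1 x) x) (h0 : a 0 = 0) (x : ℝ) :
    |a x| ≤ ‖a1‖ * |x| := by
  have := convex_univ.norm_image_sub_le_of_norm_hasDerivWithin_le (f := a) (f' := a1)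
    (C := ‖a1‖) (fun x _ => (ha x).hasDerivWithinAt) (fun x _ => a1.norm_coe_le_norm x)
    (mem_univ 0) (mem_univ x)
  simpa [h0] using this

/-- The function `a w'` belongs to `H¹(ℝ)` for `w` in the domain of the operator. -/
theorem H1.exists_mul_dx (ha : ∀ x, HasDerivAt a (a1 x) x) (h0 : a 0 = 0) {w z : H1}
    (hw : toEnergy κ w = resolvent κ (toEnergy κ z)) :
    ∃ k : H1, k.toL2 = L2.mul a w.dx ∧ k.dx = L2.mul a1 w.dx + L2.mul a (w - z).toL2 ∧
      k.rep 0 = 0 := by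
  have hweak : HasWeakDeriv (L2.mul a w.dx) (L2.mul a1 w.dx + L2.mul a (w - z).toL2 : L2) := by
    intro η hη hc
    obtain ⟨v, hv, hv'⟩ := H1.exists_of_contDiff hη hc
    -- Since `a 0 = 0`, the test function `a η` does not see the delta: the jump of `w'` at the
    -- origin is killed in `a w'`.
    have key := H1.inner_dx_of_resolvent hw (H1.mul ha v)
    simp only [H1.rep_mul, h0] at key
    rw [H1.dx_mul, H1.toL2_mul, ← L2.inner_mul_right, inner_add_left,
      ← L2.inner_mul_right, ← L2.inner_mul_right] at key
    have I1 : ∀ f : L2, inner ℂ v.toL2 f = ∫ x, η x • f x := by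
      intro f
      rw [L2.inner_def]
      refine integral_congr_ae ?_
      filter_upwards [v.coeFn_ae_eq_rep] with x h1
      rw [h1, hv]
      simp [mul_comm]
    have I2 : ∀ f : L2, inner ℂ v.dx f = ∫ x, deriv η x • f x := by
      intro f
      rw [L2.inner_def]
      refine integral_congr_ae ?_
      filter_upwards [hv'] with x h1
      rw [h1]
      simp [mul_comm]
    rw [← I1, ← I2, inner_add_right]
    have e : (w - z).toL2 = - (z - w).toL2 := by rw [← map_neg, neg_sub]
    rw [e, map_neg, inner_neg_right, ← key]
    simp
  let k : H1 := ⟨WithLp.toLp 2 (L2.mul a w.dx, L2.mul a1 w.dx + L2.mul a (w - z).toL2), hweak⟩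
  have hk : k.toL2 = L2.mul a w.dx := rfl
  refine ⟨k, hk, rfl, ?_⟩
  -- If `k(0) ≠ 0`, the bound `|k(x)| ≤ C |x| |w'(x)|` with `w'` locally integrable would make `1/x`
  -- integrable near `0`.
  by_contra hk0
  have hae : ∀ᵐ x, ‖k.rep x‖ ≤ ‖a1‖ * |x| * ‖w.dx x‖ := by
    filter_upwards [k.coeFn_ae_eq_rep, L2.mul_ae a w.dx] with x h1 h2
    rw [← h1, hk, h2, norm_mul, Complex.norm_real]
    gcongr
    exact abs_le_of_hasDerivAt ha h0 x
  have hint : IntervalIntegrable (fun x => x⁻¹ * ‖k.rep x‖) volume 0 1 := by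
    refine ((LocallyIntegrable.intervalIntegrable' (L2.locallyIntegrable w.dx) 0 1).norm.const_mul
      ‖a1‖).mono_fun ?_ (ae_restrict_of_ae ?_)
    · exact (measurable_inv.mul k.continuous_rep.norm.measurable).aestronglyMeasurable
    · filter_upwards [hae] with x hx
      rw [norm_mul, norm_norm, norm_inv, Real.norm_eq_abs, Real.norm_of_nonneg (by positivity)]
      rcases eq_or_ne x 0 with rfl | hx0
      · simp; positivity
      · rw [inv_mul_le_iff₀ (abs_pos.mpr hx0)]
        linarith
  refine not_intervalIntegrable_of_sub_inv_isBigO_punctured (c := 0) ?_ zero_ne_one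
    left_mem_uIcc hint
  have hpos : 0 < ‖k.rep 0‖ := norm_pos_iff.mpr hk0
  have hev : ∀ᶠ x in 𝓝 (0 : ℝ), ‖k.rep 0‖ / 2 < ‖k.rep x‖ :=
    k.continuous_rep.norm.continuousAt.eventually (lt_mem_nhds (half_lt_self hpos))
  refine Asymptotics.IsBigO.of_bound (2 / ‖k.rep 0‖) ?_
  filter_upwards [nhdsWithin_le_nhds hev] with x hx
  rw [sub_zero, norm_mul, norm_norm]
  calc ‖x⁻¹‖ = 2 / ‖k.rep 0‖ * (‖x⁻¹‖ * (‖k.rep 0‖ / 2)) := by field_simp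
    _ ≤ _ := by gcongr

/-- The quadratic form of the commutator of the operator with `virialOp`. -/
def virialForm (κ : ℝ) (a1 a2 : ℝ →ᵇ ℝ) (w : H1) : ℝ :=
  2 * (inner ℂ w.dx (L2.mul a1 w.dx)).re + (inner ℂ (L2.mul a2 w.toL2) w.dx).re
    + κ ^ 2 * a1 0 * ‖w.rep 0‖ ^ 2

/-- The equation for `w` is tested with `a w'`, which vanishes at the origin and carries no delta
term, and with `a' w`, which contributes `κ² a'(0) |w(0)|²`. The real parts add up to the commutator
form. -/
theorem two_mul_re_inner_virialOp (ha : ∀ x, HasDerivAt a (a1 x) x)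
    (ha1 : ∀ x, HasDerivAt a1 (a2 x) x) (h0 : a 0 = 0) {w z : H1}
    (hw : toEnergy κ w = resolvent κ (toEnergy κ z)) :
    2 * (inner ℂ (z - w).toL2 (virialOp a a1 w)).re = virialForm κ a1 a2 w := by
  obtain ⟨k, hk, hk', hk0⟩ := H1.exists_mul_dx ha h0 hw
  have e1 := H1.inner_dx_of_resolvent hw k
  have e2 := H1.inner_dx_of_resolvent hw (H1.mul ha1 w)
  rw [hk0, hk, hk', inner_add_left] at e1
  rw [H1.rep_mul, H1.dx_mul, H1.toL2_mul, inner_add_left] at e2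
  have e : (w - z).toL2 = - (z - w).toL2 := by rw [← map_neg, neg_sub]
  rw [e, map_neg, inner_neg_left, ← L2.inner_mul_right a1 w.dx,
    ← L2.inner_mul_right a (z - w).toL2] at e1
  have r1 := congrArg Complex.re e1
  have r2 := congrArg Complex.re e2
  have n0 : w.rep 0 * conj ((a1 0 : ℂ) * w.rep 0) = ((a1 0 * ‖w.rep 0‖ ^ 2 : ℝ) : ℂ) := by
    rw [map_mul, Complex.conj_ofReal, mul_left_comm, Complex.mul_conj']
    push_cast
    rfl
  rw [n0, ← Complex.ofReal_pow, ← Complex.ofReal_mul, ← L2.inner_mul_right a1 w.dx] at r2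
  have c1 := re_inner_comm (L2.mul a w.dx) (z - w).toL2
  have c2 := re_inner_comm (L2.mul a1 w.toL2) (z - w).toL2
  have c3 : ((1 / 2 : ℂ) * inner ℂ (z - w).toL2 (L2.mul a1 w.toL2)).re =
      1 / 2 * (inner ℂ (z - w).toL2 (L2.mul a1 w.toL2)).re := by
    rw [← Complex.re_ofReal_mul]
    norm_num
  simp only [Complex.add_re, Complex.neg_re, map_zero, mul_zero, Complex.zero_re,
    Complex.ofReal_re] at r1 r2
  rw [virialOp_apply, inner_add_right, inner_smul_right, Complex.add_re, c3, virialForm]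
  linarith

/-- Quadratically growing, locally Lipschitz functionals. -/
def QuadLip {X : Type*} [NormedAddCommGroup X] (q : X → ℝ) : Prop :=
  ∃ C, 0 ≤ C ∧ ∀ x y, |q x - q y| ≤ C * (‖x‖ + ‖y‖) * ‖x - y‖

section QuadLip

section

variable {X : Type*} [NormedAddCommGroup X]

theorem QuadLip.add {q r : X → ℝ} (hq : QuadLip q) (hr : QuadLip r) :
    QuadLip fun x => q x + r x := by
  obtain ⟨C, hC, h⟩ := hq
  obtain ⟨D, hD, h'⟩ := hr
  refine ⟨C + D, by positivity, fun x y => ?_⟩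
  calc |q x + r x - (q y + r y)| = |(q x - q y) + (r x - r y)| := by congr 1; ring
    _ ≤ |q x - q y| + |r x - r y| := abs_add_le _ _
    _ ≤ _ := by linarith [h x y, h' x y]

theorem QuadLip.const_mul {q : X → ℝ} (hq : QuadLip q) (c : ℝ) : QuadLip fun x => c * q x := by
  obtain ⟨C, hC, h⟩ := hq
  refine ⟨|c| * C, by positivity, fun x y => ?_⟩
  rw [← mul_sub, abs_mul, mul_assoc, mul_assoc, ← mul_assoc C]
  gcongr
  exact h x y

theorem QuadLip.continuous {q : X → ℝ} (hq : QuadLip q) : Continuous q := by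
  obtain ⟨C, hC, h⟩ := hq
  refine continuous_iff_continuousAt.mpr fun x => ?_
  rw [ContinuousAt, tendsto_iff_dist_tendsto_zero]
  refine squeeze_zero (fun _ => dist_nonneg) (fun y => h y x) ?_
  have : Tendsto (fun y => C * (‖y‖ + ‖x‖) * ‖y - x‖) (𝓝 x) (𝓝 (C * (‖x‖ + ‖x‖) * ‖x - x‖)) :=
    Continuous.tendsto (by fun_prop) x
  simpa using this

end

variable {X Y : Type*} [NormedAddCommGroup X] [InnerProductSpace ℂ X]
  [NormedAddCommGroup Y] [InnerProductSpace ℂ Y]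

theorem quadLip_re_inner (L M : X →L[ℂ] Y) : QuadLip fun x => (inner ℂ (L x) (M x)).re := by
  refine ⟨‖L‖ * ‖M‖, by positivity, fun x y => ?_⟩
  have e : inner ℂ (L x) (M x) - inner ℂ (L y) (M y) =
      inner ℂ (L (x - y)) (M x) + inner ℂ (L y) (M (x - y)) := by
    rw [map_sub, map_sub, inner_sub_left, inner_sub_right]; ring
  rw [← Complex.sub_re, e]
  refine (Complex.abs_re_le_norm _).trans ((norm_add_le _ _).trans ?_)
  calc _ ≤ ‖L (x - y)‖ * ‖M x‖ + ‖L y‖ * ‖M (x - y)‖ :=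
        add_le_add (norm_inner_le_norm _ _) (norm_inner_le_norm _ _)
    _ ≤ (‖L‖ * ‖x - y‖) * (‖M‖ * ‖x‖) + (‖L‖ * ‖y‖) * (‖M‖ * ‖x - y‖) := by
        gcongr <;> exact ContinuousLinearMap.le_opNorm _ _
    _ = _ := by ring

theorem QuadLip.comp {q : Y → ℝ} (hq : QuadLip q) (L : X →L[ℂ] Y) : QuadLip fun x => q (L x) := by
  obtain ⟨C, hC, h⟩ := hq
  refine ⟨C * ‖L‖ * ‖L‖, by positivity, fun x y => (h _ _).trans ?_⟩
  rw [← map_sub]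
  calc _ ≤ C * (‖L‖ * ‖x‖ + ‖L‖ * ‖y‖) * (‖L‖ * ‖x - y‖) := by
        gcongr <;> exact ContinuousLinearMap.le_opNorm _ _
    _ = _ := by ring

/-- `U(t)` is isometric, so the quadratic Lipschitz bound does not depend on `t`. Uniformity is what
permits passing to the limit in derivatives. -/
theorem QuadLip.tendstoUniformly [CompleteSpace X] {J : X →L[ℂ] X} (hJ : IsSelfAdjoint J)
    (hi : Function.Injective J) {q : X → ℝ} (hq : QuadLip q) {x : ℕ → X} {y : X}
    (hx : Tendsto x atTop (𝓝 y)) :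
    TendstoUniformly (fun n t => q (unitaryGroup J t (x n))) (fun t => q (unitaryGroup J t y))
      atTop := by
  obtain ⟨C, hC, h⟩ := hq
  rw [Metric.tendstoUniformly_iff]
  intro ε hε
  have hlim : Tendsto (fun n => C * (‖y‖ + ‖x n‖) * ‖y - x n‖) atTop (𝓝 0) := by
    have := ((hx.norm.const_add ‖y‖).const_mul C).mul (hx.const_sub y).norm
    simpa using this
  filter_upwards [hlim.eventually (gt_mem_nhds hε)] with n hn t
  refine lt_of_le_of_lt (h _ _) ?_
  rwa [← map_sub, norm_unitaryGroup hJ hi, norm_unitaryGroup hJ hi, norm_unitaryGroup hJ hi]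

end QuadLip

theorem quadLip_virialForm : QuadLip (virialForm κ a1 a2) := by
  have h1 := (quadLip_re_inner H1.dx ((L2.mul a1).comp H1.dx)).const_mul 2
  have h2 := quadLip_re_inner ((L2.mul a2).comp H1.toL2) H1.dx
  have h3 := (quadLip_re_inner (H1.eval 0) (H1.eval 0)).const_mul (κ ^ 2 * a1 0)
  have := (h1.add h2).add h3
  convert! this using 1
  funext w
  rw [virialForm, inner_self_eq_norm_sq_to_K]
  congr 2
  exact ((congrArg Complex.re (Complex.ofReal_pow _ 2)).symm.trans (Complex.ofReal_re _)).symm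

theorem hasDerivAt_virial_unitaryGroup_resolvent (ha : ∀ x, HasDerivAt a (a1 x) x)
    (ha1 : ∀ x, HasDerivAt a1 (a2 x) x) (h0 : a 0 = 0) (z : EnergySpace κ) (t : ℝ) :
    HasDerivAt (fun t => virial a a1 ((toEnergy κ).symm (unitaryGroup (resolvent κ) t
        (resolvent κ z))))
      (virialForm κ a1 a2 ((toEnergy κ).symm (unitaryGroup (resolvent κ) t (resolvent κ z)))) t := by
  have hJ := isSelfAdjoint_resolvent κ
  have hi := injective_resolvent κ
  set J := resolvent κ
  have hd := hasDerivAt_unitaryGroup hJ hi z t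
  set w : ℝ → H1 := fun t => (toEnergy κ).symm (unitaryGroup J t (J z)) with hw
  set Z : H1 := (toEnergy κ).symm (unitaryGroup J t z) with hZ
  have hwZ : toEnergy κ (w t) = J (toEnergy κ Z) := by
    simp only [hw, hZ, ContinuousLinearEquiv.apply_symm_apply]
    exact unitaryGroup_comm_J hJ hi t z
  have hwd : HasDerivAt w (-Complex.I • (Z - w t)) t := by
    have := (((toEnergy κ).symm.toContinuousLinearMap).restrictScalars ℝ).hasFDerivAt.comp_hasDerivAt
      t hd
    convert! this using 1
    simp only [ContinuousLinearMap.coe_restrictScalars', ContinuousLinearEquiv.coe_coe, map_smul,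
      map_sub]
    rfl
  have d1 : HasDerivAt (fun s => (w s).toL2) (-Complex.I • (Z - w t)).toL2 t :=
    (H1.toL2.restrictScalars ℝ).hasFDerivAt.comp_hasDerivAt t hwd
  have d2 : HasDerivAt (fun s => virialOp a a1 (w s)) (virialOp a a1 (-Complex.I • (Z - w t))) t :=
    ((virialOp a a1).restrictScalars ℝ).hasFDerivAt.comp_hasDerivAt t hwd
  have d3 := Complex.imCLM.hasFDerivAt.comp_hasDerivAt t (d1.inner ℂ d2)
  refine d3.congr_deriv ?_
  rw [← two_mul_re_inner_virialOp ha ha1 h0 hwZ]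
  simp only [Complex.imCLM_apply, Complex.add_im]
  rw [im_inner_virialOp_comm ha, map_smul, inner_smul_left]
  simp
  ring

/-- The identity is known on the dense range of `J`; both the virial functional and `virialForm` are
continuous on the energy space, so it extends by uniform convergence of the derivatives. -/
theorem hasDerivAt_virial_unitaryGroup (ha : ∀ x, HasDerivAt a (a1 x) x)
    (ha1 : ∀ x, HasDerivAt a1 (a2 x) x) (h0 : a 0 = 0) (z : EnergySpace κ) (t : ℝ) :
    HasDerivAt (fun t => virial a a1 ((toEnergy κ).symm (unitaryGroup (resolvent κ) t z)))
      (virialForm κ a1 a2 ((toEnergy κ).symm (unitaryGroup (resolvent κ) t z))) t := by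
  have hJ := isSelfAdjoint_resolvent κ
  have hi := injective_resolvent κ
  obtain ⟨x, hx, hlim⟩ := mem_closure_iff_seq_limit.mp (denseRange_of_isSelfAdjoint hJ hi z)
  choose y hy using hx
  refine hasDerivAt_of_tendstoUniformly (l := atTop)
    (f := fun n t => virial a a1 ((toEnergy κ).symm (unitaryGroup (resolvent κ) t (x n))))
    (f' := fun n t => virialForm κ a1 a2 ((toEnergy κ).symm (unitaryGroup (resolvent κ) t (x n))))
    ((quadLip_virialForm.comp (toEnergy κ).symm.toContinuousLinearMap).tendstoUniformly hJ hi hlim)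
    (Eventually.of_forall fun n t => ?_) (fun t => ?_) t
  · rw [← hy n]
    exact hasDerivAt_virial_unitaryGroup_resolvent ha ha1 h0 (y n) t
  · have hc : Continuous fun x : EnergySpace κ =>
        virial a a1 ((toEnergy κ).symm (unitaryGroup (resolvent κ) t x)) := by
      unfold virial
      exact Complex.continuous_im.comp (Continuous.inner (by fun_prop) (by fun_prop))
    exact (hc.tendsto z).comp hlim

/-- With `u(s) = U(s - t) u(t) + r(s)`, the free part contributes `virialForm`, the two cross terms
coincide by symmetry and give the nonlinear contribution, and the term quadratic in `r` has zero
derivative. -/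
theorem EvolvesOn.hasDerivWithinAt_virial (hp : 5 ≤ p)
    (h : EvolvesOn (resolvent κ) (energyPower κ hp) T fun t => toEnergy κ (u t))
    (ha : ∀ x, HasDerivAt a (a1 x) x) (ha1 : ∀ x, HasDerivAt a1 (a2 x) x) (h0 : a 0 = 0)
    {t : ℝ} (ht : t ∈ Ico 0 T) :
    HasDerivWithinAt (fun s => virial a a1 (u s)) (virialForm κ a1 a2 (u t) -
      2 * (inner ℂ (H1.power hp (u t)).toL2 (virialOp a a1 (u t))).re) (Ici 0) t := by
  have hJ := isSelfAdjoint_resolvent κ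
  have hi := injective_resolvent κ
  have hF := isLocLip_energyPower κ hp
  set J := resolvent κ
  set S := (toEnergy κ).symm.toContinuousLinearMap with hS
  set y : ℝ → H1 := fun s => S (unitaryGroup J (s - t) (toEnergy κ (u t))) with hy
  set r : ℝ → H1 := fun s => u s - y s with hr
  have hyt : y t = u t := by simp [hy, hS, unitaryGroup_zero hJ hi]
  have hrt : r t = 0 := by simp [hr, hyt]
  have hrd : HasDerivWithinAt r (Complex.I • H1.power hp (u t)) (Ici 0) t := by
    have := (S.restrictScalars ℝ).hasFDerivAt.comp_hasDerivWithinAt t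
      (h.hasDerivWithinAt_sub hJ hi hF ht)
    convert! this using 1
  have hyc : ContinuousWithinAt y (Ici 0) t := by
    have : Continuous y := S.continuous.comp
      ((continuous_unitaryGroup_apply hJ hi (toEnergy κ (u t))).comp (by fun_prop))
    exact this.continuousWithinAt
  have hrL : HasDerivWithinAt (fun s => (r s).toL2) (Complex.I • H1.power hp (u t)).toL2
      (Ici 0) t := (H1.toL2.restrictScalars ℝ).hasFDerivAt.comp_hasDerivWithinAt t hrd
  have hrL0 : (r t).toL2 = 0 := by rw [hrt, map_zero]
  have d1 := hasDerivWithinAt_im (hasDerivWithinAt_inner_of_zero hrL hrL0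
    ((virialOp a a1).continuous.continuousAt.comp_continuousWithinAt hyc))
  have d2 := hasDerivWithinAt_im (hasDerivWithinAt_inner_of_zero hrL hrL0
    ((virialOp a a1).continuous.continuousAt.comp_continuousWithinAt hrd.continuousWithinAt))
  have d3 : HasDerivWithinAt (fun s => virial a a1 (y s)) (virialForm κ a1 a2 (u t)) (Ici 0) t := by
    have e := hasDerivAt_virial_unitaryGroup ha ha1 h0 (toEnergy κ (u t)) (t - t)
    have e2 := (e.comp_sub_const t t).hasDerivWithinAt (s := Ici 0)
    refine e2.congr_deriv ?_
    rw [sub_self, unitaryGroup_zero hJ hi, ContinuousLinearEquiv.symm_apply_apply]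
  have d4 := (d3.add (d1.const_mul 2)).add d2
  refine (d4.congr_of_eventuallyEq (Eventually.of_forall fun s => ?_) ?_).congr_deriv ?_
  · have e : u s = y s + r s := by simp [hr]
    simp only [Pi.add_apply, Function.comp_apply]
    rw [e]
    simp only [virial, map_add, inner_add_left, inner_add_right, Complex.add_im]
    rw [im_inner_virialOp_comm ha (y s) (r s)]
    ring
  · simp only [Pi.add_apply, Function.comp_apply, hrt, hyt]
    simp
  · simp only [Function.comp_apply, hrt, hyt, map_zero, inner_zero_right, map_smul,
      inner_smul_left]
    simp
    ring

theorem H1.isPrimitive_norm_rpow (hp : 5 ≤ p) (v : H1) :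
    IsPrimitive (fun x => ((‖v.rep x‖ ^ (p + 1) : ℝ) : ℂ))
      (fun x => (((p + 1) * inner ℝ (powerFun p (v.rep x)) (v.dx x) : ℝ) : ℂ)) := by
  have hΦ : ContDiff ℝ 1 fun z : ℂ => ((‖z‖ ^ (p + 1) : ℝ) : ℂ) :=
    Complex.ofRealCLM.contDiff.comp (contDiff_norm_rpow (by linarith))
  have h := v.isPrimitive_rep.comp hΦ
  convert! h using 1
  funext x
  have hd : HasFDerivAt (fun z : ℂ => ((‖z‖ ^ (p + 1) : ℝ) : ℂ)) _ (v.rep x) :=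
    Complex.ofRealCLM.hasFDerivAt.comp (v.rep x)
      (hasFDerivAt_norm_rpow (v.rep x) (by linarith : 1 < p + 1))
  rw [hd.fderiv]
  simp only [ContinuousLinearMap.comp_apply, Complex.ofRealCLM_apply,
    smul_apply, innerSL_apply_apply, smul_eq_mul]
  rw [powerFun_real_smul, real_inner_smul_left, mul_assoc,
    show p + 1 - 2 = p - 1 by ring]

/-- The real part of `|v|^(p-1) v̄ v'` is `(|v|^(p+1))' / (p+1)`. Integration by parts against `a`
produces `-1/(p+1)`, the summand `a'/2` produces `1/2`, and twice their sum is `(p-1)/(p+1)`. -/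
theorem two_mul_re_inner_power_virialOp (hp : 5 ≤ p) (ha : ∀ x, HasDerivAt a (a1 x) x) (v : H1) :
    2 * (inner ℂ (H1.power hp v).toL2 (virialOp a a1 v)).re =
      (p - 1) / (p + 1) * ∫ x, a1 x * ‖v.rep x‖ ^ (p + 1) := by
  have hp1 : 0 < p + 1 := by linarith
  have hprim := (v.isPrimitive_norm_rpow hp).smul (isPrimitive_of_bounded ha)
  have i1 : Integrable fun x => ((a1 x * ‖v.rep x‖ ^ (p + 1) : ℝ) : ℂ) :=
    ((H1.integrable_norm_rpow hp v).bdd_mul a1.continuous.aestronglyMeasurable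
      (Eventually.of_forall a1.norm_coe_le_norm)).ofReal
  have e2 : (fun x => (inner ℂ ((H1.power hp v).toL2 x) (L2.mul a v.dx x)).re) =ᵐ[volume]
      fun x => a x * inner ℝ (powerFun p (v.rep x)) (v.dx x) := by
    filter_upwards [(H1.power hp v).coeFn_ae_eq_rep, L2.mul_ae a v.dx] with x h1 h2
    rw [h1, h2, H1.rep_power, ← Complex.real_smul]
    exact real_inner_smul_right (powerFun p (v.rep x)) (v.dx x) (a x)
  have e3 : (inner ℂ (H1.power hp v).toL2 (L2.mul a v.dx)).re =
      ∫ x, a x * inner ℝ (powerFun p (v.rep x)) (v.dx x) := by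
    rw [← integral_congr_ae e2]
    exact (integral_re (𝕜 := ℂ) (L2.integrable_inner (𝕜 := ℂ) _ _)).symm
  have i2' : Integrable fun x => a x * inner ℝ (powerFun p (v.rep x)) (v.dx x) :=
    ((L2.integrable_inner (𝕜 := ℂ) (H1.power hp v).toL2 (L2.mul a v.dx)).re).congr e2
  have i2 : Integrable fun x =>
      (((p + 1) * (a x * inner ℝ (powerFun p (v.rep x)) (v.dx x)) : ℝ) : ℂ) :=
    (i2'.const_mul (p + 1)).ofReal
  have e4 : (inner ℂ (H1.power hp v).toL2 (L2.mul a1 v.toL2)).re =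
      ∫ x, a1 x * ‖v.rep x‖ ^ (p + 1) := by
    refine (integral_re (𝕜 := ℂ) (L2.integrable_inner (𝕜 := ℂ) _ _)).symm.trans ?_
    refine integral_congr_ae ?_
    filter_upwards [(H1.power hp v).coeFn_ae_eq_rep, L2.mul_ae a1 v.toL2, v.coeFn_ae_eq_rep]
      with x h1 h2 h3
    rw [h1, h2, h3, H1.rep_power, ← Complex.real_smul, ← inner_powerFun_self hp]
    exact real_inner_smul_right (powerFun p (v.rep x)) (v.rep x) (a1 x)
  have c0 : ∀ {F : Filter ℝ}, Tendsto v.rep F (𝓝 0) →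
      Tendsto (fun x => (a x : ℂ) * ((‖v.rep x‖ ^ (p + 1) : ℝ) : ℂ)) F (𝓝 0) := by
    intro F h1
    have h2 : Tendsto (fun x => ‖v.rep x‖ ^ (p + 1)) F (𝓝 0) := by
      have := h1.norm.rpow_const (p := p + 1) (Or.inr hp1.le)
      simpa [Real.zero_rpow hp1.ne'] using this
    refine squeeze_zero_norm (a := fun x => ‖a‖ * ‖v.rep x‖ ^ (p + 1)) (fun x => ?_) ?_
    · rw [norm_mul, Complex.norm_real, Complex.norm_real, Real.norm_of_nonneg
        (by positivity : 0 ≤ ‖v.rep x‖ ^ (p + 1))]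
      gcongr
      exact a.norm_coe_le_norm x
    · simpa using h2.const_mul ‖a‖
  have e5 : (fun x => (a1 x : ℂ) * ((‖v.rep x‖ ^ (p + 1) : ℝ) : ℂ) + (a x : ℂ) *
      (((p + 1) * inner ℝ (powerFun p (v.rep x)) (v.dx x) : ℝ) : ℂ)) =
      fun x => ((a1 x * ‖v.rep x‖ ^ (p + 1) : ℝ) : ℂ) +
      (((p + 1) * (a x * inner ℝ (powerFun p (v.rep x)) (v.dx x)) : ℝ) : ℂ) := by
    funext x
    push_cast
    ring
  rw [e5] at hprim
  have h := hprim.integral_eq (i1.add i2) (c0 v.tendsto_rep_atBot) (c0 v.tendsto_rep_atTop)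
  rw [integral_add i1 i2, integral_complex_ofReal, integral_complex_ofReal, integral_const_mul,
    sub_zero, ← Complex.ofReal_add, Complex.ofReal_eq_zero] at h
  have c3 : ((1 / 2 : ℂ) * inner ℂ (H1.power hp v).toL2 (L2.mul a1 v.toL2)).re =
      1 / 2 * (inner ℂ (H1.power hp v).toL2 (L2.mul a1 v.toL2)).re := by
    rw [← Complex.re_ofReal_mul]
    norm_num
  rw [virialOp_apply, inner_add_right, inner_smul_right, Complex.add_re, c3, e3, e4]
  field_simp
  linear_combination 2 * h

/-- The derivative of the virial functional along solutions. -/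
def virialRate (κ p : ℝ) (a1 a2 : ℝ →ᵇ ℝ) (v : H1) : ℝ :=
  virialForm κ a1 a2 v - (p - 1) / (p + 1) * ∫ x, a1 x * ‖v.rep x‖ ^ (p + 1)

theorem EvolvesOn.hasDerivWithinAt_virial_rate (hp : 5 ≤ p)
    (h : EvolvesOn (resolvent κ) (energyPower κ hp) T fun t => toEnergy κ (u t))
    (ha : ∀ x, HasDerivAt a (a1 x) x) (ha1 : ∀ x, HasDerivAt a1 (a2 x) x) (h0 : a 0 = 0)
    {t : ℝ} (ht : t ∈ Ico 0 T) :
    HasDerivWithinAt (fun s => virial a a1 (u s)) (virialRate κ p a1 a2 (u t)) (Ici 0) t := by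
  have := h.hasDerivWithinAt_virial hp ha ha1 h0 ht
  rwa [two_mul_re_inner_power_virialOp hp ha] at this

theorem two_mul_re (z : ℂ) : (2 * z).re = 2 * z.re := by simp

theorem two_mul_im (z : ℂ) : (2 * z).im = 2 * z.im := by simp

/-- The weighted mass `∫ b |v|²`. -/
def weightedMass (b : ℝ →ᵇ ℝ) (v : H1) : ℝ := ∫ x, b x * ‖v.rep x‖ ^ 2

theorem weightedMass_eq (v : H1) : weightedMass b v = (inner ℂ v.toL2 (L2.mul b v.toL2)).re := by
  rw [L2.inner_mul_self, Complex.ofReal_re, weightedMass]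
  refine integral_congr_ae ?_
  filter_upwards [v.coeFn_ae_eq_rep] with x h
  rw [h]

theorem im_inner_power_mul (hp : 5 ≤ p) (v : H1) :
    (inner ℂ (L2.mul b v.toL2) (H1.power hp v).toL2).im = 0 := by
  rw [L2.inner_def]
  refine (integral_im (𝕜 := ℂ)
    (L2.integrable_inner (𝕜 := ℂ) (L2.mul b v.toL2) (H1.power hp v).toL2)).symm.trans ?_
  refine integral_eq_zero_of_ae ?_
  filter_upwards [v.coeFn_ae_eq_rep, (H1.power hp v).coeFn_ae_eq_rep, L2.mul_ae b v.toL2]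
    with x h1 h2 h3
  rw [h3, h1, h2, H1.rep_power]
  simp [powerFun]
  ring

/-- No relation between `a1` and `a` is required: `∫ a1 |v|²` is real and drops out of the imaginary
part defining `virial`. -/
theorem EvolvesOn.hasDerivWithinAt_weightedMass (hp : 5 ≤ p)
    (h : EvolvesOn (resolvent κ) (energyPower κ hp) T fun t => toEnergy κ (u t))
    (hb : ∀ x, HasDerivAt b (a x) x) {t : ℝ} (ht : t ∈ Ico 0 T) :
    HasDerivWithinAt (fun s => weightedMass b (u s)) (2 * virial a a1 (u t)) (Ici 0) t := by
  refine (h.hasDerivWithinAt_functional hp (Θ := weightedMass b)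
    (g := fun v => (2 : ℂ) • H1.mul hb v) (fun R => ⟨‖L2.mul b‖, fun v w _ _ => ?_⟩) ht).congr_deriv ?_
  · have e : weightedMass b w - weightedMass b v -
        (inner ℂ ((2 : ℂ) • H1.mul hb v).toL2 (w - v).toL2).re =
        (inner ℂ (w - v).toL2 (L2.mul b (w - v).toL2)).re := by
      rw [weightedMass_eq, weightedMass_eq, map_smul, H1.toL2_mul, inner_smul_left]
      simp only [map_sub, inner_sub_left, inner_sub_right, map_ofNat, Complex.sub_re]
      have c : (inner ℂ w.toL2 (L2.mul b v.toL2)).re = (inner ℂ v.toL2 (L2.mul b w.toL2)).re := by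
        rw [re_inner_comm, L2.inner_mul_right]
      rw [c, two_mul_re, Complex.sub_re, ← L2.inner_mul_right, ← L2.inner_mul_right]
      ring
    rw [e]
    refine (Complex.abs_re_le_norm _).trans ((norm_inner_le_norm _ _).trans ?_)
    calc _ ≤ ‖(w - v).toL2‖ * (‖L2.mul b‖ * ‖(w - v).toL2‖) := by
          gcongr; exact ContinuousLinearMap.le_opNorm _ _
      _ = _ := by ring
  · set v := u t
    have n0 : (inner ℂ v.toL2 (L2.mul a1 v.toL2)).im = 0 := by
      rw [L2.inner_mul_self, Complex.ofReal_im]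
    have n1 : (inner ℂ v.dx (L2.mul b v.dx)).im = 0 := by
      rw [L2.inner_mul_self, Complex.ofReal_im]
    have n2 : (v.rep 0 * conj ((b 0 : ℂ) * v.rep 0)) = ((b 0 * ‖v.rep 0‖ ^ 2 : ℝ) : ℂ) := by
      rw [map_mul, Complex.conj_ofReal, mul_left_comm, Complex.mul_conj']
      push_cast
      rfl
    have c3 : ((1 / 2 : ℂ) * inner ℂ v.toL2 (L2.mul a1 v.toL2)).im = 0 := by
      have : (1 / 2 : ℂ) = ((1 / 2 : ℝ) : ℂ) := by norm_num
      rw [this, Complex.im_ofReal_mul, n0, mul_zero]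
    have n3 : (inner ℂ (L2.mul b v.toL2) v.toL2).im = 0 := by
      rw [← L2.inner_mul_right, L2.inner_mul_self, Complex.ofReal_im]
    rw [virial, virialOp_apply, inner_add_right, inner_smul_right, Complex.add_im, c3, map_smul,
      map_smul, inner_smul_left, inner_smul_left, inner_smul_left, map_ofNat, ← mul_sub,
      ← mul_sub, two_mul_im, Complex.sub_im, Complex.sub_im, inner_toEnergy,
      H1.inner_eq, H1.rep_mul, H1.toL2_mul, H1.dx_mul, im_inner_power_mul, inner_add_left,
      ← L2.inner_mul_right a, ← L2.inner_mul_right b v.dx, n2]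
    rw [← Complex.ofReal_pow, ← Complex.ofReal_mul]
    simp only [Complex.add_im, Complex.ofReal_im, n1, n3]
    ring

end Virial

end DeltaNLS

namespace DeltaNLS

open MeasureTheory Set Filter Topology
open scoped ComplexConjugate ContDiff NNReal BoundedContinuousFunction

/-! ### Trigonometric weights and the virial inequality. -/

section VirialInequality

variable {κ p T : ℝ} {u : ℝ → H1}

theorem integrable_bounded_mul (a : ℝ →ᵇ ℝ) {f : ℝ → ℝ} (hf : Integrable f) :
    Integrable fun x => a x * f x :=
  hf.bdd_mul a.continuous.aestronglyMeasurable (Eventually.of_forall a.norm_coe_le_norm)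

theorem continuous_power (hp : 5 ≤ p) : Continuous (H1.power hp) := (isLocLip_power hp).continuous

theorem continuous_potential (hp : 5 ≤ p) : Continuous (H1.potential p) := by
  have h : H1.potential p = fun v : H1 => (inner ℂ (H1.power hp v).toL2 v.toL2).re :=
    funext fun v => (re_inner_power_self hp v).symm
  rw [h]
  have := continuous_power hp
  exact Complex.continuous_re.comp (Continuous.inner (by fun_prop) (by fun_prop))

theorem continuous_virialRate (hp : 5 ≤ p) {a a1 a2 : ℝ →ᵇ ℝ} (ha : ∀ x, HasDerivAt a (a1 x) x) :
    Continuous (virialRate κ p a1 a2) := by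
  have h : virialRate κ p a1 a2 = fun v : H1 => virialForm κ a1 a2 v -
      2 * (inner ℂ (H1.power hp v).toL2 (virialOp a a1 v)).re :=
    funext fun v => by rw [two_mul_re_inner_power_virialOp hp ha, virialRate]
  rw [h]
  have := continuous_power hp
  exact quadLip_virialForm.continuous.sub
    (continuous_const.mul (Complex.continuous_re.comp (Continuous.inner (by fun_prop) (by fun_prop))))

/-- `c sin(ε x)`. -/
def sinWeight (c ε : ℝ) : ℝ →ᵇ ℝ :=
  BoundedContinuousFunction.ofNormedAddCommGroup (fun x => c * Real.sin (ε * x)) (by fun_prop) |c|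
    fun x => by
      rw [norm_mul]
      exact mul_le_of_le_one_right (norm_nonneg c) (Real.abs_sin_le_one _)

/-- `c cos(ε x)`. -/
def cosWeight (c ε : ℝ) : ℝ →ᵇ ℝ :=
  BoundedContinuousFunction.ofNormedAddCommGroup (fun x => c * Real.cos (ε * x)) (by fun_prop) |c|
    fun x => by
      rw [norm_mul]
      exact mul_le_of_le_one_right (norm_nonneg c) (Real.abs_cos_le_one _)

/-- `c (1 - cos(ε x))`. -/
def massWeight (c ε : ℝ) : ℝ →ᵇ ℝ :=
  BoundedContinuousFunction.ofNormedAddCommGroup (fun x => c * (1 - Real.cos (ε * x)))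
    (by fun_prop) (|c| * 2) fun x => by
      rw [norm_mul]
      refine mul_le_mul_of_nonneg_left ?_ (norm_nonneg c)
      rw [Real.norm_eq_abs, abs_le]
      constructor <;> linarith [Real.neg_one_le_cos (ε * x), Real.cos_le_one (ε * x)]

theorem sinWeight_apply (c ε x : ℝ) : sinWeight c ε x = c * Real.sin (ε * x) := rfl

theorem cosWeight_apply (c ε x : ℝ) : cosWeight c ε x = c * Real.cos (ε * x) := rfl

theorem massWeight_apply (c ε x : ℝ) : massWeight c ε x = c * (1 - Real.cos (ε * x)) := rfl

theorem hasDerivAt_sinWeight (c ε x : ℝ) : HasDerivAt (sinWeight c ε) (cosWeight (c * ε) ε x) x := by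
  refine ((((hasDerivAt_id x).const_mul ε).sin).const_mul c).congr_deriv ?_
  simp [cosWeight_apply]
  ring

theorem hasDerivAt_cosWeight (c ε x : ℝ) :
    HasDerivAt (cosWeight c ε) (sinWeight (-(c * ε)) ε x) x := by
  refine ((((hasDerivAt_id x).const_mul ε).cos).const_mul c).congr_deriv ?_
  simp [sinWeight_apply]
  ring

theorem hasDerivAt_massWeight (c ε x : ℝ) :
    HasDerivAt (massWeight c ε) (sinWeight (c * ε) ε x) x := by
  refine (((((hasDerivAt_id x).const_mul ε).cos).const_sub 1).const_mul c).congr_deriv ?_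
  simp [sinWeight_apply]
  ring

/-- The functional `P` of the virial identity. -/
def H1.pohozaev (κ p : ℝ) (v : H1) : ℝ :=
  ‖v.dx‖ ^ 2 + κ ^ 2 / 2 * ‖v.rep 0‖ ^ 2 - (p - 1) / (2 * (p + 1)) * v.potential p

theorem EvolvesOn.continuousOn_H1 {F : EnergySpace κ → EnergySpace κ}
    (h : EvolvesOn (resolvent κ) F T fun t => toEnergy κ (u t)) : ContinuousOn u (Ico 0 T) := by
  have : ContinuousOn (fun s => (toEnergy κ).symm (toEnergy κ (u s))) (Ico 0 T) :=
    (toEnergy κ).symm.continuous.comp_continuousOn h.1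
  simpa only [ContinuousLinearEquiv.symm_apply_apply] using this

theorem continuous_pohozaev (hp : 5 ≤ p) : Continuous (H1.pohozaev κ p) := by
  have := continuous_potential hp
  unfold H1.pohozaev
  exact ((by fun_prop : Continuous fun v : H1 => ‖v.dx‖ ^ 2).add
    (continuous_const.mul ((H1.eval 0).continuous.norm.pow 2))).sub (continuous_const.mul this)

theorem virialForm_eq (a1 a2 : ℝ →ᵇ ℝ) (v : H1) : virialForm κ a1 a2 v =
    2 * (∫ x, a1 x * ‖v.dx x‖ ^ 2) + (inner ℂ (L2.mul a2 v.toL2) v.dx).re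
      + κ ^ 2 * a1 0 * ‖v.rep 0‖ ^ 2 := by
  rw [virialForm, L2.inner_mul_self, Complex.ofReal_re]

theorem abs_integral_cosWeight_le (c ε : ℝ) {f : ℝ → ℝ} (hf : Integrable f) (h0 : ∀ x, 0 ≤ f x) :
    |∫ x, cosWeight c ε x * f x| ≤ |c| * ∫ x, f x := by
  rw [← integral_const_mul, ← Real.norm_eq_abs]
  refine norm_integral_le_of_norm_le (hf.const_mul _) (Eventually.of_forall fun x => ?_)
  rw [norm_mul, Real.norm_of_nonneg (h0 x), cosWeight_apply, norm_mul]
  refine mul_le_mul_of_nonneg_right ?_ (h0 x)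
  exact mul_le_of_le_one_right (norm_nonneg c) (Real.abs_cos_le_one _)

theorem tendsto_integral_cosWeight (c : ℝ) {f : ℝ → ℝ} (hf : Integrable f) {e : ℕ → ℝ}
    (he : Tendsto e atTop (𝓝 0)) :
    Tendsto (fun n => ∫ x, cosWeight c (e n) x * f x) atTop (𝓝 (c * ∫ x, f x)) := by
  rw [← integral_const_mul]
  refine tendsto_integral_of_dominated_convergence (fun x => |c| * ‖f x‖)
    (fun n => (integrable_bounded_mul _ hf).aestronglyMeasurable) (hf.norm.const_mul _)
    (fun n => Eventually.of_forall fun x => ?_) (Eventually.of_forall fun x => ?_)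
  · rw [norm_mul, cosWeight_apply, norm_mul]
    gcongr
    exact mul_le_of_le_one_right (norm_nonneg c) (Real.abs_cos_le_one _)
  · simp only [cosWeight_apply]
    have : Tendsto (fun n => c * Real.cos (e n * x) * f x) atTop
        (𝓝 (c * Real.cos (0 * x) * f x)) :=
      (((Real.continuous_cos.tendsto _).comp (he.mul_const x)).const_mul c).mul_const _
    simpa using this

theorem norm_sinWeight_mul_le (c ε : ℝ) (f : L2) : ‖L2.mul (sinWeight c ε) f‖ ≤ |c| * ‖f‖ := by
  refine Lp.norm_le_mul_norm_of_ae_le_mul ?_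
  filter_upwards [L2.mul_ae (sinWeight c ε) f] with x h
  rw [h, norm_mul, Complex.norm_real]
  gcongr
  rw [sinWeight_apply, norm_mul]
  exact mul_le_of_le_one_right (norm_nonneg c) (Real.abs_sin_le_one _)

theorem abs_inner_sinWeight_le (c ε : ℝ) (v : H1) :
    |(inner ℂ (L2.mul (sinWeight c ε) v.toL2) v.dx).re| ≤ |c| * ‖v‖ ^ 2 := by
  refine (Complex.abs_re_le_norm _).trans ((norm_inner_le_norm _ _).trans ?_)
  calc _ ≤ (|c| * ‖v‖) * ‖v‖ := by
        refine mul_le_mul ((norm_sinWeight_mul_le c ε _).trans ?_) v.norm_dx_le (norm_nonneg _)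
          (by positivity)
        gcongr
        exact v.norm_toL2_le
    _ = _ := by ring

/-- As `ε → 0`, the weight `2 cos(ε x)` tends boundedly to `2` and `-2 ε sin(ε x)` to `0`, which
leaves the rate `4 P` belonging to the unbounded weight `x²`. -/
theorem tendsto_virialRate (hp : 5 ≤ p) (v : H1) {e : ℕ → ℝ} (he : Tendsto e atTop (𝓝 0)) :
    Tendsto (fun n => virialRate κ p (cosWeight 2 (e n)) (sinWeight (-(2 * e n)) (e n)) v) atTop
      (𝓝 (4 * v.pohozaev κ p)) := by
  have h1 := (tendsto_integral_cosWeight 2 v.integrable_sq_dx he).const_mul 2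
  have h2 := (tendsto_integral_cosWeight 2 (H1.integrable_norm_rpow hp v) he).const_mul
    ((p - 1) / (p + 1))
  have h3 : Tendsto (fun n => (inner ℂ (L2.mul (sinWeight (-(2 * e n)) (e n)) v.toL2) v.dx).re)
      atTop (𝓝 0) := by
    refine squeeze_zero_norm (fun n => abs_inner_sinWeight_le _ _ v) ?_
    have := ((he.const_mul 2).neg.abs).mul_const (‖v‖ ^ 2)
    simpa using this
  have h4 := ((h1.add h3).add_const (κ ^ 2 * 2 * ‖v.rep 0‖ ^ 2)).sub h2
  simp only [virialRate, virialForm_eq, cosWeight_apply, mul_zero, Real.cos_zero, mul_one] at h4 ⊢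
  convert! h4 using 2
  rw [H1.pohozaev, H1.norm_sq_dx, H1.potential]
  have : p + 1 ≠ 0 := by linarith
  field_simp
  ring

theorem abs_virialRate_le (hp : 5 ≤ p) (v : H1) {ε : ℝ} (hε : |ε| ≤ 1) :
    |virialRate κ p (cosWeight 2 ε) (sinWeight (-(2 * ε)) ε) v| ≤
      (6 + 2 * κ ^ 2) * ‖v‖ ^ 2 + 2 * v.potential p := by
  have h1 := abs_integral_cosWeight_le 2 ε v.integrable_sq_dx (fun x => by positivity)
  have h2 := abs_integral_cosWeight_le 2 ε (H1.integrable_norm_rpow hp v) (fun x => by positivity)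
  have h3 := abs_inner_sinWeight_le (-(2 * ε)) ε v
  rw [← H1.norm_sq_dx] at h1
  have h5 : ‖v.dx‖ ^ 2 ≤ ‖v‖ ^ 2 := by gcongr; exact v.norm_dx_le
  have h6 : κ ^ 2 * ‖v.rep 0‖ ^ 2 ≤ κ ^ 2 * ‖v‖ ^ 2 := by gcongr; exact v.norm_rep_le 0
  have h7 : 0 ≤ κ ^ 2 * ‖v.rep 0‖ ^ 2 := by positivity
  have h8 : |-(2 * ε)| * ‖v‖ ^ 2 ≤ 2 * ‖v‖ ^ 2 := by
    rw [abs_neg, abs_mul]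
    gcongr
    norm_num
    exact hε
  have hq : 0 ≤ (p - 1) / (p + 1) := div_nonneg (by linarith) (by linarith)
  have hq1 : (p - 1) / (p + 1) ≤ 1 := by rw [div_le_one (by linarith)]; linarith
  have h9 : |(p - 1) / (p + 1) * ∫ x, cosWeight 2 ε x * ‖v.rep x‖ ^ (p + 1)| ≤
      2 * v.potential p := by
    rw [abs_mul, abs_of_nonneg hq]
    refine (mul_le_of_le_one_left (abs_nonneg _) hq1).trans (h2.trans_eq ?_)
    rw [H1.potential]; norm_num
  rw [virialRate, virialForm_eq, cosWeight_apply]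
  norm_num at h1 ⊢
  rw [abs_le] at *
  constructor <;> nlinarith

theorem virial_eq_zero_of_real {v : H1} (h : ∀ x, (v.rep x).im = 0) (h' : ∀ᵐ x, (v.dx x).im = 0)
    (a a1 : ℝ →ᵇ ℝ) : virial a a1 v = 0 := by
  rw [virial, virialOp_apply, inner_add_right, inner_smul_right, L2.inner_mul_self, L2.inner_def]
  have e : ∫ x, inner ℂ (v.toL2 x) (L2.mul a v.dx x) = ((∫ x, (v.rep x).re * (a x * (v.dx x).re) : ℝ) : ℂ) := by
    rw [← integral_complex_ofReal]
    refine integral_congr_ae ?_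
    filter_upwards [v.coeFn_ae_eq_rep, L2.mul_ae a v.dx, h'] with x h1 h2 h3
    have e1 : v.rep x = ((v.rep x).re : ℂ) := Complex.ext rfl (by simp [h x])
    have e2 : v.dx x = ((v.dx x).re : ℂ) := Complex.ext rfl (by simp [h3])
    rw [h1, h2, RCLike.inner_apply, e1, e2]
    simp
    ring
  rw [e, Complex.add_im, Complex.ofReal_im, Complex.mul_im]
  simp

/-- The bounded weights `(2/ε²)(1 - cos(ε x)) ≤ x²` replace `x²`, so finite variance is needed at
time `0` only. For the weighted mass `V` one has `V(t) ≥ 0`, and `V'(0) = 0` since the data are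
real; Taylor's formula and the limit `ε → 0` give the bound. -/
theorem EvolvesOn.virial_inequality (hp : 5 ≤ p)
    (h : EvolvesOn (resolvent κ) (energyPower κ hp) T fun t => toEnergy κ (u t))
    (hre : ∀ x, ((u 0).rep x).im = 0) (hre' : ∀ᵐ x, ((u 0).dx x).im = 0)
    (hx : Integrable fun x => x ^ 2 * ‖(u 0).rep x‖ ^ 2) {δ : ℝ}
    (hδ : ∀ t ∈ Ico 0 T, (u t).pohozaev κ p ≤ -δ) {t : ℝ} (ht : t ∈ Ico 0 T) :
    4 * δ * t ^ 2 ≤ ∫ x, x ^ 2 * ‖(u 0).rep x‖ ^ 2 := by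
  have hsub : Icc 0 t ⊆ Ico 0 T := fun s hs => ⟨hs.1, hs.2.trans_lt ht.2⟩
  have huc : ContinuousOn u (Icc 0 t) := h.continuousOn_H1.mono hsub
  set e : ℕ → ℝ := fun n => 1 / ((n : ℝ) + 1) with he
  have hepos : ∀ n, 0 < e n := fun n => by positivity
  have he0 : Tendsto e atTop (𝓝 0) := tendsto_one_div_add_atTop_nhds_zero_nat
  have he1 : ∀ n, |e n| ≤ 1 := fun n => by
    rw [abs_of_pos (hepos n), he]
    exact (div_le_one (by positivity)).mpr (by linarith [(Nat.cast_nonneg n : (0 : ℝ) ≤ n)])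
  set R : ℕ → H1 → ℝ := fun n =>
    virialRate κ p (cosWeight 2 (e n)) (sinWeight (-(2 * e n)) (e n)) with hR
  have hRc : ∀ n, Continuous (R n) := fun n => by
    have := continuous_virialRate (κ := κ) (a2 := sinWeight (-(2 * e n)) (e n)) hp
      (hasDerivAt_sinWeight (2 / e n) (e n))
    rwa [div_mul_cancel₀ _ (hepos n).ne'] at this
  have key : ∀ n, 0 ≤ (∫ x, x ^ 2 * ‖(u 0).rep x‖ ^ 2) + ∫ s in (0 : ℝ)..t, (t - s) * (2 * R n (u s)) := by
    intro n
    set b := massWeight (2 / e n ^ 2) (e n) with hb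
    set a := sinWeight (2 / e n) (e n) with ha
    set a1 := cosWeight 2 (e n) with ha1
    have db : ∀ x, HasDerivAt b (a x) x := fun x => by
      have := hasDerivAt_massWeight (2 / e n ^ 2) (e n) x
      rwa [show 2 / e n ^ 2 * e n = 2 / e n by have := (hepos n).ne'; field_simp] at this
    have da : ∀ x, HasDerivAt a (a1 x) x := fun x => by
      have := hasDerivAt_sinWeight (2 / e n) (e n) x
      rwa [div_mul_cancel₀ _ (hepos n).ne'] at this
    have dm := fun s (hs : s ∈ Ico 0 T) => h.hasDerivWithinAt_virial_rate hp da
      (hasDerivAt_cosWeight 2 (e n)) (by simp [ha, sinWeight_apply]) hs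
    have dV := fun s (hs : s ∈ Ico 0 T) => h.hasDerivWithinAt_weightedMass (a1 := a1) hp db hs
    -- The derivative of `V(s) + (t - s) V'(s)` is `(t - s) V''(s)`: Taylor's formula with integral
    -- remainder.
    have dH : ∀ s ∈ Ico 0 T, HasDerivWithinAt
        (fun s => weightedMass b (u s) + (t - s) * (2 * virial a a1 (u s)))
        ((t - s) * (2 * R n (u s))) (Ici 0) s := by
      intro s hs
      refine ((dV s hs).add (((hasDerivWithinAt_id s _).const_sub t).mul
        ((dm s hs).const_mul 2))).congr_deriv ?_
      simp only [id_eq, hR]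
      ring
    have hint := intervalIntegral.integral_eq_sub_of_hasDeriv_right_of_le ht.1
      (fun s hs => ((dH s (hsub hs)).continuousWithinAt).mono Icc_subset_Ici_self)
      (fun s hs => (dH s (hsub (Ioo_subset_Icc_self hs))).mono
        (Ioi_subset_Ici hs.1.le))
      (ContinuousOn.intervalIntegrable_of_Icc ht.1 (by
        have := (hRc n).comp_continuousOn huc
        fun_prop))
    rw [hint, virial_eq_zero_of_real hre hre']
    have hVt : 0 ≤ weightedMass b (u t) := by
      refine integral_nonneg fun x => mul_nonneg ?_ (by positivity)
      rw [hb, massWeight_apply]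
      have := Real.cos_le_one (e n * x)
      have := hepos n
      exact mul_nonneg (by positivity) (by linarith)
    have hV0 : weightedMass b (u 0) ≤ ∫ x, x ^ 2 * ‖(u 0).rep x‖ ^ 2 := by
      refine integral_mono (integrable_bounded_mul _ (u 0).integrable_sq_rep) hx fun x => ?_
      refine mul_le_mul_of_nonneg_right ?_ (by positivity)
      rw [hb, massWeight_apply, div_mul_eq_mul_div, div_le_iff₀ (by have := hepos n; positivity)]
      nlinarith [Real.one_sub_sq_div_two_le_cos (x := e n * x)]
    simp only [sub_self, zero_mul, mul_zero, add_zero]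
    linarith
  have hlim : Tendsto (fun n => ∫ s in (0 : ℝ)..t, (t - s) * (2 * R n (u s))) atTop
      (𝓝 (∫ s in (0 : ℝ)..t, (t - s) * (2 * (4 * (u s).pohozaev κ p)))) := by
    have hpc := continuous_potential hp
    refine intervalIntegral.tendsto_integral_filter_of_dominated_convergence
      (fun s => (t - s) * (2 * ((6 + 2 * κ ^ 2) * ‖u s‖ ^ 2 + 2 * (u s).potential p))) ?_ ?_ ?_ ?_
    · refine Eventually.of_forall fun n => ?_
      have : ContinuousOn (fun s => (t - s) * (2 * R n (u s))) (Icc 0 t) := by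
        have := (hRc n).comp_continuousOn huc
        fun_prop
      rw [uIoc_of_le ht.1]
      exact (this.intervalIntegrable_of_Icc ht.1).1.aestronglyMeasurable
    · refine Eventually.of_forall fun n => Eventually.of_forall fun s hs => ?_
      rw [uIoc_of_le ht.1] at hs
      have : 0 ≤ t - s := by linarith [hs.2]
      rw [norm_mul, Real.norm_of_nonneg this, norm_mul, Real.norm_two]
      gcongr
      exact abs_virialRate_le hp (u s) (he1 n)
    · refine ContinuousOn.intervalIntegrable_of_Icc ht.1 ?_
      have := hpc.comp_continuousOn huc
      fun_prop
    · refine Eventually.of_forall fun s _ => ?_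
      exact ((tendsto_virialRate hp (u s) he0).const_mul 2).const_mul _
  have hfin := ge_of_tendsto' (hlim.const_add (∫ x, x ^ 2 * ‖(u 0).rep x‖ ^ 2)) key
  have hle : ∫ s in (0 : ℝ)..t, (t - s) * (2 * (4 * (u s).pohozaev κ p)) ≤
      ∫ s in (0 : ℝ)..t, (t - s) * (-8 * δ) := by
    refine intervalIntegral.integral_mono_on ht.1 ?_ ?_ fun s hs => ?_
    · refine ContinuousOn.intervalIntegrable_of_Icc ht.1 ?_
      have := (continuous_pohozaev (κ := κ) hp).comp_continuousOn huc
      fun_prop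
    · exact Continuous.intervalIntegrable (by fun_prop) _ _
    · have := hδ s (hsub hs)
      refine mul_le_mul_of_nonneg_left (by linarith) (by linarith [hs.2])
  have hval : ∫ s in (0 : ℝ)..t, (t - s) * (-8 * δ) = -4 * δ * t ^ 2 := by
    rw [intervalIntegral.integral_mul_const, intervalIntegral.integral_sub (by simp) (by simp)]
    simp
    ring
  linarith

end VirialInequality

end DeltaNLS

namespace DeltaNLS

open MeasureTheory Set Filter Topology
open scoped ComplexConjugate NNReal BoundedContinuousFunction

/-! ### The explicit soliton profile: differential equation and decay. -/

section Soliton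

variable {ω p c γ : ℝ}

/-- The translated soliton profile. -/
def soliton (ω p c y : ℝ) : ℝ :=
  ((p + 1) * ω / 2 * (1 / Real.cosh ((p - 1) * √ω / 2 * y + c)) ^ 2) ^ (1 / (p - 1))

/-- The derivative of the soliton profile. -/
def solitonDeriv (ω p c y : ℝ) : ℝ :=
  -√ω * (Real.sinh ((p - 1) * √ω / 2 * y + c) / Real.cosh ((p - 1) * √ω / 2 * y + c)) *
    soliton ω p c y

theorem profile_eq (γ ω p x : ℝ) :
    profile γ ω p x = soliton ω p (Real.artanh (γ / (2 * √ω))) |x| := rfl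

theorem soliton_pos (hω : 0 < ω) (hp : 5 ≤ p) (y : ℝ) : 0 < soliton ω p c y := by
  have : 0 < p + 1 := by linarith
  have := Real.cosh_pos ((p - 1) * √ω / 2 * y + c)
  rw [soliton]
  positivity

theorem soliton_rpow (hω : 0 < ω) (hp : 5 ≤ p) (y : ℝ) : soliton ω p c y ^ (p - 1) =
    (p + 1) * ω / 2 * (1 / Real.cosh ((p - 1) * √ω / 2 * y + c)) ^ 2 := by
  have : 0 < p + 1 := by linarith
  have := Real.cosh_pos ((p - 1) * √ω / 2 * y + c)
  rw [soliton, ← Real.rpow_mul (by positivity), one_div_mul_cancel (by linarith), Real.rpow_one]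

theorem soliton_eq_mul (hω : 0 < ω) (hp : 5 ≤ p) (y : ℝ) : soliton ω p c y =
    ((p + 1) * ω / 2) ^ (1 / (p - 1)) *
      Real.cosh ((p - 1) * √ω / 2 * y + c) ^ (-(2 / (p - 1))) := by
  have : 0 < p + 1 := by linarith
  have hc := Real.cosh_pos ((p - 1) * √ω / 2 * y + c)
  rw [soliton, Real.mul_rpow (by positivity) (by positivity),
    one_div (Real.cosh _), inv_pow, Real.inv_rpow (by positivity), Real.rpow_neg hc.le, ← Real.rpow_natCast, ← Real.rpow_mul hc.le]
  congr 3
  push_cast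
  ring

theorem hasDerivAt_arg (k c y : ℝ) : HasDerivAt (fun y => k * y + c) k y := by
  simpa using ((hasDerivAt_id y).const_mul k).add_const c

theorem hasDerivAt_soliton (hω : 0 < ω) (hp : 5 ≤ p) (y : ℝ) :
    HasDerivAt (soliton ω p c) (solitonDeriv ω p c y) y := by
  have hc := Real.cosh_pos ((p - 1) * √ω / 2 * y + c)
  have h := (((hasDerivAt_arg ((p - 1) * √ω / 2) c y).cosh).rpow_const
    (p := -(2 / (p - 1))) (Or.inl hc.ne')).const_mul (((p + 1) * ω / 2) ^ (1 / (p - 1)))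
  refine (h.congr_of_eventuallyEq (Eventually.of_forall fun y => soliton_eq_mul hω hp y)).congr_deriv ?_
  rw [solitonDeriv, soliton_eq_mul hω hp, Real.rpow_sub_one hc.ne']
  have : p - 1 ≠ 0 := by linarith
  field_simp

theorem continuous_soliton (hω : 0 < ω) (hp : 5 ≤ p) : Continuous (soliton ω p c) :=
  continuous_iff_continuousAt.mpr fun y => (hasDerivAt_soliton hω hp y).continuousAt

theorem rpow_eq_mul_of_pos {s : ℝ} (hs : 0 < s) (p : ℝ) : s ^ p = s ^ (p - 1) * s := by
  rw [← Real.rpow_add_one hs.ne']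
  congr 1; ring

theorem hasDerivAt_solitonDeriv (hω : 0 < ω) (hp : 5 ≤ p) (y : ℝ) :
    HasDerivAt (solitonDeriv ω p c) (ω * soliton ω p c y - soliton ω p c y ^ p) y := by
  set k := (p - 1) * √ω / 2 with hk
  have hc := Real.cosh_pos (k * y + c)
  have h := ((((hasDerivAt_arg k c y).sinh).div ((hasDerivAt_arg k c y).cosh) hc.ne').const_mul
    (-√ω)).mul (hasDerivAt_soliton (c := c) hω hp y)
  refine h.congr_deriv ?_
  rw [rpow_eq_mul_of_pos (soliton_pos hω hp y), soliton_rpow hω hp, solitonDeriv, ← hk]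
  have e := Real.cosh_sq (k * y + c)
  have e2 := Real.sq_sqrt hω.le
  have e3 : √ω * k = (p - 1) * ω / 2 := by rw [hk]; linear_combination (p - 1) / 2 * e2
  set C := Real.cosh (k * y + c)
  set S := Real.sinh (k * y + c)
  set s := soliton ω p c y
  have e4 : S ^ 2 = C ^ 2 - 1 := by linarith
  simp only [Pi.div_apply]
  have l1 : -√ω * ((C * k * C - S * (S * k)) / C ^ 2) * s =
      -((p - 1) * ω / 2) * (1 / C ^ 2) * s := by
    rw [← e3]
    field_simp
    linear_combination k * s * e4
  have l2 : -√ω * (S / C) * (-√ω * (S / C) * s) = ω * (1 - 1 / C ^ 2) * s := by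
    have : -√ω * (S / C) * (-√ω * (S / C) * s) = √ω ^ 2 * (S ^ 2 / C ^ 2) * s := by ring
    rw [this, e2, e4]
    field_simp
  rw [l1, l2]
  ring

/-- The first integral of `φ'' = ω φ - φ^p` with integration constant zero. It gives the derivative
bound, the second integral identity for the standing wave and the equality case of the calibration.
-/
theorem solitonDeriv_sq (hω : 0 < ω) (hp : 5 ≤ p) (y : ℝ) : solitonDeriv ω p c y ^ 2 =
    ω * soliton ω p c y ^ 2 - 2 / (p + 1) * soliton ω p c y ^ (p + 1) := by
  have hs := soliton_pos (c := c) hω hp y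
  have e0 : soliton ω p c y ^ (p + 1) = soliton ω p c y ^ (p - 1) * soliton ω p c y ^ 2 := by
    rw [← Real.rpow_natCast, ← Real.rpow_add hs]
    congr 1; push_cast; ring
  rw [e0, soliton_rpow hω hp, solitonDeriv]
  set z := (p - 1) * √ω / 2 * y + c
  have hc := Real.cosh_pos z
  have e := Real.cosh_sq z
  have e2 := Real.sq_sqrt hω.le
  have : p + 1 ≠ 0 := by linarith
  have e4 : Real.sinh z ^ 2 = Real.cosh z ^ 2 - 1 := by linarith
  rw [mul_pow, mul_pow, neg_sq, e2, div_pow, e4]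
  field_simp

theorem soliton_rpow_le (hω : 0 < ω) (hp : 5 ≤ p) (y : ℝ) :
    soliton ω p c y ^ (p - 1) ≤ (p + 1) * ω / 2 := by
  rw [soliton_rpow hω hp]
  have : 0 < p + 1 := by linarith
  refine mul_le_of_le_one_right (by positivity) (pow_le_one₀ ?_ ?_)
  · have := Real.cosh_pos ((p - 1) * √ω / 2 * y + c)
    positivity
  · rw [div_le_one (Real.cosh_pos _)]
    exact Real.one_le_cosh _

theorem abs_solitonDeriv_le (hω : 0 < ω) (hp : 5 ≤ p) (y : ℝ) :
    |solitonDeriv ω p c y| ≤ √ω * soliton ω p c y := by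
  have hs := soliton_pos (c := c) hω hp y
  refine abs_le_of_sq_le_sq ?_ (by positivity)
  have : 0 < p + 1 := by linarith
  rw [solitonDeriv_sq hω hp, mul_pow, Real.sq_sqrt hω.le]
  have : 0 ≤ 2 / (p + 1) * soliton ω p c y ^ (p + 1) := by positivity
  linarith

theorem abs_solitonDeriv_deriv_le (hω : 0 < ω) (hp : 5 ≤ p) (y : ℝ) :
    |ω * soliton ω p c y - soliton ω p c y ^ p| ≤ (ω + (p + 1) * ω / 2) * soliton ω p c y := by
  have hs := soliton_pos (c := c) hω hp y
  have h1 := soliton_rpow_le (c := c) hω hp y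
  rw [rpow_eq_mul_of_pos hs, ← sub_mul, abs_mul, abs_of_pos hs]
  gcongr
  have : 0 < soliton ω p c y ^ (p - 1) := by positivity
  rw [abs_le]
  constructor <;> linarith

theorem exp_neg_mul_abs_le {μ : ℝ} (hμ : 0 < μ) :
    ∃ C, 0 < C ∧ ∀ y : ℝ, (1 + y ^ 2) * Real.exp (-(μ * |y|)) ≤ C * (1 + y ^ 2)⁻¹ := by
  refine ⟨2 * (1 + 24 / μ ^ 4), by positivity, fun y => ?_⟩
  -- The quartic term of the exponential series, with `4! = 24`, controls `y⁴`, and `(1 + y²)² ≤ 2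
  -- (1 + y⁴)`.
  have h1 := Real.pow_div_factorial_le_exp (x := μ * |y|) (by positivity) 4
  have h2 : 1 ≤ Real.exp (μ * |y|) := Real.one_le_exp (by positivity)
  have h3 : (Nat.factorial 4 : ℝ) = 24 := by norm_num [Nat.factorial]
  rw [h3, mul_pow, (by decide : Even 4).pow_abs] at h1
  have h4 : y ^ 4 ≤ 24 / μ ^ 4 * Real.exp (μ * |y|) := by
    rw [div_mul_eq_mul_div, le_div_iff₀ (by positivity)]
    rw [div_le_iff₀ (by norm_num)] at h1
    linarith
  rw [Real.exp_neg, ← div_eq_mul_inv, ← div_eq_mul_inv, div_le_div_iff₀ (Real.exp_pos _)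
    (by positivity)]
  nlinarith [sq_nonneg (y ^ 2 - 1)]

/-- One estimate provides both square integrability and the finite variance required by the virial
argument. -/
theorem soliton_decay (hω : 0 < ω) (hp : 5 ≤ p) (c : ℝ) :
    ∃ C, 0 < C ∧ ∀ y : ℝ, (1 + y ^ 2) * soliton ω p c y ^ 2 ≤ C * (1 + y ^ 2)⁻¹ := by
  have hp1 : 0 < p + 1 := by linarith
  have hpm : 0 < p - 1 := by linarith
  have hsω : 0 < √ω := Real.sqrt_pos.mpr hω
  obtain ⟨C, hC, H⟩ := exp_neg_mul_abs_le (μ := 2 * √ω) (by positivity)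
  set A := ((p + 1) * ω / 2) ^ (1 / (p - 1)) with hA
  set D := (Real.exp (-|c|) / 2) ^ (-(2 / (p - 1))) with hD
  have hA0 : 0 < A := by positivity
  have hD0 : 0 < D := by positivity
  refine ⟨(A * D) ^ 2 * C, by positivity, fun y => ?_⟩
  set z := (p - 1) * √ω / 2 * y + c with hz
  have h1 : Real.exp (-|c|) / 2 * Real.exp ((p - 1) * √ω / 2 * |y|) ≤ Real.cosh z := by
    have e1 : (p - 1) * √ω / 2 * |y| - |c| ≤ |z| := by
      have : |(p - 1) * √ω / 2 * y| = (p - 1) * √ω / 2 * |y| := by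
        rw [abs_mul, abs_of_pos (by positivity)]
      rw [← this, hz]
      have := abs_sub_abs_le_abs_sub ((p - 1) * √ω / 2 * y) (-c)
      rwa [abs_neg, sub_neg_eq_add] at this
    have e2 : Real.exp |z| / 2 ≤ Real.cosh z := by
      rw [← Real.cosh_abs, Real.cosh_eq]
      have := Real.exp_pos (-|z|)
      linarith
    refine le_trans ?_ e2
    rw [div_mul_eq_mul_div, ← Real.exp_add]
    gcongr
    linarith
  have h2 : soliton ω p c y ≤ A * D * Real.exp (-(√ω * |y|)) := by
    rw [soliton_eq_mul hω hp, ← hA, mul_assoc]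
    refine mul_le_mul_of_nonneg_left ?_ hA0.le
    refine (Real.rpow_le_rpow_of_nonpos (by positivity) h1 (by
      rw [neg_nonpos]; positivity)).trans_eq ?_
    rw [Real.mul_rpow (by positivity) (by positivity), ← hD, ← Real.exp_mul]
    congr 2
    field_simp
  calc (1 + y ^ 2) * soliton ω p c y ^ 2 ≤ (1 + y ^ 2) * (A * D * Real.exp (-(√ω * |y|))) ^ 2 := by
        have := (soliton_pos (c := c) hω hp y).le
        gcongr
    _ = (A * D) ^ 2 * ((1 + y ^ 2) * Real.exp (-(2 * √ω * |y|))) := by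
        rw [mul_pow, ← Real.exp_nat_mul]
        push_cast
        rw [show (2 : ℝ) * -(√ω * |y|) = -(2 * √ω * |y|) by ring]
        ring
    _ ≤ (A * D) ^ 2 * (C * (1 + y ^ 2)⁻¹) := mul_le_mul_of_nonneg_left (H y) (by positivity)
    _ = _ := by ring

/-- An upper bound for the soliton profile. -/
def solitonMax (ω p : ℝ) : ℝ := ((p + 1) * ω / 2) ^ (1 / (p - 1))

theorem solitonMax_pos (hω : 0 < ω) (hp : 5 ≤ p) : 0 < solitonMax ω p := by
  have : 0 < p + 1 := by linarith
  rw [solitonMax]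
  positivity

theorem solitonMax_rpow (hω : 0 < ω) (hp : 5 ≤ p) :
    solitonMax ω p ^ (p - 1) = (p + 1) * ω / 2 := by
  have : 0 < p + 1 := by linarith
  rw [solitonMax, ← Real.rpow_mul (by positivity), one_div_mul_cancel (by linarith), Real.rpow_one]

theorem soliton_le_max (hω : 0 < ω) (hp : 5 ≤ p) (y : ℝ) : soliton ω p c y ≤ solitonMax ω p := by
  refine (Real.rpow_le_rpow_iff (soliton_pos hω hp y).le (solitonMax_pos hω hp).le
    (by linarith : 0 < p - 1)).mp ?_
  rw [solitonMax_rpow hω hp]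
  exact soliton_rpow_le hω hp y

/-- The map `τ` stands for either the identity or the absolute value, so that the profile on the
half-line and its even extension are treated together. -/
theorem integrable_mul_soliton_sq (hω : 0 < ω) (hp : 5 ≤ p) (c : ℝ) {τ : ℝ → ℝ}
    (hτ : Continuous τ) (h : ∀ y, τ y ^ 2 = y ^ 2) :
    Integrable fun y => (1 + y ^ 2) * soliton ω p c (τ y) ^ 2 := by
  obtain ⟨C, hC, H⟩ := soliton_decay hω hp c
  have := (continuous_soliton (c := c) hω hp).comp hτ
  refine (integrable_inv_one_add_sq.const_mul C).mono' (by fun_prop) (Eventually.of_forall fun y => ?_)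
  rw [Real.norm_of_nonneg (by positivity), ← h y]
  exact H (τ y)

theorem memLp_of_norm_le_soliton (hω : 0 < ω) (hp : 5 ≤ p) (c : ℝ) {τ : ℝ → ℝ}
    (hτ : Continuous τ) (hsq : ∀ y, τ y ^ 2 = y ^ 2) {f : ℝ → ℂ}
    (hf : AEStronglyMeasurable f volume) {K : ℝ}
    (h : ∀ y, ‖f y‖ ≤ K * soliton ω p c (τ y)) : MemLp f 2 := by
  have hi := integrable_mul_soliton_sq hω hp c hτ hsq
  have hc : Continuous fun y => soliton ω p c (τ y) := (continuous_soliton hω hp).comp hτ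
  have hm : MemLp (fun y => soliton ω p c (τ y)) 2 (volume : Measure ℝ) := by
    rw [memLp_two_iff_integrable_sq hc.aestronglyMeasurable]
    refine hi.mono' (hc.pow 2).aestronglyMeasurable (Eventually.of_forall fun y => ?_)
    rw [Real.norm_of_nonneg (by positivity)]
    nlinarith [mul_nonneg (sq_nonneg y) (sq_nonneg (soliton ω p c (τ y)))]
  refine MemLp.of_le_mul (c := K) hm hf (Eventually.of_forall fun y => ?_)
  rw [Real.norm_of_nonneg (soliton_pos hω hp _).le]
  exact h y

end Soliton

end DeltaNLS

namespace DeltaNLS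

open MeasureTheory Set Filter Topology
open scoped ComplexConjugate NNReal BoundedContinuousFunction

/-! ### The standing wave: equation and integral identities. -/

section StandingWave

variable {ω p c γ κ : ℝ}

theorem continuous_solitonDeriv (hω : 0 < ω) (hp : 5 ≤ p) : Continuous (solitonDeriv ω p c) :=
  continuous_iff_continuousAt.mpr fun y => (hasDerivAt_solitonDeriv hω hp y).continuousAt

/-- The sign function with value `1` at `0`. -/
def side (x : ℝ) : ℝ := if 0 ≤ x then 1 else -1

theorem abs_side (x : ℝ) : |side x| = 1 := by
  unfold side
  split_ifs <;> simp

theorem measurable_side : Measurable side :=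
  Measurable.ite measurableSet_Ici measurable_const measurable_const

theorem isPrimitive_soliton_abs (hω : 0 < ω) (hp : 5 ≤ p) (c : ℝ) :
    IsPrimitive (fun x => (soliton ω p c |x| : ℂ))
      (fun x => ((side x * solitonDeriv ω p c |x| : ℝ) : ℂ)) := by
  have hm : Measurable fun x => ((side x * solitonDeriv ω p c |x| : ℝ) : ℂ) :=
    Complex.measurable_ofReal.comp (measurable_side.mul
      ((continuous_solitonDeriv hω hp).comp continuous_abs).measurable)
  have hL : LocallyIntegrable fun x => ((side x * solitonDeriv ω p c |x| : ℝ) : ℂ) := by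
    refine (memLp_of_norm_le_soliton (K := √ω) hω hp c continuous_abs sq_abs
      hm.aestronglyMeasurable fun y => ?_).locallyIntegrable (by norm_num)
    rw [Complex.norm_real, norm_mul, Real.norm_eq_abs, abs_side, one_mul]
    exact abs_solitonDeriv_le hω hp _
  have hc : Continuous fun x => (soliton ω p c |x| : ℂ) :=
    Complex.continuous_ofReal.comp ((continuous_soliton hω hp).comp continuous_abs)
  refine ⟨hL, fun x y => (integral_eq_of_hasDerivAt_off_countable _ _ (countable_singleton (0 : ℝ))
    hc.continuousOn (fun z hz => ?_) (LocallyIntegrable.intervalIntegrable' hL x y)).symm⟩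
  have hz0 : z ≠ 0 := hz.2
  have h := ((hasDerivAt_soliton (c := c) hω hp |z|).comp z (hasDerivAt_abs hz0)).ofReal_comp
  refine h.congr_deriv ?_
  rcases lt_or_gt_of_ne hz0 with h | h
  · simp [side, not_le.mpr h, h]
  · simp [side, h.le, h]

theorem memLp_soliton_abs (hω : 0 < ω) (hp : 5 ≤ p) (c : ℝ) :
    MemLp (fun x => (soliton ω p c |x| : ℂ)) 2 :=
  memLp_of_norm_le_soliton (K := 1) hω hp c continuous_abs sq_abs
    (Complex.continuous_ofReal.comp ((continuous_soliton hω hp).comp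
      continuous_abs)).aestronglyMeasurable fun y => by
    rw [Complex.norm_real, one_mul, Real.norm_of_nonneg (soliton_pos hω hp _).le]

theorem memLp_solitonDeriv_abs (hω : 0 < ω) (hp : 5 ≤ p) (c : ℝ) :
    MemLp (fun x => ((side x * solitonDeriv ω p c |x| : ℝ) : ℂ)) 2 := by
  refine memLp_of_norm_le_soliton (K := √ω) hω hp c continuous_abs sq_abs
    (Complex.measurable_ofReal.comp (measurable_side.mul
      ((continuous_solitonDeriv hω hp).comp continuous_abs).measurable)).aestronglyMeasurable
    fun y => ?_
  rw [Complex.norm_real, norm_mul, Real.norm_eq_abs, abs_side, one_mul]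
  exact abs_solitonDeriv_le hω hp _

/-- The profile `soliton |x|` as an element of `H¹(ℝ)`. -/
def solitonH1 (hω : 0 < ω) (hp : 5 ≤ p) (c : ℝ) : H1 :=
  H1.ofPrimitive (isPrimitive_soliton_abs hω hp c) (memLp_soliton_abs hω hp c)
    (memLp_solitonDeriv_abs hω hp c)

theorem rep_solitonH1 (hω : 0 < ω) (hp : 5 ≤ p) (c : ℝ) :
    (solitonH1 hω hp c).rep = fun x => (soliton ω p c |x| : ℂ) := H1.rep_ofPrimitive _ _ _

theorem dx_solitonH1_ae (hω : 0 < ω) (hp : 5 ≤ p) (c : ℝ) :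
    ((solitonH1 hω hp c).dx : ℝ → ℂ) =ᵐ[volume]
      fun x => ((side x * solitonDeriv ω p c |x| : ℝ) : ℂ) := H1.dx_ofPrimitive_ae _ _ _

theorem norm_rep_solitonH1 (hω : 0 < ω) (hp : 5 ≤ p) (c x : ℝ) :
    ‖(solitonH1 hω hp c).rep x‖ = soliton ω p c |x| := by
  rw [rep_solitonH1, Complex.norm_real, Real.norm_of_nonneg (soliton_pos hω hp _).le]

theorem integral_eq_add_Ioi {E : Type*} [NormedAddCommGroup E] [NormedSpace ℝ E]
    {f : ℝ → E} (hf : Integrable f) :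
    ∫ x, f x = (∫ x in Ioi 0, f x) + ∫ x in Ioi 0, f (-x) := by
  rw [integral_comp_neg_Ioi, neg_zero, add_comm,
    intervalIntegral.integral_Iic_add_Ioi hf.integrableOn hf.integrableOn]

theorem MemLp.integrable_mul_conj {f g : ℝ → ℂ} (hf : MemLp f 2) (hg : MemLp g 2) :
    Integrable fun x => f x * conj (g x) :=
  hf.integrable_mul hg.star

theorem integral_Ioi_solitonDeriv (hω : 0 < ω) (hp : 5 ≤ p) (c : ℝ) (w : H1) :
    ∫ x in Ioi 0, (solitonDeriv ω p c x : ℂ) * conj (w.dx x) =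
      -(solitonDeriv ω p c 0 : ℂ) * conj (w.rep 0) - ∫ x in Ioi 0,
        ((ω * soliton ω p c x - soliton ω p c x ^ p : ℝ) : ℂ) * conj (w.rep x) := by
  have hsc := continuous_soliton (c := c) hω hp
  have hdc := continuous_solitonDeriv (c := c) hω hp
  have hrc : Continuous fun x => ω * soliton ω p c x - soliton ω p c x ^ p :=
    (continuous_const.mul hsc).sub (hsc.rpow_const fun _ => Or.inr (by linarith))
  have hprim : IsPrimitive (fun x => (solitonDeriv ω p c x : ℂ))
      (fun x => ((ω * soliton ω p c x - soliton ω p c x ^ p : ℝ) : ℂ)) :=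
    isPrimitive_of_hasDerivAt (fun x => (hasDerivAt_solitonDeriv hω hp x).ofReal_comp)
      (Complex.continuous_ofReal.comp hrc)
  have m1 : MemLp (fun x => (solitonDeriv ω p c x : ℂ)) 2 :=
    memLp_of_norm_le_soliton (τ := id) hω hp c continuous_id (fun _ => rfl)
      (Complex.continuous_ofReal.comp hdc).aestronglyMeasurable fun y => by
      rw [Complex.norm_real]
      exact abs_solitonDeriv_le hω hp y
  have m2 : MemLp (fun x => ((ω * soliton ω p c x - soliton ω p c x ^ p : ℝ) : ℂ)) 2 :=
    memLp_of_norm_le_soliton (τ := id) hω hp c continuous_id (fun _ => rfl)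
      (Complex.continuous_ofReal.comp hrc).aestronglyMeasurable fun y => by
      rw [Complex.norm_real]
      exact abs_solitonDeriv_deriv_le hω hp y
  have i1 := MemLp.integrable_mul_conj m2 w.memLp_rep
  have i2 := MemLp.integrable_mul_conj m1 w.memLp_dx
  have hlim : Tendsto (fun x => (solitonDeriv ω p c x : ℂ) * conj (w.rep x)) atTop (𝓝 0) := by
    refine squeeze_zero_norm (a := fun x => √ω * solitonMax ω p * ‖w.rep x‖) (fun x => ?_) ?_
    · rw [norm_mul, Complex.norm_real, RCLike.norm_conj]
      gcongr
      refine (abs_solitonDeriv_le hω hp x).trans ?_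
      gcongr
      exact soliton_le_max hω hp x
    · simpa using w.tendsto_rep_atTop.norm.const_mul (√ω * solitonMax ω p)
  have h := (hprim.mul_conj w.isPrimitive_rep).integral_Ioi_eq 0 (i1.add i2).integrableOn hlim
  rw [integral_add i1.integrableOn i2.integrableOn] at h
  linear_combination h

theorem H1.power_toHm1_apply (hp : 5 ≤ p) (v w : H1) : (H1.power hp v).toHm1 w =
    ∫ x, ((‖v.rep x‖ ^ (p - 1) : ℝ) : ℂ) * v.rep x * conj (w.rep x) := by
  rw [H1.toHm1_apply, H1.rep_power]
  rfl

/-- Integrate by parts on each half-line, the left one after reflection. The boundary terms add up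
to `-2 φ'(0+)` times the conjugate of `w(0)`, and the jump condition `hc` makes this cancel the
delta term. -/
theorem solitonH1_equation (hω : 0 < ω) (hp : 5 ≤ p)
    (hc : solitonDeriv ω p c 0 = -(γ / 2) * soliton ω p c 0) (w : H1) :
    nlsForm γ p (solitonH1 hω hp c) w + ω * (solitonH1 hω hp c).toHm1 w = 0 := by
  set φ := solitonH1 hω hp c with hφ
  have e1 : ∫ x, φ.dx x * conj (w.dx x) =
      ∫ x, ((side x * solitonDeriv ω p c |x| : ℝ) : ℂ) * conj (w.dx x) := by
    refine integral_congr_ae ?_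
    filter_upwards [dx_solitonH1_ae hω hp c] with x hx
    rw [hφ, hx]
  have e2 : ∫ x, ((side x * solitonDeriv ω p c |x| : ℝ) : ℂ) * conj (w.dx x) =
      (∫ x in Ioi 0, (solitonDeriv ω p c x : ℂ) * conj (w.dx x)) +
      ∫ x in Ioi 0, (solitonDeriv ω p c x : ℂ) * conj ((H1.reflect w).dx x) := by
    rw [integral_eq_add_Ioi (MemLp.integrable_mul_conj (memLp_solitonDeriv_abs hω hp c) w.memLp_dx)]
    congr 1
    · refine setIntegral_congr_fun measurableSet_Ioi fun x (hx : 0 < x) => ?_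
      simp [side, hx.le, abs_of_pos hx]
    · refine setIntegral_congr_ae measurableSet_Ioi ?_
      filter_upwards [w.dx_reflect_ae] with x h (hx : 0 < x)
      rw [h]
      simp [side, not_le.mpr hx, abs_of_pos hx]
  have i1 : Integrable fun x => φ.rep x * conj (w.rep x) :=
    MemLp.integrable_mul_conj φ.memLp_rep w.memLp_rep
  have i2 : Integrable fun x => (H1.power hp φ).rep x * conj (w.rep x) :=
    MemLp.integrable_mul_conj (H1.power hp φ).memLp_rep w.memLp_rep
  have e3 : (fun x => ω * (φ.rep x * conj (w.rep x)) - (H1.power hp φ).rep x * conj (w.rep x)) =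
      fun x => ((ω * soliton ω p c |x| - soliton ω p c |x| ^ p : ℝ) : ℂ) * conj (w.rep x) := by
    funext x
    simp only [H1.rep_power, powerFun, norm_rep_solitonH1, hφ]
    rw [rep_solitonH1,
      rpow_eq_mul_of_pos (soliton_pos hω hp |x|) p]
    push_cast
    ring
  have e4 : ω * φ.toHm1 w - (H1.power hp φ).toHm1 w =
      (∫ x in Ioi 0, ((ω * soliton ω p c x - soliton ω p c x ^ p : ℝ) : ℂ) * conj (w.rep x)) +
      ∫ x in Ioi 0, ((ω * soliton ω p c x - soliton ω p c x ^ p : ℝ) : ℂ) *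
        conj ((H1.reflect w).rep x) := by
    rw [H1.toHm1_apply, H1.toHm1_apply, ← integral_const_mul, ← integral_sub (i1.const_mul _) i2,
      e3, integral_eq_add_Ioi (by rw [← e3]; exact (i1.const_mul _).sub i2)]
    congr 1
    · refine setIntegral_congr_fun measurableSet_Ioi fun x (hx : 0 < x) => ?_
      simp [abs_of_pos hx]
    · refine setIntegral_congr_fun measurableSet_Ioi fun x (hx : 0 < x) => ?_
      simp [abs_of_pos hx, H1.rep_reflect]
  have h1 := integral_Ioi_solitonDeriv hω hp c w
  have h2 := integral_Ioi_solitonDeriv hω hp c (H1.reflect w)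
  have e5 : (H1.reflect w).rep 0 = w.rep 0 := by rw [H1.rep_reflect]; simp
  have e6 : φ.rep 0 = (soliton ω p c 0 : ℂ) := by rw [hφ, rep_solitonH1]; simp
  rw [e5] at h2
  rw [nlsForm, ← H1.power_toHm1_apply hp, e1, e2, e6]
  rw [hc] at h1 h2
  push_cast at h1 h2
  push_cast at e4
  linear_combination h1 + h2 + e4

theorem solitonH1_ne_zero (hω : 0 < ω) (hp : 5 ≤ p) (c : ℝ) : solitonH1 hω hp c ≠ 0 := by
  intro h
  have h1 := norm_rep_solitonH1 hω hp c 0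
  rw [h, H1.rep_zero] at h1
  have := soliton_pos (c := c) hω hp |0|
  simp at h1
  simp at this
  linarith

theorem isStandingWave_solitonH1 (hω : 0 < ω) (hp : 5 ≤ p)
    (hc : solitonDeriv ω p c 0 = -(γ / 2) * soliton ω p c 0) :
    IsStandingWave γ ω p (solitonH1 hω hp c) :=
  ⟨solitonH1_ne_zero hω hp c, solitonH1_equation hω hp hc⟩

theorem IsStandingWave.nehari (hp : 5 ≤ p) (hκ : κ ^ 2 = -γ) {φ : H1}
    (h : IsStandingWave γ ω p φ) :
    ‖φ.dx‖ ^ 2 + κ ^ 2 * ‖φ.rep 0‖ ^ 2 + ω * ‖φ.toL2‖ ^ 2 = φ.potential p := by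
  have e := h.2 φ
  rw [nlsForm, ← H1.power_toHm1_apply hp] at e
  have e1 : ∫ x, φ.dx x * conj (φ.dx x) = ((‖φ.dx‖ ^ 2 : ℝ) : ℂ) := by
    rw [H1.norm_sq_dx, ← integral_complex_ofReal]
    refine integral_congr_ae (Eventually.of_forall fun x => ?_)
    simp only [Complex.mul_conj']
    push_cast; rfl
  have e2 : φ.toHm1 φ = ((‖φ.toL2‖ ^ 2 : ℝ) : ℂ) := by
    rw [H1.toHm1_apply, H1.norm_sq_toL2, ← integral_complex_ofReal]
    refine integral_congr_ae (Eventually.of_forall fun x => ?_)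
    simp only [Complex.mul_conj']
    push_cast; rfl
  have e3 : (H1.power hp φ).toHm1 φ = ((φ.potential p : ℝ) : ℂ) := by
    rw [H1.toHm1_apply, H1.potential, ← integral_complex_ofReal]
    refine integral_congr_ae (Eventually.of_forall fun x => ?_)
    simp only [H1.rep_power, powerFun]
    rw [mul_assoc, Complex.mul_conj', ← norm_rpow_mul_sq hp]
    push_cast; rfl
  rw [e1, e2, e3, Complex.mul_conj'] at e
  have e4 : ((‖φ.dx‖ ^ 2 - γ * ‖φ.rep 0‖ ^ 2 - φ.potential p + ω * ‖φ.toL2‖ ^ 2 : ℝ) : ℂ) = 0 := by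
    push_cast
    push_cast at e
    exact e
  rw [Complex.ofReal_eq_zero] at e4
  rw [hκ]
  linarith

theorem norm_sq_dx_solitonH1 (hω : 0 < ω) (hp : 5 ≤ p) (c : ℝ) : ‖(solitonH1 hω hp c).dx‖ ^ 2 =
    ω * ‖(solitonH1 hω hp c).toL2‖ ^ 2 - 2 / (p + 1) * (solitonH1 hω hp c).potential p := by
  have i1 := (solitonH1 hω hp c).integrable_sq_rep
  have i2 := H1.integrable_norm_rpow hp (solitonH1 hω hp c)
  rw [H1.norm_sq_dx, H1.norm_sq_toL2, H1.potential, ← integral_const_mul, ← integral_const_mul,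
    ← integral_sub (i1.const_mul _) (i2.const_mul _)]
  refine integral_congr_ae ?_
  filter_upwards [dx_solitonH1_ae hω hp c] with x hx
  rw [hx, norm_rep_solitonH1, Complex.norm_real, norm_mul, Real.norm_eq_abs, abs_side, one_mul,
    Real.norm_eq_abs, sq_abs, solitonDeriv_sq hω hp]

/-- Half the sum of the Nehari identity and of the integrated first integral; no differentiation
along dilations is needed. -/
theorem pohozaev_solitonH1 (hω : 0 < ω) (hp : 5 ≤ p) (hκ : κ ^ 2 = -γ)
    (hc : solitonDeriv ω p c 0 = -(γ / 2) * soliton ω p c 0) :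
    (solitonH1 hω hp c).pohozaev κ p = 0 := by
  have h1 := (isStandingWave_solitonH1 hω hp hc).nehari hp hκ
  have h2 := norm_sq_dx_solitonH1 hω hp c
  rw [H1.pohozaev]
  have : p + 1 ≠ 0 := by linarith
  field_simp at h2 ⊢
  linear_combination (p + 1) * h1 + h2

theorem reflect_solitonH1 (hω : 0 < ω) (hp : 5 ≤ p) (c : ℝ) :
    H1.reflect (solitonH1 hω hp c) = solitonH1 hω hp c :=
  H1.ext_rep (by rw [H1.rep_reflect, rep_solitonH1]; simp)

theorem integrable_sq_mul_solitonH1 (hω : 0 < ω) (hp : 5 ≤ p) (c : ℝ) :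
    Integrable fun x => x ^ 2 * ‖(solitonH1 hω hp c).rep x‖ ^ 2 := by
  have h := integrable_mul_soliton_sq hω hp c continuous_abs sq_abs
  have h2 := (solitonH1 hω hp c).integrable_sq_rep
  simp only [norm_rep_solitonH1] at h2 ⊢
  convert! h.sub h2 using 1
  funext x
  simp only [Pi.sub_apply]
  ring

/-- The condition `γ²/4 < ω` says exactly that `γ/(2√ω)` lies in `(-1, 1)`, where `tanh` inverts
`artanh`. -/
theorem solitonDeriv_zero (hω : 0 < ω) (h : γ ^ 2 / 4 < ω) :
    solitonDeriv ω p (Real.artanh (γ / (2 * √ω))) 0 =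
      -(γ / 2) * soliton ω p (Real.artanh (γ / (2 * √ω))) 0 := by
  have hs : 0 < √ω := Real.sqrt_pos.mpr hω
  have hmem : γ / (2 * √ω) ∈ Ioo (-1) 1 := by
    have : |γ| < 2 * √ω := by
      refine abs_lt_of_sq_lt_sq ?_ (by positivity)
      rw [mul_pow, Real.sq_sqrt hω.le]
      linarith
    rw [abs_lt] at this
    constructor
    · rw [lt_div_iff₀ (by positivity)]; linarith
    · rw [div_lt_iff₀ (by positivity)]; linarith
  rw [solitonDeriv, mul_zero, zero_add, ← Real.tanh_eq_sinh_div_cosh, Real.tanh_artanh hmem]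
  field_simp

end StandingWave

end DeltaNLS

namespace DeltaNLS

open MeasureTheory Set Filter Topology
open scoped ComplexConjugate NNReal BoundedContinuousFunction

/-! ### The calibration and the variational characterization among even functions. -/

section Calibration

variable {ω p c γ κ : ℝ}

/-- The derivative of the calibration. -/
def calibRate (ω p r : ℝ) : ℝ := √(ω - 2 / (p + 1) * r ^ ((p - 1) / 2))

/-- The calibration. -/
def calib (ω p r : ℝ) : ℝ := ∫ t in (0 : ℝ)..r, calibRate ω p t

theorem continuous_calibRate (hp : 5 ≤ p) : Continuous (calibRate ω p) :=
  (continuous_const.sub (continuous_const.mul (continuous_id.rpow_const fun _ =>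
    Or.inr (by linarith)))).sqrt

theorem calibRate_nonneg (ω p r : ℝ) : 0 ≤ calibRate ω p r := Real.sqrt_nonneg _

theorem hasDerivAt_calib (hp : 5 ≤ p) (r : ℝ) : HasDerivAt (calib ω p) (calibRate ω p r) r :=
  intervalIntegral.integral_hasDerivAt_right ((continuous_calibRate hp).intervalIntegrable _ _)
    ((continuous_calibRate hp).stronglyMeasurableAtFilter _ _) (continuous_calibRate hp).continuousAt

theorem contDiff_calib (hp : 5 ≤ p) : ContDiff ℝ 1 (calib ω p) := by
  rw [contDiff_one_iff_deriv]
  refine ⟨fun r => (hasDerivAt_calib hp r).differentiableAt, ?_⟩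
  rw [funext fun r => (hasDerivAt_calib (ω := ω) hp r).deriv]
  exact continuous_calibRate hp

theorem calib_zero (ω p : ℝ) : calib ω p 0 = 0 := intervalIntegral.integral_same

theorem antitoneOn_calibRate (ω : ℝ) (hp : 5 ≤ p) : AntitoneOn (calibRate ω p) (Ici 0) := by
  intro r hr s _ hrs
  have h0 : (0 : ℝ) ≤ r := hr
  have : 0 < p + 1 := by linarith
  refine Real.sqrt_le_sqrt ?_
  have := Real.rpow_le_rpow h0 hrs (by linarith : 0 ≤ (p - 1) / 2)
  have : 2 / (p + 1) * r ^ ((p - 1) / 2) ≤ 2 / (p + 1) * s ^ ((p - 1) / 2) := by gcongr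
  linarith

/-- The calibration has decreasing derivative on `[0, ∞)`, hence is concave there and lies below its
tangents. -/
theorem calib_sub_le (ω : ℝ) (hp : 5 ≤ p) {r s : ℝ} (hr : 0 ≤ r) (hs : 0 ≤ s) :
    calib ω p s - calib ω p r ≤ calibRate ω p r * (s - r) := by
  have hi := fun a b => (continuous_calibRate (ω := ω) hp).intervalIntegrable (μ := volume) a b
  rw [calib, calib, intervalIntegral.integral_interval_sub_left (hi _ _) (hi _ _)]
  rcases le_total r s with h | h
  · have := intervalIntegral.integral_mono_on h (hi r s)
      (intervalIntegrable_const (c := calibRate ω p r)) fun t ht =>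
        antitoneOn_calibRate ω hp hr (hr.trans ht.1) ht.1
    rw [intervalIntegral.integral_const, smul_eq_mul] at this
    linarith
  · have := intervalIntegral.integral_mono_on h
      (intervalIntegrable_const (c := calibRate ω p r)) (hi s r) fun t ht =>
        antitoneOn_calibRate ω hp (hs.trans ht.1) hr ht.2
    rw [intervalIntegral.integral_const, smul_eq_mul] at this
    rw [intervalIntegral.integral_symm]
    linarith

/-- Up to the maximal height of the soliton the radicand is nonnegative, so the truncation at zero
in the real square root is inactive. -/
theorem sq_mul_calibRate_sq (hω : 0 < ω) (hp : 5 ≤ p) {m : ℝ} (h0 : 0 ≤ m)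
    (hm : m ≤ solitonMax ω p) :
    m ^ 2 * calibRate ω p (m ^ 2) ^ 2 = ω * m ^ 2 - 2 / (p + 1) * m ^ (p + 1) := by
  have hp1 : 0 < p + 1 := by linarith
  have e1 : (m ^ 2) ^ ((p - 1) / 2) = m ^ (p - 1) := by
    rw [← Real.rpow_natCast, ← Real.rpow_mul h0]
    congr 1; push_cast; ring
  have e2 : m ^ (p - 1) ≤ (p + 1) * ω / 2 := by
    rw [← solitonMax_rpow hω hp]
    exact Real.rpow_le_rpow h0 hm (by linarith)
  have e3 : m ^ (p - 1) * m ^ 2 = m ^ (p + 1) := by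
    have := norm_rpow_mul_sq hp (m : ℂ)
    rwa [Complex.norm_real, Real.norm_of_nonneg h0] at this
  rw [calibRate, Real.sq_sqrt, e1, ← e3]
  · ring
  · rw [e1]
    have : 2 / (p + 1) * m ^ (p - 1) ≤ 2 / (p + 1) * ((p + 1) * ω / 2) := by gcongr
    have e : 2 / (p + 1) * ((p + 1) * ω / 2) = ω := by field_simp
    linarith

theorem IsPrimitive.calib (hp : 5 ≤ p) {f g : ℝ → ℝ} (h : IsPrimitive f g) :
    IsPrimitive (fun x => calib ω p (f x)) (fun x => calibRate ω p (f x) * g x) := by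
  convert! h.comp (contDiff_calib (ω := ω) hp) using 1
  funext x
  rw [(hasDerivAt_calib hp (f x)).hasFDerivAt.fderiv]
  simp [mul_comm]

theorem tendsto_calib_zero (hp : 5 ≤ p) {f : ℝ → ℝ} {F : Filter ℝ} (h : Tendsto f F (𝓝 0)) :
    Tendsto (fun x => calib ω p (f x)) F (𝓝 0) := by
  have := ((contDiff_calib (ω := ω) hp).continuous.tendsto 0).comp h
  rwa [calib_zero] at this

theorem norm_reflect_eq {v : H1} (hv : H1.reflect v = v) (x : ℝ) : ‖v.rep (-x)‖ = ‖v.rep x‖ := by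
  have := congrFun (H1.rep_reflect v) x
  rw [hv] at this
  rw [this]

theorem norm_dx_reflect_eq {v : H1} (hv : H1.reflect v = v) :
    ∀ᵐ x, ‖v.dx (-x)‖ = ‖v.dx x‖ := by
  filter_upwards [v.dx_reflect_ae] with x hx
  rw [hv] at hx
  rw [hx, norm_neg]

theorem integral_eq_two_mul_Ioi {f : ℝ → ℝ} (hf : Integrable f) (he : ∀ᵐ x, f (-x) = f x) :
    ∫ x, f x = 2 * ∫ x in Ioi 0, f x := by
  rw [integral_eq_add_Ioi hf, setIntegral_congr_ae measurableSet_Ioi (he.mono fun x hx _ => hx)]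
  ring

/-- By the arithmetic-geometric inequality the integrand dominates `l` times the absolute derivative
of `calib(|v|²)`. On the half-line `|v|²` passes from `|v(0)|²` to the maximal value `M²` at `y` and
then to `0`, so the variation of `calib(|v|²)` is at least `2 calib(M²) - calib(|v(0)|²)`. -/
theorem calibration_Ioi (hω : 0 < ω) (hp : 5 ≤ p) {v : H1} (hm : ∀ x, ‖v.rep x‖ ≤ solitonMax ω p)
    {y : ℝ} (hy : 0 ≤ y) (hvy : ‖v.rep y‖ = solitonMax ω p) {l : ℝ} (hl : 0 < l) :
    l * (2 * calib ω p (solitonMax ω p ^ 2) - calib ω p (‖v.rep 0‖ ^ 2)) ≤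
      ∫ x in Ioi 0, (l ^ 2 * ‖v.dx x‖ ^ 2 +
        (ω * ‖v.rep x‖ ^ 2 - 2 / (p + 1) * ‖v.rep x‖ ^ (p + 1))) := by
  have hprim := v.isPrimitive_norm_sq.calib (ω := ω) hp
  set G : ℝ → ℝ := fun x => calibRate ω p (‖v.rep x‖ ^ 2) * (2 * inner ℝ (v.rep x) (v.dx x)) with hG
  set e : ℝ → ℝ := fun x => l ^ 2 * ‖v.dx x‖ ^ 2 +
    (ω * ‖v.rep x‖ ^ 2 - 2 / (p + 1) * ‖v.rep x‖ ^ (p + 1)) with he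
  have hei : Integrable e := (v.integrable_sq_dx.const_mul _).add
    ((v.integrable_sq_rep.const_mul _).sub ((H1.integrable_norm_rpow hp v).const_mul _))
  have hGe : ∀ x, l * |G x| ≤ e x := by
    intro x
    have h1 := sq_mul_calibRate_sq hω hp (norm_nonneg (v.rep x)) (hm x)
    have h2 : |G x| ≤ calibRate ω p (‖v.rep x‖ ^ 2) * (2 * (‖v.rep x‖ * ‖v.dx x‖)) := by
      rw [hG, abs_mul, abs_of_nonneg (calibRate_nonneg _ _ _), abs_mul, abs_two]
      have := calibRate_nonneg ω p (‖v.rep x‖ ^ 2)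
      gcongr
      exact abs_real_inner_le_norm _ _
    rw [he]
    simp only
    rw [← h1]
    nlinarith [mul_le_mul_of_nonneg_left h2 hl.le,
      sq_nonneg (l * ‖v.dx x‖ - ‖v.rep x‖ * calibRate ω p (‖v.rep x‖ ^ 2))]
  have hGi : Integrable G := by
    refine (hei.const_mul l⁻¹).mono' hprim.locInt.aestronglyMeasurable
      (Eventually.of_forall fun x => ?_)
    rw [Real.norm_eq_abs, inv_mul_eq_div, le_div_iff₀ hl, mul_comm]
    exact hGe x
  have h1 := hprim.sub_eq 0 y
  have h2 := hprim.integral_Ioi_eq y hGi.integrableOn (tendsto_calib_zero hp v.tendsto_norm_sq_atTop)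
  rw [hvy] at h1 h2
  have h3 : l * ∫ x in (0 : ℝ)..y, G x ≤ ∫ x in (0 : ℝ)..y, e x := by
    rw [← intervalIntegral.integral_const_mul]
    refine intervalIntegral.integral_mono_on hy (hGi.const_mul l).intervalIntegrable
      hei.intervalIntegrable fun x _ => ?_
    exact (mul_le_mul_of_nonneg_left (le_abs_self _) hl.le).trans (hGe x)
  have h4 : -(l * ∫ x in Ioi y, G x) ≤ ∫ x in Ioi y, e x := by
    rw [← integral_const_mul, ← integral_neg]
    refine setIntegral_mono (hGi.const_mul l).neg.integrableOn hei.integrableOn fun x => ?_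
    have := (mul_le_mul_of_nonneg_left (neg_le_abs (G x)) hl.le).trans (hGe x)
    linarith
  have h5 := intervalIntegral.integral_interval_add_Ioi (μ := volume) (f := e) (a := 0) (b := y)
    hei.integrableOn hei.integrableOn
  rw [← h5]
  rw [← h1] at h3
  rw [h2] at h4
  linarith

/-- Evenness lets both half-lines reach the maximum and doubles the previous bound. The tangent of
the concave calibration at `r`, of slope `κ²/2`, trades the unknown `calib(|v(0)|²)` for the delta
term. The parameter `l` comes from the dilation `√l v(l x)`, which multiplies the gradient term by
`l²` and the delta term by `l`. -/
theorem calibration (hω : 0 < ω) (hp : 5 ≤ p) {v : H1} (hv : H1.reflect v = v)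
    (hm : ∀ x, ‖v.rep x‖ ≤ solitonMax ω p) {y : ℝ} (hvy : ‖v.rep y‖ = solitonMax ω p)
    {l : ℝ} (hl : 0 < l) {r : ℝ} (hr : 0 ≤ r) (hκ : 2 * calibRate ω p r = κ ^ 2) :
    l * (2 * (2 * calib ω p (solitonMax ω p ^ 2) - calib ω p r) + κ ^ 2 * r) +
      2 / (p + 1) * v.potential p ≤
      l ^ 2 * ‖v.dx‖ ^ 2 + l * κ ^ 2 * ‖v.rep 0‖ ^ 2 + ω * ‖v.toL2‖ ^ 2 := by
  have hy : ‖v.rep |y|‖ = solitonMax ω p := by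
    rcases abs_choice y with h | h
    · rw [h, hvy]
    · rw [h, norm_reflect_eq hv, hvy]
  have h1 := calibration_Ioi hω hp hm (abs_nonneg y) hy hl
  have i1 := v.integrable_sq_dx.const_mul (l ^ 2)
  have i2 := v.integrable_sq_rep.const_mul ω
  have i3 := (H1.integrable_norm_rpow hp v).const_mul (2 / (p + 1))
  have i23 : Integrable fun x => ω * ‖v.rep x‖ ^ 2 - 2 / (p + 1) * ‖v.rep x‖ ^ (p + 1) :=
    i2.sub i3
  have i123 : Integrable fun x => l ^ 2 * ‖v.dx x‖ ^ 2 +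
      (ω * ‖v.rep x‖ ^ 2 - 2 / (p + 1) * ‖v.rep x‖ ^ (p + 1)) := i1.add i23
  have h2 : ∫ x, (l ^ 2 * ‖v.dx x‖ ^ 2 +
      (ω * ‖v.rep x‖ ^ 2 - 2 / (p + 1) * ‖v.rep x‖ ^ (p + 1))) =
      l ^ 2 * ‖v.dx‖ ^ 2 + (ω * ‖v.toL2‖ ^ 2 - 2 / (p + 1) * v.potential p) := by
    rw [integral_add i1 i23, integral_sub i2 i3, integral_const_mul, integral_const_mul,
      integral_const_mul, ← H1.norm_sq_dx, ← H1.norm_sq_toL2, H1.potential]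
  rw [integral_eq_two_mul_Ioi i123] at h2
  · have h3 := calib_sub_le ω hp hr (by positivity : 0 ≤ ‖v.rep 0‖ ^ 2)
    have h4 : 2 * (calib ω p (‖v.rep 0‖ ^ 2) - calib ω p r) ≤ κ ^ 2 * (‖v.rep 0‖ ^ 2 - r) := by
      rw [← hκ]; linarith
    nlinarith [mul_le_mul_of_nonneg_left h4 hl.le]
  · filter_upwards [norm_dx_reflect_eq hv] with x hx
    rw [hx, norm_reflect_eq hv]

theorem calibRate_soliton_sq (hω : 0 < ω) (hp : 5 ≤ p) (y : ℝ) :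
    soliton ω p c y * calibRate ω p (soliton ω p c y ^ 2) = |solitonDeriv ω p c y| := by
  have hs := soliton_pos (c := c) hω hp y
  rw [← sq_eq_sq₀ (mul_nonneg hs.le (calibRate_nonneg _ _ _)) (abs_nonneg _), mul_pow, sq_abs,
    sq_mul_calibRate_sq hω hp hs.le (soliton_le_max hω hp y), solitonDeriv_sq hω hp]

theorem two_mul_calibRate_soliton (hω : 0 < ω) (hp : 5 ≤ p) (hγ : γ ≤ 0) (hκ : κ ^ 2 = -γ)
    (hc : solitonDeriv ω p c 0 = -(γ / 2) * soliton ω p c 0) :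
    2 * calibRate ω p (soliton ω p c 0 ^ 2) = κ ^ 2 := by
  have hs := soliton_pos (c := c) hω hp 0
  have h := calibRate_soliton_sq (c := c) hω hp 0
  rw [hc, abs_mul, abs_of_nonneg (by linarith : 0 ≤ -(γ / 2)), abs_of_pos hs, mul_comm] at h
  rw [mul_right_cancel₀ hs.ne' h, hκ]
  ring

/-- Equality in the calibration. For `c ≤ 0` the profile rises on `[0, y]`, `y = -c/k`, to its
maximum and decreases afterwards, while the derivative of `calib(φ²)` is `2 |φ'| φ'`; its increments
on both pieces are integrals of `± 2 φ'²`. -/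
theorem calib_soliton (hω : 0 < ω) (hp : 5 ≤ p) (hc : c ≤ 0) :
    ‖(solitonH1 hω hp c).dx‖ ^ 2 =
      2 * calib ω p (solitonMax ω p ^ 2) - calib ω p (soliton ω p c 0 ^ 2) := by
  have hk : 0 < (p - 1) * √ω / 2 := by
    have := Real.sqrt_pos.mpr hω
    have : 0 < p - 1 := by linarith
    positivity
  set k := (p - 1) * √ω / 2 with hkd
  set y := -c / k with hy
  have hy0 : 0 ≤ y := div_nonneg (by linarith) hk.le
  have hky : k * y + c = 0 := by rw [hy]; field_simp; ring
  have hsy : soliton ω p c y = solitonMax ω p := by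
    rw [soliton, ← hkd, hky, solitonMax]; simp
  have hdc := continuous_solitonDeriv (c := c) hω hp
  have hprim : IsPrimitive (fun x => calib ω p (soliton ω p c x ^ 2))
      (fun x => 2 * |solitonDeriv ω p c x| * solitonDeriv ω p c x) := by
    refine isPrimitive_of_hasDerivAt (fun x => ?_) (by fun_prop)
    refine ((hasDerivAt_calib hp _).comp x ((hasDerivAt_soliton hω hp x).pow 2)).congr_deriv ?_
    rw [← calibRate_soliton_sq hω hp]
    simp
    ring
  have hsq : ∀ x, (2 * |solitonDeriv ω p c x| * solitonDeriv ω p c x = 2 * solitonDeriv ω p c x ^ 2 ∧ x ≤ y) ∨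
      (2 * |solitonDeriv ω p c x| * solitonDeriv ω p c x = -(2 * solitonDeriv ω p c x ^ 2) ∧ y ≤ x) := by
    intro x
    have hs := soliton_pos (c := c) hω hp x
    have hch := Real.cosh_pos (k * x + c)
    have hsω := Real.sqrt_pos.mpr hω
    rcases le_total x y with h | h
    · left
      have h1 : k * x + c ≤ 0 := by
        rw [← hky]; gcongr
      have h2 : 0 ≤ solitonDeriv ω p c x := by
        rw [solitonDeriv, ← hkd]
        have := Real.sinh_nonpos_iff.mpr h1
        exact mul_nonneg (mul_nonneg_of_nonpos_of_nonpos (by linarith)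
          (div_nonpos_of_nonpos_of_nonneg this hch.le)) hs.le
      rw [abs_of_nonneg h2]
      exact ⟨by ring, h⟩
    · right
      have h1 : 0 ≤ k * x + c := by
        rw [← hky]; gcongr
      have h2 : solitonDeriv ω p c x ≤ 0 := by
        rw [solitonDeriv, ← hkd]
        have := Real.sinh_nonneg_iff.mpr h1
        exact mul_nonpos_of_nonpos_of_nonneg (mul_nonpos_of_nonpos_of_nonneg (by linarith)
          (div_nonneg this hch.le)) hs.le
      rw [abs_of_nonpos h2]
      exact ⟨by ring, h⟩
  have hi : Integrable fun x => solitonDeriv ω p c x ^ 2 := by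
    have hm : MemLp (fun x => (solitonDeriv ω p c x : ℂ)) 2 :=
      memLp_of_norm_le_soliton (τ := id) hω hp c continuous_id (fun _ => rfl)
        (Complex.continuous_ofReal.comp hdc).aestronglyMeasurable fun y => by
        rw [Complex.norm_real]
        exact abs_solitonDeriv_le hω hp y
    have := hm.integrable_norm_pow (by norm_num)
    simpa using this
  have hA : ‖(solitonH1 hω hp c).dx‖ ^ 2 = 2 * ∫ x in Ioi 0, solitonDeriv ω p c x ^ 2 := by
    rw [H1.norm_sq_dx, ← integral_comp_abs (f := fun x => solitonDeriv ω p c x ^ 2)]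
    refine integral_congr_ae ?_
    filter_upwards [dx_solitonH1_ae hω hp c] with x hx
    rw [hx, Complex.norm_real, norm_mul, Real.norm_eq_abs, abs_side, one_mul, Real.norm_eq_abs,
      sq_abs]
  have hlim : Tendsto (fun x => soliton ω p c x ^ 2) atTop (𝓝 0) := by
    refine (solitonH1 hω hp c).tendsto_norm_sq_atTop.congr' ?_
    filter_upwards [eventually_ge_atTop 0] with x hx
    rw [norm_rep_solitonH1, abs_of_nonneg hx]
  have e1 : ∫ x in (0 : ℝ)..y, 2 * |solitonDeriv ω p c x| * solitonDeriv ω p c x =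
      ∫ x in (0 : ℝ)..y, 2 * solitonDeriv ω p c x ^ 2 := by
    refine intervalIntegral.integral_congr fun x hx => ?_
    rw [uIcc_of_le hy0] at hx
    rcases hsq x with h | h
    · exact h.1
    · have : x = y := le_antisymm hx.2 h.2
      rcases hsq y with h' | h'
      · rw [this]; exact h'.1
      · have h0 : solitonDeriv ω p c y = 0 := by rw [solitonDeriv, ← hkd, hky]; simp
        simp only [this, h0]; simp
  have e2 : ∫ x in Ioi y, 2 * |solitonDeriv ω p c x| * solitonDeriv ω p c x =
      ∫ x in Ioi y, -(2 * solitonDeriv ω p c x ^ 2) := by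
    refine setIntegral_congr_fun measurableSet_Ioi fun x (hx : y < x) => ?_
    rcases hsq x with h | h
    · exact absurd h.2 (not_le.mpr hx)
    · exact h.1
  have hGi : IntegrableOn (fun x => 2 * |solitonDeriv ω p c x| * solitonDeriv ω p c x) (Ioi y) := by
    refine ((hi.const_mul 2).neg.integrableOn (s := Ioi y)).congr_fun (fun x (hx : y < x) => ?_) measurableSet_Ioi
    rcases hsq x with h | h
    · exact absurd h.2 (not_le.mpr hx)
    · exact h.1.symm
  have h1 := hprim.sub_eq 0 y
  have h2 := hprim.integral_Ioi_eq y hGi (tendsto_calib_zero hp hlim)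
  rw [e1, intervalIntegral.integral_const_mul] at h1
  rw [e2, integral_neg, integral_const_mul] at h2
  have h5 := intervalIntegral.integral_interval_add_Ioi (μ := volume)
    (f := fun x => solitonDeriv ω p c x ^ 2) (a := 0) (b := y) hi.integrableOn hi.integrableOn
  rw [hA, ← h5]
  rw [hsy] at h1 h2
  linarith

theorem calibration_potential (hω : 0 < ω) (hp : 5 ≤ p) (hκ : κ ^ 2 = -γ) (hc0 : c ≤ 0)
    (hc : solitonDeriv ω p c 0 = -(γ / 2) * soliton ω p c 0) :
    2 * (2 * calib ω p (solitonMax ω p ^ 2) - calib ω p (soliton ω p c 0 ^ 2)) +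
      κ ^ 2 * soliton ω p c 0 ^ 2 = (p - 1) / (p + 1) * (solitonH1 hω hp c).potential p := by
  have h1 := (isStandingWave_solitonH1 hω hp hc).nehari hp hκ
  have h2 := norm_sq_dx_solitonH1 hω hp c
  have h3 := norm_rep_solitonH1 hω hp c 0
  rw [abs_zero] at h3
  rw [h3] at h1
  rw [← calib_soliton hω hp hc0]
  have : p + 1 ≠ 0 := by linarith
  field_simp at h2 ⊢
  linear_combination (p + 1) * h1 + h2

theorem H1.exists_max (v : H1) : ∃ y, ∀ x, ‖v.rep x‖ ≤ ‖v.rep y‖ := by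
  by_cases h : ∃ x₀, v.rep x₀ ≠ 0
  · obtain ⟨x₀, h0⟩ := h
    refine v.continuous_rep.norm.exists_forall_ge' x₀ ?_
    have hpos : 0 < ‖v.rep x₀‖ := norm_pos_iff.mpr h0
    rw [cocompact_eq_atBot_atTop, eventually_sup]
    have h1 := v.tendsto_rep_atBot.norm
    have h2 := v.tendsto_rep_atTop.norm
    rw [norm_zero] at h1 h2
    exact ⟨(h1.eventually (gt_mem_nhds hpos)).mono fun _ h => h.le,
      (h2.eventually (gt_mem_nhds hpos)).mono fun _ h => h.le⟩
  · push Not at h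
    exact ⟨0, fun x => by rw [h x, h 0]⟩

theorem H1.potential_smul (p : ℝ) (v : H1) {μ : ℝ} (hμ : 0 ≤ μ) :
    ((μ : ℂ) • v).potential p = μ ^ (p + 1) * v.potential p := by
  rw [H1.potential, H1.potential, ← integral_const_mul]
  congr 1
  funext x
  rw [H1.rep_smul, Pi.smul_apply, norm_smul, Complex.norm_real, Real.norm_of_nonneg hμ,
    Real.mul_rpow hμ (norm_nonneg _)]

theorem weighted_am_gm (hp : 5 ≤ p) {y : ℝ} (hy : 0 < y) :
    1 ≤ 2 / (p + 1) * y ^ (-((p - 1) / 2)) + (p - 1) / (p + 1) * y := by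
  have hp1 : 0 < p + 1 := by linarith
  have h := Real.geom_mean_le_arith_mean2_weighted (w₁ := 2 / (p + 1)) (w₂ := (p - 1) / (p + 1))
    (p₁ := y ^ (-((p - 1) / 2))) (p₂ := y) (by positivity) (div_nonneg (by linarith) hp1.le)
    (by positivity) hy.le (by field_simp; ring)
  rw [← Real.rpow_mul hy.le, ← Real.rpow_add hy] at h
  have e : -((p - 1) / 2) * (2 / (p + 1)) + (p - 1) / (p + 1) = 0 := by field_simp; ring
  rwa [e, Real.rpow_zero] at h

theorem H1.potential_nonneg (p : ℝ) (v : H1) : 0 ≤ v.potential p :=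
  integral_nonneg fun x => by positivity

/-- The variational characterization of the standing wave among even functions. -/
theorem potential_solitonH1_le (hω : 0 < ω) (hp : 5 ≤ p) (hγ : γ ≤ 0) (hκ : κ ^ 2 = -γ)
    (hc0 : c ≤ 0) (hc : solitonDeriv ω p c 0 = -(γ / 2) * soliton ω p c 0) {v : H1}
    (hv : H1.reflect v = v) (hv0 : v ≠ 0) {l : ℝ} (hl : 0 < l)
    (hN : l ^ ((p - 1) / 2) * v.potential p = (solitonH1 hω hp c).potential p) :
    (solitonH1 hω hp c).potential p ≤
      l ^ 2 * ‖v.dx‖ ^ 2 + l * κ ^ 2 * ‖v.rep 0‖ ^ 2 + ω * ‖v.toL2‖ ^ 2 := by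
  have hM := solitonMax_pos hω hp
  set N := (solitonH1 hω hp c).potential p with hNd
  have hN0 : 0 ≤ N := H1.potential_nonneg _ _
  obtain ⟨y, hy⟩ := v.exists_max
  have hm : 0 < ‖v.rep y‖ := by
    refine lt_of_le_of_ne (norm_nonneg _) fun h => hv0 (H1.ext_rep ?_)
    rw [H1.rep_zero]
    funext x
    exact norm_le_zero_iff.mp ((hy x).trans h.symm.le)
  set m := ‖v.rep y‖ with hmd
  set M := solitonMax ω p with hMd
  -- `θ v` has the same maximum as the maximal height of the soliton, as the calibration requires.
  set θ := M / m with hθ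
  have hθ0 : 0 < θ := by positivity
  have hrep : ∀ x, ‖((θ : ℂ) • v).rep x‖ = θ * ‖v.rep x‖ := fun x => by
    rw [H1.rep_smul, Pi.smul_apply, norm_smul, Complex.norm_real, Real.norm_of_nonneg hθ0.le]
  have hθm : θ * m = M := by rw [hθ]; field_simp
  have key := calibration (v := (θ : ℂ) • v) hω hp (by rw [map_smul, hv])
    (fun x => by rw [hrep, ← hMd, ← hθm]; gcongr; exact hy x) (y := y) (by rw [hrep, ← hmd, hθm]) hl
    (sq_nonneg (soliton ω p c 0)) (two_mul_calibRate_soliton hω hp hγ hκ hc)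
  rw [calibration_potential hω hp hκ hc0 hc, H1.potential_smul p v hθ0.le, hrep, map_smul, map_smul,
    norm_smul, norm_smul, Complex.norm_real, Real.norm_of_nonneg hθ0.le, ← hNd] at key
  -- With this `z`, `z^(-(p-1)/2) N = θ^(p-1) N(v)` and `z θ² = l`, so the weighted mean inequality
  -- at `z` recombines the two terms on the left of `key` into at least `θ² N`; dividing by `θ²`
  -- undoes the rescaling.
  set z := l / θ ^ 2 with hz
  have hz0 : 0 < z := by positivity
  have am := weighted_am_gm hp hz0
  have e1 : z ^ (-((p - 1) / 2)) * N = θ ^ (p - 1) * v.potential p := by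
    rw [← hN, hz, Real.rpow_neg (by positivity), Real.div_rpow hl.le (by positivity),
      ← Real.rpow_natCast, ← Real.rpow_mul hθ0.le]
    have : (2 : ℕ) * ((p - 1) / 2) = p - 1 := by push_cast; ring
    rw [this]
    have : l ^ ((p - 1) / 2) ≠ 0 := by positivity
    have : θ ^ (p - 1) ≠ 0 := by positivity
    field_simp
  have e2 : θ ^ (p + 1) = θ ^ (p - 1) * θ ^ 2 := by
    rw [← Real.rpow_natCast, ← Real.rpow_add hθ0]
    congr 1; push_cast; ring
  rw [e2] at key
  have e3 : z * θ ^ 2 = l := by rw [hz]; field_simp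
  have am2 := mul_le_mul_of_nonneg_right am hN0
  have am3 := mul_le_mul_of_nonneg_right am2 (sq_nonneg θ)
  have e4 : (2 / (p + 1) * z ^ (-((p - 1) / 2)) + (p - 1) / (p + 1) * z) * N * θ ^ 2 =
      l * ((p - 1) / (p + 1) * N) + 2 / (p + 1) * (θ ^ (p - 1) * θ ^ 2 * v.potential p) := by
    rw [← e3]
    linear_combination 2 / (p + 1) * θ ^ 2 * e1
  rw [e4, one_mul] at am3
  have h := am3.trans key
  have e5 : l ^ 2 * (θ * ‖v.dx‖) ^ 2 + l * κ ^ 2 * (θ * ‖v.rep 0‖) ^ 2 + ω * (θ * ‖v.toL2‖) ^ 2 =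
      (l ^ 2 * ‖v.dx‖ ^ 2 + l * κ ^ 2 * ‖v.rep 0‖ ^ 2 + ω * ‖v.toL2‖ ^ 2) * θ ^ 2 := by ring
  rw [e5] at h
  exact le_of_mul_le_mul_right h (by positivity)

/-- The action functional. -/
def H1.action (κ ω p : ℝ) (v : H1) : ℝ := v.energy κ p + ω / 2 * ‖v.toL2‖ ^ 2

theorem H1.potential_pos (hp : 5 ≤ p) {v : H1} (hv : v ≠ 0) : 0 < v.potential p := by
  refine lt_of_le_of_ne (v.potential_nonneg p) fun h => hv (H1.ext_rep ?_)
  have hcont : Continuous fun x => ‖v.rep x‖ ^ (p + 1) :=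
    v.continuous_rep.norm.rpow_const fun _ => Or.inr (by linarith)
  have h1 := (integral_eq_zero_iff_of_nonneg (fun x => by positivity)
    (H1.integrable_norm_rpow hp v)).mp h.symm
  have h2 := (Continuous.ae_eq_iff_eq volume hcont continuous_zero).mp h1
  rw [H1.rep_zero]
  funext x
  have h3 : ‖v.rep x‖ ^ (p + 1) = 0 := congrFun h2 x
  rw [Real.rpow_eq_zero (norm_nonneg _) (by linarith)] at h3
  exact norm_eq_zero.mp h3

/-- Let `v_l(x) = √l v(l x)` have the same potential as the soliton, so that `S(φ) ≤ S(v_l)` by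
`potential_solitonH1_le`. The combination `S(v_l) - l² P(v)/2` is at most its value at `l = 1`: the
delta terms differ by `κ² |v(0)|² (1 - l)²/4`, and the potential terms compare by Bernoulli's
inequality. Finally `l² P(v)/2 ≤ 0`. -/
theorem action_solitonH1_le (hω : 0 < ω) (hp : 5 ≤ p) (hγ : γ ≤ 0) (hκ : κ ^ 2 = -γ)
    (hc0 : c ≤ 0) (hc : solitonDeriv ω p c 0 = -(γ / 2) * soliton ω p c 0) {v : H1}
    (hv : H1.reflect v = v) (hv0 : v ≠ 0) (hP : v.pohozaev κ p ≤ 0) :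
    (solitonH1 hω hp c).action κ ω p ≤ v.action κ ω p - v.pohozaev κ p / 2 := by
  have hp1 : 0 < p + 1 := by linarith
  have hne := (isStandingWave_solitonH1 hω hp hc).nehari hp hκ
  set N₀ := (solitonH1 hω hp c).potential p with hN₀
  have hN₀pos : 0 < N₀ := H1.potential_pos hp (solitonH1_ne_zero hω hp c)
  have hNpos := H1.potential_pos hp hv0
  set l := (N₀ / v.potential p) ^ (2 / (p - 1)) with hl
  have hl0 : 0 < l := by positivity
  have hlN : l ^ ((p - 1) / 2) * v.potential p = N₀ := by
    rw [hl, ← Real.rpow_mul (by positivity)]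
    have : 2 / (p - 1) * ((p - 1) / 2) = 1 := by
      have : p - 1 ≠ 0 := by linarith
      field_simp
    rw [this, Real.rpow_one]
    field_simp
  have key := potential_solitonH1_le hω hp hγ hκ hc0 hc hv hv0 hl0 hlN
  -- `l^((p-1)/2)` is a power of `l²` with exponent `(p-1)/4`, which is at least one exactly when `p
  -- ≥ 5`.
  have bern := one_add_mul_self_le_rpow_one_add (s := l ^ 2 - 1) (p := (p - 1) / 4)
    (by nlinarith) (by linarith)
  have e1 : (1 + (l ^ 2 - 1)) ^ ((p - 1) / 4) = l ^ ((p - 1) / 2) := by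
    rw [add_sub_cancel, ← Real.rpow_natCast, ← Real.rpow_mul hl0.le]
    congr 1; push_cast; ring
  rw [e1] at bern
  have bern2 := mul_le_mul_of_nonneg_right bern hNpos.le
  rw [hlN] at bern2
  rw [H1.pohozaev] at hP
  rw [H1.action, H1.action, H1.energy, H1.energy, H1.pohozaev, ← hN₀]
  set A := ‖v.dx‖ ^ 2
  set B := ‖v.rep 0‖ ^ 2
  set M := ‖v.toL2‖ ^ 2
  set N := v.potential p
  set A₀ := ‖(solitonH1 hω hp c).dx‖ ^ 2
  set B₀ := ‖(solitonH1 hω hp c).rep 0‖ ^ 2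
  set M₀ := ‖(solitonH1 hω hp c).toL2‖ ^ 2
  have hB : 0 ≤ κ ^ 2 * B * (1 - l) ^ 2 := by positivity
  have hA := mul_le_mul_of_nonneg_left hP (sq_nonneg l)
  have q1 : (p - 1) / (2 * (p + 1)) * N = N / 2 - N / (p + 1) := by field_simp; ring
  have q2 : (A₀ + κ ^ 2 * B₀) / 2 - N₀ / (p + 1) + ω / 2 * M₀ = N₀ / 2 - N₀ / (p + 1) := by
    linarith
  rw [q2]
  rw [q1] at hA ⊢
  have q3 : N₀ / (p + 1) ≥ ((p - 1) / 4 * (l ^ 2 - 1) + 1) * N / (p + 1) := by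
    gcongr
    linarith
  have q4 : ((p - 1) / 4 * (l ^ 2 - 1) + 1) * N / (p + 1) =
      l ^ 2 / 2 * (N / 2 - N / (p + 1)) - (N / 2 - N / (p + 1)) / 2 + N / (p + 1) := by
    field_simp; ring
  nlinarith

end Calibration

end DeltaNLS

namespace DeltaNLS

open MeasureTheory Set Filter Topology
open scoped ComplexConjugate NNReal BoundedContinuousFunction

/-! ### Invariance of the blow-up region and strong instability. -/

section Instability

variable {ω p c γ κ T : ℝ} {u : ℝ → H1}

theorem H1.reflect_reflect (v : H1) : H1.reflect (H1.reflect v) = v :=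
  H1.ext_rep (by simp only [H1.rep_reflect, neg_neg])

theorem H1.inner_reflect_left (v w : H1) :
    inner ℂ (H1.reflect v) w = inner ℂ v (H1.reflect w) := by
  conv_lhs => rw [← H1.reflect_reflect w]
  exact H1.reflect.inner_map_map _ _

theorem inner_toL2_reflect_left (v w : H1) :
    inner ℂ (H1.reflect v).toL2 w.toL2 = inner ℂ v.toL2 (H1.reflect w).toL2 := by
  change w.toHm1 (H1.reflect v) = (H1.reflect w).toHm1 v
  rw [H1.toHm1_apply, H1.toHm1_apply, H1.rep_reflect, H1.rep_reflect,
    ← integral_neg_eq_self (fun x => w.rep x * conj (v.rep (-x)))]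
  simp only [neg_neg]

/-- The reflection on the energy space. -/
def energyReflect (κ : ℝ) : EnergySpace κ →L[ℂ] EnergySpace κ :=
  (toEnergy κ).toContinuousLinearMap.comp
    (H1.reflect.toContinuousLinearMap.comp (toEnergy κ).symm.toContinuousLinearMap)

theorem energyReflect_toEnergy (v : H1) :
    energyReflect κ (toEnergy κ v) = toEnergy κ (H1.reflect v) := by
  simp [energyReflect]

theorem energyReflect_resolvent (z : EnergySpace κ) :
    energyReflect κ (resolvent κ z) = resolvent κ (energyReflect κ z) := by
  obtain ⟨w, rfl⟩ := (toEnergy κ).surjective z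
  obtain ⟨y, hy⟩ := (toEnergy κ).surjective (resolvent κ (toEnergy κ w))
  refine ext_inner_left ℂ fun x => ?_
  obtain ⟨v, rfl⟩ := (toEnergy κ).surjective x
  rw [energyReflect_toEnergy, inner_toEnergy_resolvent, ← inner_toL2_reflect_left,
    ← inner_toEnergy_resolvent (κ := κ), ← hy, energyReflect_toEnergy, inner_toEnergy,
    inner_toEnergy, H1.inner_reflect_left, H1.rep_reflect, H1.rep_reflect]
  simp

theorem H1.power_reflect (hp : 5 ≤ p) (v : H1) :
    H1.power hp (H1.reflect v) = H1.reflect (H1.power hp v) :=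
  H1.ext_rep (by simp only [H1.rep_power, H1.rep_reflect])

theorem EvolvesOn.reflect (hp : 5 ≤ p)
    (h : EvolvesOn (resolvent κ) (energyPower κ hp) T fun t => toEnergy κ (u t)) :
    EvolvesOn (resolvent κ) (energyPower κ hp) T fun t => toEnergy κ (H1.reflect (u t)) := by
  simp only [← energyReflect_toEnergy]
  refine ⟨(energyReflect κ).continuous.comp_continuousOn h.1, fun t ht => ?_⟩
  have hd := ((energyReflect κ).restrictScalars ℝ).hasFDerivAt.comp_hasDerivWithinAt t (h.2 t ht)
  simp only [← energyReflect_resolvent]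
  refine hd.congr_deriv ?_
  rw [ContinuousLinearMap.coe_restrictScalars', map_smul, map_sub, map_sub,
    energyReflect_resolvent (energyPower κ hp _), energyPower_toEnergy, energyReflect_toEnergy,
    energyReflect_toEnergy, energyPower_toEnergy, H1.power_reflect]

theorem EvolvesOn.reflect_eq (hp : 5 ≤ p)
    (h : EvolvesOn (resolvent κ) (energyPower κ hp) T fun t => toEnergy κ (u t))
    (h0 : H1.reflect (u 0) = u 0) {t : ℝ} (ht : t ∈ Ico 0 T) : H1.reflect (u t) = u t :=
  (toEnergy κ).injective ((h.reflect hp).unique (isSelfAdjoint_resolvent κ) (injective_resolvent κ)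
    (isLocLip_energyPower κ hp) h (by simp only [h0]) ht)

theorem EvolvesOn.action_eq (hp : 5 ≤ p)
    (h : EvolvesOn (resolvent κ) (energyPower κ hp) T fun t => toEnergy κ (u t))
    {t : ℝ} (ht : t ∈ Ico 0 T) : (u t).action κ ω p = (u 0).action κ ω p := by
  rw [H1.action, H1.action, h.energy_eq hp ht, h.mass_eq hp ht]

/-- The sign of `pohozaev` is preserved below the action of the standing wave. -/
theorem EvolvesOn.pohozaev_le (hω : 0 < ω) (hp : 5 ≤ p) (hγ : γ ≤ 0) (hκ : κ ^ 2 = -γ)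
    (hc0 : c ≤ 0) (hc : solitonDeriv ω p c 0 = -(γ / 2) * soliton ω p c 0)
    (h : EvolvesOn (resolvent κ) (energyPower κ hp) T fun t => toEnergy κ (u t))
    (h0 : H1.reflect (u 0) = u 0) (hne : u 0 ≠ 0)
    (hS : (u 0).action κ ω p < (solitonH1 hω hp c).action κ ω p)
    (hP : (u 0).pohozaev κ p < 0) {t : ℝ} (ht : t ∈ Ico 0 T) : (u t).pohozaev κ p ≤
      -(2 * ((solitonH1 hω hp c).action κ ω p - (u 0).action κ ω p)) := by
  have hne' : ∀ s ∈ Ico 0 T, u s ≠ 0 := by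
    intro s hs h'
    have := h.mass_eq hp hs
    rw [h', map_zero, norm_zero] at this
    have h2 : (u 0).toL2 = 0 := by
      rw [← norm_eq_zero]
      exact pow_eq_zero_iff (two_ne_zero) |>.mp (by rw [← this]; simp)
    exact hne (H1.ext_toL2 (by rw [h2, map_zero]))
  have key : ∀ s ∈ Ico 0 T, (u s).pohozaev κ p ≤ 0 →
      (solitonH1 hω hp c).action κ ω p ≤ (u 0).action κ ω p - (u s).pohozaev κ p / 2 := by
    intro s hs hPs
    rw [← h.action_eq hp hs]
    exact action_solitonH1_le hω hp hγ hκ hc0 hc (h.reflect_eq hp h0 hs) (hne' s hs) hPs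
  have hneg : (u t).pohozaev κ p ≤ 0 := by
    by_contra! hpos
    have hcont : ContinuousOn (fun s => (u s).pohozaev κ p) (Icc 0 t) :=
      (continuous_pohozaev hp).comp_continuousOn
        (h.continuousOn_H1.mono fun s hs => ⟨hs.1, hs.2.trans_lt ht.2⟩)
    -- If `P` became positive it would vanish at some time `s`, where `key` would give `S(φ) ≤
    -- S(u(0))`.
    obtain ⟨s, hs, hs0⟩ := intermediate_value_Icc ht.1 hcont ⟨hP.le, hpos.le⟩
    have := key s ⟨hs.1, hs.2.trans_lt ht.2⟩ (le_of_eq hs0)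
    simp only at hs0
    rw [hs0] at this
    linarith
  have := key t ht hneg
  linarith

/-- The energy norm is controlled by mass and gradient, and the mass is conserved, so its blow-up is
that of the gradient. -/
theorem tendsto_norm_dx (hp : 5 ≤ p) (hT : 0 < T)
    (h : EvolvesOn (resolvent κ) (energyPower κ hp) T fun t => toEnergy κ (u t))
    (hlim : Tendsto (fun t => ‖toEnergy κ (u t)‖) (𝓝[<] T) atTop) :
    Tendsto (fun t => ‖(u t).dx‖) (𝓝[<] T) atTop := by
  rw [tendsto_atTop]
  intro b
  filter_upwards [hlim.eventually_gt_atTop (√((1 + κ ^ 2) * (‖(u 0).toL2‖ ^ 2 + b ^ 2))),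
    Ico_mem_nhdsLT hT] with t h1 ht
  by_contra! hb
  have hb0 : ‖(u t).dx‖ ^ 2 ≤ b ^ 2 := by gcongr
  have h2 : ‖toEnergy κ (u t)‖ ^ 2 ≤ (1 + κ ^ 2) * (‖(u 0).toL2‖ ^ 2 + b ^ 2) := by
    have h3 : ‖(u t).rep 0‖ ^ 2 ≤ ‖u t‖ ^ 2 := by gcongr; exact (u t).norm_rep_le 0
    calc ‖toEnergy κ (u t)‖ ^ 2 ≤ (1 + κ ^ 2) * ‖u t‖ ^ 2 := by
          rw [norm_sq_toEnergy]
          nlinarith [mul_le_mul_of_nonneg_left h3 (sq_nonneg κ)]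
      _ ≤ _ := by
          rw [H1.norm_sq_eq, h.mass_eq hp ht]
          gcongr
  have := (le_abs_self _).trans (Real.abs_le_sqrt h2)
  linarith

theorem blowsUpAt_of_evolvesOn (hp : 5 ≤ p) (hκ : κ ^ 2 = -γ) (hT : 0 < T)
    (h : EvolvesOn (resolvent κ) (energyPower κ hp) T fun t => toEnergy κ (u t))
    (hlim : Tendsto (fun t => ‖toEnergy κ (u t)‖) (𝓝[<] T) atTop) : BlowsUpAt γ p T (u 0) := by
  have hJ := isSelfAdjoint_resolvent κ
  have hi := injective_resolvent κ
  have hF := isLocLip_energyPower κ hp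
  refine ⟨u, (isSolution_iff hp hκ).mpr h, rfl, fun T' v hv hv0 => ?_, tendsto_norm_dx hp hT h hlim⟩
  rw [isSolution_iff hp hκ] at hv
  have hrestrict : ∀ {S S' : ℝ} {w : ℝ → EnergySpace κ}, S' ≤ S →
      EvolvesOn (resolvent κ) (energyPower κ hp) S w →
      EvolvesOn (resolvent κ) (energyPower κ hp) S' w := fun hS hw =>
    ⟨hw.1.mono (Ico_subset_Ico_right hS), fun t ht => hw.2 t (Ico_subset_Ico_right hS ht)⟩
  have hle : T' ≤ T := by
    -- A solution living beyond `T` would agree with `u` before `T` and be continuous at `T`,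
    -- contradicting the divergence of the norm.
    by_contra! hlt
    have heq := (hrestrict hlt.le hv).unique hJ hi hF h (by simp only [hv0])
    have hc := (hv.1 T ⟨hT.le, hlt⟩).norm
    have hc' : Tendsto (fun t => ‖toEnergy κ (v t)‖) (𝓝[<] T) (𝓝 ‖toEnergy κ (v T)‖) := by
      refine hc.mono_left (nhdsWithin_le_iff.mpr ?_)
      filter_upwards [Ico_mem_nhdsLT hT] with t ht using ⟨ht.1, ht.2.trans hlt⟩
    refine not_tendsto_nhds_of_tendsto_atTop hlim _ (hc'.congr' ?_)
    filter_upwards [Ico_mem_nhdsLT hT] with t ht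
    exact congrArg norm (heq ht)
  refine ⟨hle, fun t ht => ?_⟩
  exact (toEnergy κ).injective (hv.unique hJ hi hF (hrestrict hle h) (by simp only [hv0]) ht)

theorem exists_blowsUpAt (hω : 0 < ω) (hp : 5 ≤ p) (hγ : γ ≤ 0) (hκ : κ ^ 2 = -γ)
    (hc0 : c ≤ 0) (hc : solitonDeriv ω p c 0 = -(γ / 2) * soliton ω p c 0) {u₀ : H1}
    (h0 : H1.reflect u₀ = u₀) (hne : u₀ ≠ 0)
    (hS : u₀.action κ ω p < (solitonH1 hω hp c).action κ ω p) (hP : u₀.pohozaev κ p < 0)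
    (hre : ∀ x, (u₀.rep x).im = 0) (hre' : ∀ᵐ x, (u₀.dx x).im = 0)
    (hx : Integrable fun x => x ^ 2 * ‖u₀.rep x‖ ^ 2) : ∃ T, 0 < T ∧ BlowsUpAt γ p T u₀ := by
  rcases exists_maximal_evolution (isSelfAdjoint_resolvent κ) (injective_resolvent κ)
    (isLocLip_energyPower κ hp) (toEnergy κ u₀) with ⟨x, hx0, hev⟩ | ⟨T, hT, x, hx0, hev, hlim⟩
  · exfalso
    set u : ℝ → H1 := fun t => (toEnergy κ).symm (x t) with hu
    have hxu : x = fun t => toEnergy κ (u t) := by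
      funext t
      simp only [hu, ContinuousLinearEquiv.apply_symm_apply]
    have hu0 : u 0 = u₀ := by simp only [hu, hx0, ContinuousLinearEquiv.symm_apply_apply]
    rw [hxu] at hev
    rw [← hu0] at h0 hne hS hP hre hre' hx
    set δ := 2 * ((solitonH1 hω hp c).action κ ω p - (u 0).action κ ω p) with hδ
    have hδ0 : 0 < δ := by rw [hδ]; linarith
    have key : ∀ t : ℝ, 0 ≤ t → 4 * δ * t ^ 2 ≤ ∫ x, x ^ 2 * ‖(u 0).rep x‖ ^ 2 := fun t ht =>
      (hev (t + 1)).virial_inequality hp hre hre' hx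
        (fun s hs => (hev (t + 1)).pohozaev_le hω hp hγ hκ hc0 hc h0 hne hS hP hs)
        ⟨ht, lt_add_one t⟩
    have hV : 0 ≤ ∫ x, x ^ 2 * ‖(u 0).rep x‖ ^ 2 := integral_nonneg fun x => by positivity
    set V := ∫ x, x ^ 2 * ‖(u 0).rep x‖ ^ 2
    -- At the time `τ = V/δ + 1 ≥ 1` one has `4 δ τ² ≥ 4 (V + δ) > V`, which contradicts the virial
    -- bound.
    have h1 := key (V / δ + 1) (by positivity)
    have h2 : δ * (V / δ + 1) = V + δ := by field_simp
    have h3 : (1 : ℝ) ≤ V / δ + 1 := by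
      have : 0 ≤ V / δ := by positivity
      linarith
    nlinarith [mul_le_mul_of_nonneg_left h3 (by positivity : 0 ≤ δ * (V / δ + 1))]
  · set u : ℝ → H1 := fun t => (toEnergy κ).symm (x t) with hu
    have hxu : x = fun t => toEnergy κ (u t) := by
      funext t
      simp only [hu, ContinuousLinearEquiv.apply_symm_apply]
    have hu0 : u 0 = u₀ := by simp only [hu, hx0, ContinuousLinearEquiv.symm_apply_apply]
    rw [hxu] at hev hlim
    rw [← hu0]
    exact ⟨T, hT, blowsUpAt_of_evolvesOn hp hκ hT hev hlim⟩

/-- The quadratic part is multiplied by `μ²` and the potential by the larger factor `μ^(p+1)`. -/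
theorem pohozaev_smul_neg (hp : 5 ≤ p) {φ : H1} (hφ : φ ≠ 0) (h : φ.pohozaev κ p = 0) {μ : ℝ}
    (hμ : 1 < μ) : ((μ : ℂ) • φ).pohozaev κ p < 0 := by
  have hp1 : 0 < p + 1 := by linarith
  have hN := H1.potential_pos hp hφ
  rw [H1.pohozaev] at h ⊢
  have hμ0 : 0 ≤ μ := by linarith
  rw [map_smul, norm_smul, H1.rep_smul, Pi.smul_apply, norm_smul, Complex.norm_real,
    Real.norm_of_nonneg hμ0, H1.potential_smul p φ hμ0]
  have h1 : μ ^ 2 < μ ^ (p + 1) := by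
    rw [← Real.rpow_natCast]
    exact Real.rpow_lt_rpow_of_exponent_lt hμ (by push_cast; linarith)
  have hQ : 0 < (p - 1) / (2 * (p + 1)) * φ.potential p :=
    mul_pos (div_pos (by linarith) (by linarith)) hN
  nlinarith

/-- By the Nehari identity the quadratic part of the action along the ray is `μ² N/2`, and strict
Bernoulli with exponent `(p+1)/2` shows that the potential term more than compensates its growth. -/
theorem action_smul_lt (hp : 5 ≤ p) {φ : H1} (hφ : φ ≠ 0)
    (h : ‖φ.dx‖ ^ 2 + κ ^ 2 * ‖φ.rep 0‖ ^ 2 + ω * ‖φ.toL2‖ ^ 2 = φ.potential p) {μ : ℝ}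
    (hμ : 1 < μ) : ((μ : ℂ) • φ).action κ ω p < φ.action κ ω p := by
  have hp1 : 0 < p + 1 := by linarith
  have hN := H1.potential_pos hp hφ
  have hμ0 : 0 ≤ μ := by linarith
  rw [H1.action, H1.action, H1.energy, H1.energy, map_smul, map_smul, norm_smul, norm_smul,
    H1.rep_smul, Pi.smul_apply, norm_smul, Complex.norm_real, Real.norm_of_nonneg hμ0,
    H1.potential_smul p φ hμ0]
  have bern := one_add_mul_self_lt_rpow_one_add (s := μ ^ 2 - 1) (p := (p + 1) / 2)
    (by nlinarith) (by nlinarith) (by linarith)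
  have e1 : (1 + (μ ^ 2 - 1)) ^ ((p + 1) / 2) = μ ^ (p + 1) := by
    rw [add_sub_cancel, ← Real.rpow_natCast, ← Real.rpow_mul hμ0]
    congr 1; push_cast; ring
  rw [e1] at bern
  have h2 : (1 + (p + 1) / 2 * (μ ^ 2 - 1)) * φ.potential p / (p + 1) <
      μ ^ (p + 1) * φ.potential p / (p + 1) := by gcongr
  have h3 : (1 + (p + 1) / 2 * (μ ^ 2 - 1)) * φ.potential p / (p + 1) =
      φ.potential p / (p + 1) + (μ ^ 2 - 1) / 2 * φ.potential p := by field_simp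
  rw [h3] at h2
  have h4 : (((μ * ‖φ.dx‖) ^ 2 + κ ^ 2 * (μ * ‖φ.rep 0‖) ^ 2) / 2 + ω / 2 * (μ * ‖φ.toL2‖) ^ 2) =
      μ ^ 2 / 2 * φ.potential p := by rw [← h]; ring
  linarith

theorem isStronglyUnstable_solitonH1 (hω : 0 < ω) (hp : 5 ≤ p) (hγ : γ ≤ 0) (hc0 : c ≤ 0)
    (hc : solitonDeriv ω p c 0 = -(γ / 2) * soliton ω p c 0) :
    IsStronglyUnstable γ ω p (solitonH1 hω hp c) := by
  have hst := isStandingWave_solitonH1 hω hp hc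
  refine ⟨hst, fun ε hε => ?_⟩
  set φ := solitonH1 hω hp c with hφ
  have hκ : √(-γ) ^ 2 = -γ := Real.sq_sqrt (by linarith)
  set κ := √(-γ)
  have hφ0 : φ ≠ 0 := hst.1
  have hn : 0 < ‖φ‖ := norm_pos_iff.mpr hφ0
  -- With this `μ` the distance from `μ φ` to `φ` is `ε/2`.
  set μ : ℝ := 1 + ε / (2 * ‖φ‖) with hμ
  have hμ1 : 1 < μ := by
    have : 0 < ε / (2 * ‖φ‖) := by positivity
    linarith
  have hre : ∀ x, (φ.rep x).im = 0 := fun x => by rw [hφ, rep_solitonH1, Complex.ofReal_im]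
  refine ⟨(μ : ℂ) • φ, ?_, ?_⟩
  · have : (μ : ℂ) • φ - φ = ((μ - 1 : ℝ) : ℂ) • φ := by
      push_cast
      rw [sub_smul, one_smul]
    rw [this, norm_smul, Complex.norm_real, Real.norm_of_nonneg (by linarith), hμ,
      add_sub_cancel_left]
    have : ε / (2 * ‖φ‖) * ‖φ‖ = ε / 2 := by field_simp
    linarith
  · refine exists_blowsUpAt hω hp hγ hκ hc0 hc ?_ ?_ ?_ ?_ ?_ ?_ ?_
    · rw [map_smul, hφ, reflect_solitonH1]
    · exact smul_ne_zero (by rw [Ne, Complex.ofReal_eq_zero]; linarith) hφ0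
    · exact action_smul_lt hp hφ0 (hst.nehari hp hκ) hμ1
    · exact pohozaev_smul_neg hp hφ0 (pohozaev_solitonH1 hω hp hκ hc) hμ1
    · intro x
      rw [H1.rep_smul, Pi.smul_apply, smul_eq_mul, Complex.im_ofReal_mul, hre, mul_zero]
    · rw [map_smul]
      filter_upwards [Lp.coeFn_smul (μ : ℂ) φ.dx, dx_solitonH1_ae hω hp c] with x h1 h2
      rw [h1, Pi.smul_apply, smul_eq_mul, Complex.im_ofReal_mul, hφ, h2, Complex.ofReal_im,
        mul_zero]
    · have := (integrable_sq_mul_solitonH1 hω hp c).const_mul (μ ^ 2)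
      refine this.congr (Eventually.of_forall fun x => ?_)
      simp only
      rw [H1.rep_smul, Pi.smul_apply, norm_smul, Complex.norm_real, mul_pow, Real.norm_eq_abs,
        sq_abs, ← hφ]
      ring

end Instability

end DeltaNLS

end

theorem theorem2 (γ ω p : ℝ) (hγ : γ ≤ 0) (hω : γ ^ 2 / 4 < ω) (hp : 5 ≤ p) :
    ∃ φ : DeltaNLS.H1, (∀ x : ℝ, φ.rep x = (DeltaNLS.profile γ ω p x : ℂ)) ∧
      DeltaNLS.IsStronglyUnstable γ ω p φ := by
  have hω0 : 0 < ω := lt_of_le_of_lt (by positivity) hω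
  refine ⟨DeltaNLS.solitonH1 hω0 hp (Real.artanh (γ / (2 * √ω))), fun x => ?_,
    DeltaNLS.isStronglyUnstable_solitonH1 hω0 hp hγ ?_ (DeltaNLS.solitonDeriv_zero hω0 hω)⟩
  · rw [DeltaNLS.rep_solitonH1, DeltaNLS.profile_eq]
  · exact Real.artanh_nonpos (div_nonpos_of_nonpos_of_nonneg hγ (by positivity))
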